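/- **Setting.** Let $n\ge 1$ and let $\Sigma=\overline\Omega$ for a bounded open $\Omega\subset\mathbb R^n$, $\partial\Sigma=\partial\Omega$. The fields at a fixed time are smooth functions $z^A$ ($A=1,\dots,m$) and $\overset{(l)}{\lambda}{}^a$ ($a=1,\dots,c$, $l\ge 0$; the time derivatives of the Lagrange multipliers $\lambda^a=\overset{(0)}\lambda{}^a$, treated as independent fields). A *local function* is a smooth function of $t$, $x$ and finitely many spatial derivatives of the fields; $\partial_i$ are total derivatives, $\frac{\delta}{\delta z^A},\frac{\delta}{\delta \overset{(l)}\lambda{}^a}$ the Euler operators, and functionals are integrals over $\Sigma$ of local functions (boundary terms $\oint_{\partial\Sigma}(d^{n-1}x)_iK^i$ being the integrals of total divergences $\partial_iK^i$). Consider the gauge theory $$S=\int dt\Big\{\int_\Sigma \tfrac12 z^A\sigma_{AB}\dot z^B-H\Big\},\qquad H=\int_\Sigma (h(z)+\lambda^a\phi_a(z))+\oint_{\partial\Sigma} b_H(z,\lambda),$$ with $\sigma^{AB}$ constant, antisymmetric and invertible with inverse $\sigma_{AB}$, and with $h,\phi_a$ first class (their brackets with the smeared constraints, locally, are combinations of the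 $\phi_a$ and their derivatives). Write $\{F,G\}=\int_\Sigma\frac{\delta F}{\delta z^A}\sigma^{AB}\frac{\delta G}{\delta z^B}$ and $\delta_t=\partial_t+\delta_H$ with $\delta_Hz^A=\sigma^{AB}\frac{\delta H}{\delta z^B}$, $\delta_H\overset{(l)}\lambda{}^a=\overset{(l+1)}\lambda{}^a$. *Boundary conditions.* The external boundary conditions are $\partial_{(i)}\phi_a|_{\partial\Sigma}=0$ and $\partial_{(i)}(\dot z^A-\sigma^{AB}\frac{\delta H}{\delta z^B})|_{\partial\Sigma}=0$ for all multi-indices $(i)$; configurations satisfying the first are called admissible. The internal ones are $\chi_I^\alpha(z,\lambda)|_{\partial\Sigma}=\zeta^\alpha$ with local $\chi_I^\alpha$ and boundary fields $\zeta^\alpha$. A variation (with local characteristics) preserves the external conditions if it is tangent to the set of admissible configurations, that is, annihilates, on admissible configurations, every local function on $\partial\Sigma$ and every local functional vanishing on all admissible configurations; it preserves the internal conditions if moreover it annihilates all $\delta_t^k\chi_I^\alpha|_{\partial\Sigma}$, $k\ge0$, on admissible configurations. A functional $K$ *depends only on $\zeta$* if $\delta K=0$ on admissible configurations for all $\delta$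 preserving the internal conditions. It is assumed that $\delta_H$ preserves the external conditions and that $\delta H=\int_\Sigma(\frac{\delta H}{\delta z^A}\delta z^A+\phi_a\delta\lambda^a)$ for all $\delta$ preserving the internal conditions. Equalities of functionals are on admissible configurations; $F\approx0$ means that $F$ vanishes whenever $\phi_a=0$ on $\Sigma$. *External symmetries.* For a transformation $\tau$: $\delta z^A=Z^A$, $\delta\lambda^a=\Lambda^a$ with local $Z^A,\Lambda^a$, let $\tilde\delta z^A=Z^A$, $\tilde\delta\overset{(l)}\lambda{}^a=\delta_t^l\Lambda^a$. A couple $(G,\delta^\lambda_G)$, with $G$ a functional of $(t,z,\lambda,\dot\lambda,\dots)$ and $\delta^\lambda_G\lambda^a=\Lambda^a$, defines such a transformation with $Z^A=\sigma^{AB}\frac{\delta G}{\delta z^B}$. It *generates an external symmetry* if $\tilde\delta_G$ preserves the external conditions, if for all $\delta$ preserving the internal conditions $$[\delta_G,\delta]\chi_I^\alpha|_{\partial\Sigma}=0,\qquad \delta G=\int_\Sigma\Big(\frac{\delta G}{\delta z^A}\delta z^A+\sum_l\frac{\delta G}{\delta\overset{(l)}\lambda{}^a}\delta\overset{(l)}\lambda{}^a\Big),$$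 and if there is a boundary term $\oint V_G$ depending only on $\zeta$ such that the Lagrangian $L=\int_\Sigma\frac12z^A\sigma_{AB}\dot z^B-H$ satisfies $\delta_GL=\frac{d}{dt}\big(\int_\Sigma\frac12z^A\sigma_{AB}Z^B-G\big)+\oint_{\partial\Sigma}V_G$ whenever the external conditions hold. It is a *proper gauge couple* if moreover $\delta_G\chi_I^\alpha|_{\partial\Sigma}=0$ and $G\approx0$; the transformations generated by such couples are the proper gauge transformations. Put $$[(G_1,\delta_1^\lambda),(G_2,\delta_2^\lambda)]=(\{G_2,G_1\}_g,\delta^\lambda_{[1,2]}),\quad \{G_2,G_1\}_g=\tilde\delta_1G_2-\tilde\delta_2G_1-\{G_2,G_1\},\quad \delta^\lambda_{[1,2]}\lambda^a=\tilde\delta_1\Lambda_2^a-\tilde\delta_2\Lambda_1^a,$$ and define the bracket $\delta_{[1,2]}$ of two transformations (their commutator up to a trivial symmetry) by $\delta_{[1,2]}\lambda^a=\delta^\lambda_{[1,2]}\lambda^a$ and $$\delta_{[1,2]}z^A=\tilde\delta_1Z_2^A+\sum_{l\ge1}\sum_{k=0}^{l-1}\sigma^{AD}(-\partial)_{(j)}\Big[\frac{\partial(\delta_t^k\Lambda_1^b)}{\partial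 z^D_{(j)}}\,(-\delta_t)^{l-1-k}\frac{\delta(\phi_a\Lambda_2^a)}{\delta\overset{(l)}\lambda{}^b}\Big]-(1\leftrightarrow2).$$ **Theorem.** (i) If two couples generate the external symmetries $\delta_1,\delta_2$, their bracket generates the external symmetry $\delta_{[1,2]}$. (ii) Let $\mathcal G$ be a linear space of external symmetries closed under $[\cdot,\cdot]$, and let $\delta_i\mapsto(G_i,\delta_i^\lambda)$ be a linear choice of generating couples for the elements of $\mathcal G$, with $G_i\approx0$ whenever $\delta_i$ is a proper gauge transformation. Then there are boundary terms $K_{1,2}=\oint_{\partial\Sigma}(d^{n-1}x)_iK^i_{1,2}$, depending only on $\zeta$, such that for all $\delta_1,\delta_2,\delta_3\in\mathcal G$ $$[(G_1,\delta_1^\lambda),(G_2,\delta_2^\lambda)]=(G_{[1,2]}+K_{1,2},\delta^\lambda_{[1,2]}),\qquad K_{1,2}=-K_{2,1},$$ $$K_{[1,2],3}-\tilde\delta_3K_{1,2}+\text{cyclic}\approx0 ,$$ where the left-hand side of the last formula is again a boundary term depending only on $\zeta$ (so that it vanishes as a functional of the boundary fields of configurations obeying the constraints). (iii) The resulting (possibly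 non-central) extension is abelian, with the following bracket: for all boundary terms $k_1,k_2$ depending only on $\zeta$, $\tilde\delta_1k_2$ is again such a boundary term and the functional in $[(G_1+k_1,\delta_1^\lambda),(G_2+k_2,\delta_2^\lambda)]$ is $G_{[1,2]}+K_{1,2}+\tilde\delta_1k_2-\tilde\delta_2k_1$. -/

import Mathlib

open MeasureTheory
open scoped ContDiff

noncomputable section

namespace BoundaryGauge

/-! ## Jet space and local functions -/

/-- Space coordinates. -/
abbrev Space (n : ℕ) := EuclideanSpace ℝ (Fin n)

/-- Multi-indices `(i)` for spatial derivatives. -/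
abbrev MultiIdx (n : ℕ) := Fin n → ℕ

/-- Field labels at a fixed time: `inl A` is the canonical field `z^A`, and `inr (l, a)` is the
`l`-th time derivative of the Lagrange multiplier `λ^a`. -/
abbrev FieldIdx (m c : ℕ) := Fin m ⊕ (ℕ × Fin c)

/-- Labels of the jet coordinates: the coordinate `(s, I)` stands for `∂_I` of the field `s`. -/
abbrev JetIdx (n m c : ℕ) := FieldIdx m c × MultiIdx n

/-- Functions of the time, of the position, and of the jet coordinates. -/
abbrev JetFn (n m c : ℕ) := ℝ × Space n × (JetIdx n m c → ℝ) → ℝ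

/-- Local functions: smooth, and depending on finitely many jet coordinates. -/
def IsLocal {n m c : ℕ} (f : JetFn n m c) : Prop :=
  ∃ (S : Finset (JetIdx n m c)) (g : ℝ × Space n × (S → ℝ) → ℝ),
    ContDiff ℝ ∞ g ∧ ∀ t x u, f (t, x, u) = g (t, x, fun j => u j)

/-- `D^I = D_0^{I_0} ⋯ D_{n-1}^{I_{n-1}}` for a family `D` of operators. -/
def iterOp {n : ℕ} {α : Type} (D : Fin n → α → α) (I : MultiIdx n) (f : α) : α :=
  (List.finRange n).foldr (fun i h => (D i)^[I i] h) f

/-- The sign `(-1)^{|I|}`. -/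
def sgn {n : ℕ} (I : MultiIdx n) : ℝ := (-1) ^ (∑ i, I i)

/-- Partial derivative of a function of the position. -/
def partialX {n : ℕ} (i : Fin n) (f : Space n → ℝ) : Space n → ℝ :=
  fun x => fderiv ℝ f x (EuclideanSpace.single i 1)

/-- Derivative with respect to the explicit time. -/
def pdT {n m c : ℕ} (f : JetFn n m c) : JetFn n m c :=
  fun p => deriv (fun s => f (s, p.2.1, p.2.2)) p.1

/-- Derivative with respect to the explicit position. -/
def pdX {n m c : ℕ} (i : Fin n) (f : JetFn n m c) : JetFn n m c :=
  fun p => partialX i (fun x => f (p.1, x, p.2.2)) p.2.1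

/-- Derivative with respect to a jet coordinate. -/
def pdU {n m c : ℕ} (j : JetIdx n m c) (f : JetFn n m c) : JetFn n m c :=
  fun p => deriv (fun s => f (p.1, p.2.1, Function.update p.2.2 j s)) (p.2.2 j)

/-- The jet coordinate `j` as a function. -/
def coord {n m c : ℕ} (j : JetIdx n m c) : JetFn n m c := fun p => p.2.2 j

/-- The total spatial derivative `∂_i`. -/
def totalD {n m c : ℕ} (i : Fin n) (f : JetFn n m c) : JetFn n m c :=
  fun p => pdX i f p + ∑ᶠ j : JetIdx n m c, p.2.2 (j.1, j.2 + Pi.single i 1) * pdU j f p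

/-- The iterated total derivative `∂_I`. -/
def totalDs {n m c : ℕ} (I : MultiIdx n) (f : JetFn n m c) : JetFn n m c :=
  iterOp totalD I f

/-- The total divergence of a current; its integral over the region is the boundary term
`∮ (d^{n-1}x)_i k^i`. -/
def divergence {n m c : ℕ} (k : Fin n → JetFn n m c) : JetFn n m c :=
  fun p => ∑ i, totalD i (k i) p

/-- The variational derivative (Euler operator)
`δf/δu^s = ∑_I (-∂)_I (∂f/∂u^s_I)`. -/
def euler {n m c : ℕ} (s : FieldIdx m c) (f : JetFn n m c) : JetFn n m c :=
  fun p => ∑ᶠ I : MultiIdx n, sgn I * totalDs I (pdU (s, I) f) p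

/-- Formal adjoint of the linearization of `P` in `z^D`, applied to `v`:
`∑_J (-∂)_J (∂P/∂z^D_J · v)`. -/
def adjLin {n m c : ℕ} (D : Fin m) (P v : JetFn n m c) : JetFn n m c :=
  fun p => ∑ᶠ J : MultiIdx n, sgn J * totalDs J (fun q => pdU (Sum.inl D, J) P q * v q) p

/-- A (field dependent) variation at fixed time, given by its characteristics. -/
abbrev Variation (n m c : ℕ) := FieldIdx m c → JetFn n m c

/-- Action of a variation on functions: `∑_{s,I} ∂_I Q^s ∂f/∂u^s_I`. -/
def vary {n m c : ℕ} (Q : Variation n m c) (f : JetFn n m c) : JetFn n m c :=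
  fun p => ∑ᶠ j : JetIdx n m c, totalDs j.2 (Q j.1) p * pdU j f p

/-! ## Configurations -/

/-- Field configurations at a fixed time. The time derivatives of the multipliers are independent
fields. -/
abbrev Config (n m c : ℕ) := FieldIdx m c → Space n → ℝ

/-- The jet of a configuration at a point. -/
def jet {n m c : ℕ} (u : Config n m c) (x : Space n) : JetIdx n m c → ℝ :=
  fun j => iterOp partialX j.2 (u j.1) x

/-- A function of the jets, evaluated on a configuration. -/
def ev {n m c : ℕ} (f : JetFn n m c) (t : ℝ) (u : Config n m c) : Space n → ℝ :=
  fun x => f (t, x, jet u x)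

/-- Functions that depend on the position and on the canonical fields only. -/
def OnlyZ {n m c : ℕ} (f : JetFn n m c) : Prop :=
  ∀ t t' x u u', (∀ A I, u (Sum.inl A, I) = u' (Sum.inl A, I)) → f (t, x, u) = f (t', x, u')

/-- Functions that depend on the position, the canonical fields and the multipliers only (neither
on the explicit time nor on time derivatives of the multipliers). -/
def OnlyZLam {n m c : ℕ} (f : JetFn n m c) : Prop :=
  ∀ t t' x u u', (∀ A I, u (Sum.inl A, I) = u' (Sum.inl A, I)) →
    (∀ a I, u (Sum.inr (0, a), I) = u' (Sum.inr (0, a), I)) → f (t, x, u) = f (t', x, u')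

/-- A couple `(G, δ^λ_G)`: the density of the functional `G`, and `Λ^a = δ^λ_G λ^a`. -/
abbrev Couple (n m c : ℕ) := JetFn n m c × (Fin c → JetFn n m c)

/-- A transformation `δz^A = Z^A`, `δλ^a = Λ^a`. -/
abbrev Transf (n m c : ℕ) := (Fin m → JetFn n m c) × (Fin c → JetFn n m c)

/-! ## The data of a gauge field theory and the operators built from them -/

/-- The data of a gauge field theory: the region `Ω` (`Σ` is its closure), the Poisson structure
`σ^{AB}`, the bulk hamiltonian density `h`, the constraints `φ_a`, the boundary term `b_H` of the
hamiltonian and the operators `χ_I^α` whose boundary values are the boundary fields `ζ^α`. -/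
structure GaugeData (n m c r : ℕ) where
  Ω : Set (Space n)
  σ : Matrix (Fin m) (Fin m) ℝ
  h : JetFn n m c
  φ : Fin c → JetFn n m c
  b : Fin n → JetFn n m c
  χ : Fin r → JetFn n m c

namespace GaugeData

variable {n m c r : ℕ} (T : GaugeData n m c r)

/-- The functional `∫_Σ f d^nx`. -/
def functional (f : JetFn n m c) (t : ℝ) (u : Config n m c) : ℝ := ∫ x in T.Ω, ev f t u x

/-- The density of `H = ∫ (h + λ^a φ_a) + ∮ b_H`. -/
def H : JetFn n m c :=
  fun p => T.h p + (∑ a, p.2.2 (Sum.inr (0, a), 0) * T.φ a p) + divergence T.b p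

/-- `σ^{AB} δG/δz^B`. -/
def ham (G : JetFn n m c) (A : Fin m) : JetFn n m c :=
  fun p => ∑ B, T.σ A B * euler (Sum.inl B) G p

/-- The variation of `z` generated by `G`, the multipliers being kept fixed. -/
def hamVar (G : JetFn n m c) : Variation n m c := Sum.elim (T.ham G) (fun _ _ => 0)

/-- The density of the unmodified Poisson bracket `{F, G}`. -/
def poisson (F G : JetFn n m c) : JetFn n m c :=
  fun p => ∑ A, ∑ B, euler (Sum.inl A) F p * T.σ A B * euler (Sum.inl B) G p

/-- The field part of the time evolution: `δ_H z^A = σ^{AB} δH/δz^B` and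
`λ^{(l)} ↦ λ^{(l+1)}`. -/
def flow : Variation n m c :=
  Sum.elim (T.ham T.H) (fun la => coord (Sum.inr (la.1 + 1, la.2), 0))

/-- `δ_t = ∂/∂t + δ_H`. -/
def dt (f : JetFn n m c) : JetFn n m c := fun p => pdT f p + vary T.flow f p

/-- The variation `δ̃`: `δ̃ z^A = Z^A`, `δ̃ λ^{(l)a} = δ_t^l Λ^a`. -/
def tilde (τ : Transf n m c) : Variation n m c :=
  Sum.elim τ.1 (fun la => T.dt^[la.1] (τ.2 la.2))

/-- The transformation generated by a couple. -/
def trans (C : Couple n m c) : Transf n m c := (T.ham C.1, C.2)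

/-- The bracket of couples: `[(G₁, δ₁^λ), (G₂, δ₂^λ)] = ({G₂, G₁}_g, δ^λ_{[1,2]})` with
`{G₂, G₁}_g = δ̃₁ G₂ - δ̃₂ G₁ - {G₂, G₁}` and
`δ^λ_{[1,2]} λ^a = δ̃₁ Λ₂^a - δ̃₂ Λ₁^a`. -/
def coupleBracket (C₁ C₂ : Couple n m c) : Couple n m c :=
  (fun p => vary (T.tilde (T.trans C₁)) C₂.1 p - vary (T.tilde (T.trans C₂)) C₁.1 p
      - T.poisson C₂.1 C₁.1 p,
    fun a p => vary (T.tilde (T.trans C₁)) (C₂.2 a) p - vary (T.tilde (T.trans C₂)) (C₁.2 a) p)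

/-- The part of `δ_{[1,2]} z^A` that is antisymmetrized in `bracket`. -/
def halfBracket (τ₁ τ₂ : Transf n m c) (A : Fin m) : JetFn n m c :=
  fun p => vary (T.tilde τ₁) (τ₂.1 A) p +
    ∑ᶠ l : ℕ, ∑ k ∈ Finset.range l, ∑ D, ∑ b, T.σ A D *
      adjLin D (T.dt^[k] (τ₁.2 b))
        ((fun f => -T.dt f)^[l - 1 - k]
          (euler (Sum.inr (l, b)) (fun q => ∑ a, T.φ a q * τ₂.2 a q))) p

/-- The bracket `δ_{[1,2]}` of transformations, i.e. the commutator `[δ₁, δ₂]` from which the time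
derivatives of the canonical fields have been removed by a trivial symmetry. -/
def bracket (τ₁ τ₂ : Transf n m c) : Transf n m c :=
  (fun A p => T.halfBracket τ₁ τ₂ A p - T.halfBracket τ₂ τ₁ A p,
    fun a p => vary (T.tilde τ₁) (τ₂.2 a) p - vary (T.tilde τ₂) (τ₁.2 a) p)

/-! ## Boundary conditions and variations -/

/-- The external boundary conditions on a configuration at fixed time: the constraints and all
their derivatives vanish on the boundary. (The remaining ones, the equations of motion on the
boundary, restrict the velocities, see `VelocityAdm`.) -/
def Adm (u : Config n m c) : Prop :=
  (∀ s, ContDiff ℝ ∞ (u s)) ∧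
    ∀ a I t, ∀ x ∈ frontier T.Ω, ev (totalDs I (T.φ a)) t u x = 0

/-- The external boundary conditions on the velocity `v = ż` at `(t, u)`: all derivatives of
`ż^A - σ^{AB} δH/δz^B` vanish on the boundary. -/
def VelocityAdm (t : ℝ) (u : Config n m c) (v : Fin m → Space n → ℝ) : Prop :=
  (∀ A, ContDiff ℝ ∞ (v A)) ∧
    ∀ A I, ∀ x ∈ frontier T.Ω, iterOp partialX I (fun y => v A y - ev (T.ham T.H A) t u y) x = 0

/-- The constraint surface. -/
def OnShell (u : Config n m c) : Prop :=
  T.Adm u ∧ ∀ a t, ∀ x ∈ closure T.Ω, ev (T.φ a) t u x = 0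

/-- The variation `Q` preserves the external boundary conditions, i.e. it is tangent to the set of
admissible configurations: every local condition on the boundary fields, and every equation
`∫ f = 0`, that holds on all admissible configurations is preserved by `Q` to first order. In
particular `Q (∂_I φ_a) = 0` on the boundary. -/
def PreservesExternal (Q : Variation n m c) : Prop :=
  (∀ s, IsLocal (Q s)) ∧
  (∀ f, IsLocal f → (∀ t u, T.Adm u → ∀ x ∈ frontier T.Ω, ev f t u x = 0) →
    ∀ t u, T.Adm u → ∀ x ∈ frontier T.Ω, ev (vary Q f) t u x = 0) ∧
  (∀ f, IsLocal f → (∀ t u, T.Adm u → T.functional f t u = 0) →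
    ∀ t u, T.Adm u → T.functional (vary Q f) t u = 0)

/-- The variation `Q` preserves the internal boundary conditions `χ_I^α = ζ^α` (at all times: at
fixed time this means that the time derivatives `δ_t^k χ_I^α` are preserved as well), and the
external ones. -/
def PreservesInternal (Q : Variation n m c) : Prop :=
  T.PreservesExternal Q ∧
    ∀ k α t u, T.Adm u → ∀ x ∈ frontier T.Ω, ev (vary Q (T.dt^[k] (T.χ α))) t u x = 0

/-- `f` is, on the region, a combination of the constraints and their derivatives. -/
def InConstraintIdeal (f : JetFn n m c) : Prop :=
  ∃ (S : Finset (Fin c × MultiIdx n)) (k : Fin c × MultiIdx n → JetFn n m c),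
    (∀ j, IsLocal (k j)) ∧
    ∀ t, ∀ x ∈ T.Ω, ∀ u, f (t, x, u) = ∑ j ∈ S, k j (t, x, u) * totalDs j.2 (T.φ j.1) (t, x, u)

end GaugeData

/-- A gauge field theory with action
`S = ∫ dt { ∫_Σ ½ z^A σ_{AB} ż^B - H[z, λ] }`. -/
structure GaugeTheory (n m c r : ℕ) extends GaugeData n m c r where
  dim_pos : 0 < n
  isOpen : IsOpen Ω
  bounded : Bornology.IsBounded Ω
  σ_antisymm : σ.transpose = -σ
  σ_unit : IsUnit σ.det
  h_local : IsLocal h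
  h_only : OnlyZ h
  φ_local : ∀ a, IsLocal (φ a)
  φ_only : ∀ a, OnlyZ (φ a)
  b_local : ∀ i, IsLocal (b i)
  b_only : ∀ i, OnlyZLam (b i)
  χ_local : ∀ α, IsLocal (χ α)
  χ_only : ∀ α, OnlyZLam (χ α)
  /-- The constraints are first class; the multipliers serve as smearing functions. -/
  φ_firstClass : ∀ a, toGaugeData.InConstraintIdeal
    (vary (toGaugeData.hamVar (fun p => ∑ b, p.2.2 (Sum.inr (0, b), 0) * φ b p)) (φ a))
  /-- The hamiltonian `h` is first class. -/
  h_firstClass : ∀ a, toGaugeData.InConstraintIdeal (vary (toGaugeData.hamVar h) (φ a))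
  /-- The time evolution is compatible with the external boundary conditions. -/
  flow_preserves : toGaugeData.PreservesExternal toGaugeData.flow
  /-- The hamiltonian has a well-defined variation. -/
  H_variation : ∀ Q, toGaugeData.PreservesInternal Q → ∀ t u, toGaugeData.Adm u →
    toGaugeData.functional (vary Q toGaugeData.H) t u =
      toGaugeData.functional (fun p =>
        (∑ A, euler (Sum.inl A) toGaugeData.H p * Q (Sum.inl A) p) +
          ∑ a, φ a p * Q (Sum.inr (0, a)) p) t u

namespace GaugeTheory

variable {n m c r : ℕ} (T : GaugeTheory n m c r)

/-- Equality of functionals on admissible configurations. -/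
def FunctionalEq (F G : JetFn n m c) : Prop :=
  ∀ t u, T.Adm u → T.functional F t u = T.functional G t u

/-- `F ≈ 0`: the functional vanishes on the constraint surface. -/
def WeaklyZero (F : JetFn n m c) : Prop :=
  ∀ t u, T.OnShell u → T.functional F t u = 0

/-- The functional is unchanged by all variations that preserve the internal boundary conditions:
it depends on the fields through the boundary fields `ζ` only. -/
def DependsOnlyOnZeta (K : JetFn n m c) : Prop :=
  ∀ Q, T.PreservesInternal Q → ∀ t u, T.Adm u → T.functional (vary Q K) t u = 0

/-- Boundary terms `∮ (d^{n-1}x)_i K^i` that depend on the boundary fields `ζ` only. -/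
def IsBoundaryFunctional (K : JetFn n m c) : Prop :=
  IsLocal K ∧ T.DependsOnlyOnZeta K ∧
    ∃ k : Fin n → JetFn n m c, (∀ i, IsLocal (k i)) ∧ T.FunctionalEq K (divergence k)

/-- The configuration reached from `u` after the time `s` with the constant velocity
`ż = v`, `d/dt λ^{(l)} = λ^{(l+1)}`. -/
def advance (u : Config n m c) (v : Fin m → Space n → ℝ) (s : ℝ) : Config n m c :=
  Sum.elim (fun A x => u (Sum.inl A) x + s * v A x)
    (fun la x => u (Sum.inr la) x + s * u (Sum.inr (la.1 + 1, la.2)) x)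

/-- The variation of the Lagrangian `∫_Σ ½ z^A σ_{AB} ż^B - H` under the transformation generated
by the couple `C`, at the time `t`, the configuration `u` and the velocity `ż = v`. -/
def lagrangianVariation (C : Couple n m c) (t : ℝ) (u : Config n m c)
    (v : Fin m → Space n → ℝ) : ℝ :=
  (∫ x in T.Ω, ∑ A, ∑ B, (1 / 2 : ℝ) * T.σ⁻¹ A B *
      (ev (T.ham C.1 A) t u x * v B x + u (Sum.inl A) x *
        deriv (fun s => ev (T.ham C.1 B) (t + s) (advance u v s) x) 0)) -
    T.functional (vary (T.tilde (T.trans C)) T.H) t u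

/-- The density of `½ z^A σ_{AB} Z^B - G`. -/
def totalDerivTerm (C : Couple n m c) : JetFn n m c :=
  fun p => (∑ A, ∑ B, (1 / 2 : ℝ) * T.σ⁻¹ A B * coord (Sum.inl A, 0) p * T.ham C.1 B p) - C.1 p

/-- The couple `(G, δ^λ_G)` generates an external symmetry of the action. -/
structure ExternalCouple (C : Couple n m c) : Prop where
  local_G : IsLocal C.1
  local_Λ : ∀ a, IsLocal (C.2 a)
  /-- The external boundary conditions are preserved. -/
  preserves : T.PreservesExternal (T.tilde (T.trans C))
  /-- `[δ_G, δ] χ_I^α = 0` on the boundary: the variation of the boundary fields depends on the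
  boundary fields only. -/
  sources : ∀ Q, T.PreservesInternal Q → ∀ α t u, T.Adm u → ∀ x ∈ frontier T.Ω,
    ev (vary (T.tilde (T.trans C)) (vary Q (T.χ α))) t u x -
      ev (vary Q (vary (T.tilde (T.trans C)) (T.χ α))) t u x = 0
  /-- `G` has a well-defined variation. -/
  differentiable : ∀ Q, T.PreservesInternal Q → ∀ t u, T.Adm u →
    T.functional (vary Q C.1) t u =
      T.functional (fun p => ∑ᶠ s : FieldIdx m c, euler s C.1 p * Q s p) t u
  /-- `δ_G L = d/dt (∫ ½ z^A σ_{AB} Z^B - G) + ∮ V` where `∮ V` depends on the boundary fields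
  only. -/
  invariance : ∃ V : Fin n → JetFn n m c, (∀ i, IsLocal (V i)) ∧
    T.DependsOnlyOnZeta (divergence V) ∧
    ∀ t u v, T.Adm u → T.VelocityAdm t u v →
      T.lagrangianVariation C t u v =
        deriv (fun s => T.functional (T.totalDerivTerm C) (t + s) (advance u v s)) 0 +
          T.functional (divergence V) t u

/-- Two transformations agree on `Σ`. -/
def SameTransf (τ τ' : Transf n m c) : Prop :=
  ∀ t u, T.Adm u → ∀ x ∈ closure T.Ω,
    (∀ A, ev (τ.1 A) t u x = ev (τ'.1 A) t u x) ∧ ∀ a, ev (τ.2 a) t u x = ev (τ'.2 a) t u x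

/-- The couple `C` generates the external symmetry `τ`. -/
def Generates (C : Couple n m c) (τ : Transf n m c) : Prop :=
  T.ExternalCouple C ∧ (∀ A, IsLocal (τ.1 A)) ∧ (∀ a, IsLocal (τ.2 a)) ∧
    T.SameTransf (T.trans C) τ

/-- Couples generating proper gauge transformations: external symmetries that preserve the internal
boundary conditions, with a generator that vanishes on the constraint surface. -/
def ProperGaugeCouple (C : Couple n m c) : Prop :=
  T.ExternalCouple C ∧
    (∀ α t u, T.Adm u → ∀ x ∈ frontier T.Ω,
      ev (vary (T.tilde (T.trans C)) (T.χ α)) t u x = 0) ∧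
    T.WeaklyZero C.1

/-- Proper gauge transformations. -/
def IsProperGauge (τ : Transf n m c) : Prop :=
  ∃ C, T.ProperGaugeCouple C ∧ T.Generates C τ

/-- `G` is a generating set for the algebra `𝒢` of external symmetries: `𝒢` is a space of
transformations closed under the bracket, and `G` chooses, linearly, a couple generating each of
them; proper gauge transformations are represented by proper gauge generators. -/
structure IsGeneratingSet (𝒢 : Submodule ℝ (Transf n m c))
    (G : Transf n m c → Couple n m c) : Prop where
  bracket_mem : ∀ τ₁ ∈ 𝒢, ∀ τ₂ ∈ 𝒢, T.bracket τ₁ τ₂ ∈ 𝒢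
  generates : ∀ τ ∈ 𝒢, T.Generates (G τ) τ
  linear : ∀ τ ∈ 𝒢, ∀ τ' ∈ 𝒢, ∀ a b : ℝ,
    T.FunctionalEq (G (a • τ + b • τ')).1 (a • (G τ).1 + b • (G τ').1)
  proper : ∀ τ ∈ 𝒢, T.IsProperGauge τ → T.WeaklyZero (G τ).1

end GaugeTheory

end BoundaryGauge

end

/-!
The theorem is a statement of the formal calculus of variations. The local functions form an
algebra `Loc`; total derivatives, variations and the time evolution are derivations of it, given
by their values on the jet coordinates, so that commutators are computed on the characteristics
(`lie_V`, `V_commT`). Euler derivatives and adjoint linearizations obey integration by parts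
(`V_mul_sub_mem`, `V_sub_mem`), `E_V` and the Helmholtz conditions `V_E`.

Functionals enter through subspaces of `Loc`: the densities `null` of functionals that vanish on
admissible configurations, the functions `bd` and `flat` that vanish on the boundary there,
respectively with all derivatives, and the functions `vanish` that are zero on all jets over the
region. A variation that is flat at the boundary can be cut off outside the region, where it
becomes a displacement of admissible configurations; hence it annihilates vanishing functionals,
no boundary terms arise from it, and the Euler derivatives of a density in `null` lie in `vanish`
(`functional_V_of_flatAt`, `DivSub_flat_le_null`, `E_mem_vanish_of_null`). The constraints generate
an ideal `constr` contained in `flat` and stable under the time evolution.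

For a couple `(G, Λ)`, invariance of the action says that `δ_t G - {G, H} - δ̃_G H` is a boundary
term (`externalCouple_iff`). Its Euler derivatives determine the derivatives of `G` along the
multipliers recursively and show that they are combinations of constraints (`Ext.E_lam_mem`), and
so is the commutator of `δ̃_G` with the time evolution (`Ext.commT_mem`). Therefore the
transformation generated by the bracket of two couples is the commutator of the two
transformations up to constraints (`Ext.triv_mem`), and the latter are flat. All conditions on an
external symmetry then pass to the bracket by the Jacobi identity for commutators and the Leibniz
rule (`Ext.bracket`); solving the recursion identifies the generated transformation with the
bracket of transformations (`Gen.bracket`).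

Two generators of the same transformation have the same Euler derivatives, so that by the homotopy
formula `exists_divergence` their difference is a boundary term, which depends on the boundary
fields only (`Gen.sub_mem_bndry`). This gives the extension terms. The cyclic sum of double brackets
of couples is flat as a transformation and vanishes on the constraint surface as a functional
(`Ext.V_jacobi_mem`, `Ext.jacobi_mem_weak`); it is a proper gauge generator, which makes the chosen
generator of the same transformation vanish weakly, and the cocycle condition follows.
-/

noncomputable section

namespace BoundaryGauge

/-! ### The algebra of local functions -/

section Local

variable {n m c : ℕ}

/-- Labels of the coordinates of the jet space: the time, the positions, the jet coordinates. -/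
abbrev BaseIdx (n m c : ℕ) := Unit ⊕ (Fin n ⊕ JetIdx n m c)

/-- Restriction of a point of the jet space to the jet coordinates in `S`. -/
def jetProj (S : Finset (JetIdx n m c)) (p : ℝ × Space n × (JetIdx n m c → ℝ)) :
    ℝ × Space n × (S → ℝ) := (p.1, p.2.1, fun j => p.2.2 j)

/-- The unit vector along a coordinate, restricted to the jet coordinates in `S`. -/
def jetVec (S : Finset (JetIdx n m c)) : BaseIdx n m c → ℝ × Space n × (S → ℝ)
  | Sum.inl _ => (1, 0, 0)
  | Sum.inr (Sum.inl i) => (0, EuclideanSpace.single i 1, 0)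
  | Sum.inr (Sum.inr j) => (0, 0, fun j' => if (j' : JetIdx n m c) = j then 1 else 0)

/-- Partial derivative along a coordinate of the jet space. -/
def pdFn : BaseIdx n m c → JetFn n m c → JetFn n m c
  | Sum.inl _ => pdT
  | Sum.inr (Sum.inl i) => pdX i
  | Sum.inr (Sum.inr j) => pdU j

/-- `f` is a smooth function of time, position and the jet coordinates in `S`. -/
def IsLocalOn (S : Finset (JetIdx n m c)) (f : JetFn n m c) : Prop :=
  ∃ g : ℝ × Space n × (S → ℝ) → ℝ, ContDiff ℝ ∞ g ∧ ∀ p, f p = g (jetProj S p)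

theorem isLocal_iff {f : JetFn n m c} : IsLocal f ↔ ∃ S, IsLocalOn S f := by
  constructor
  · rintro ⟨S, g, hg, h⟩
    exact ⟨S, g, hg, fun ⟨t, x, u⟩ => h t x u⟩
  · rintro ⟨S, g, hg, h⟩
    exact ⟨S, g, hg, fun t x u => h (t, x, u)⟩

theorem IsLocalOn.mono {S S' : Finset (JetIdx n m c)} (h : S ⊆ S') {f : JetFn n m c}
    (hf : IsLocalOn S f) : IsLocalOn S' f := by
  obtain ⟨g, hg, hfg⟩ := hf
  refine ⟨fun q => g (q.1, q.2.1, fun j => q.2.2 ⟨j, h j.2⟩), ?_, fun p => hfg p⟩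
  exact hg.comp (by fun_prop)

theorem hasDerivAt_comp_jetProj {S : Finset (JetIdx n m c)}
    {g : ℝ × Space n × (S → ℝ) → ℝ} (hg : ContDiff ℝ ∞ g)
    {τ : ℝ → ℝ} {ξ : ℝ → Space n} {υ : ℝ → JetIdx n m c → ℝ} {s : ℝ}
    {τ' : ℝ} {ξ' : Space n} {υ' : JetIdx n m c → ℝ}
    (hτ : HasDerivAt τ τ' s) (hξ : HasDerivAt ξ ξ' s)
    (hυ : ∀ j, HasDerivAt (fun s => υ s j) (υ' j) s) :
    HasDerivAt (fun s => g (jetProj S (τ s, ξ s, υ s)))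
      (fderiv ℝ g (jetProj S (τ s, ξ s, υ s)) (jetProj S (τ', ξ', υ'))) s := by
  have h1 : HasDerivAt (fun s => jetProj S (τ s, ξ s, υ s)) (jetProj S (τ', ξ', υ')) s :=
    hτ.prodMk (hξ.prodMk (hasDerivAt_pi.2 fun j => hυ j))
  exact ((hg.differentiable (by simp)) _).hasFDerivAt.comp_hasDerivAt s h1

theorem pdFn_eq {S : Finset (JetIdx n m c)} {f : JetFn n m c}
    {g : ℝ × Space n × (S → ℝ) → ℝ} (hg : ContDiff ℝ ∞ g) (hf : ∀ p, f p = g (jetProj S p))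
    (k : BaseIdx n m c) (p) : pdFn k f p = fderiv ℝ g (jetProj S p) (jetVec S k) := by
  obtain ⟨t, x, u⟩ := p
  obtain rfl : f = fun p => g (jetProj S p) := funext hf
  rcases k with _ | i | j
  · exact (hasDerivAt_comp_jetProj hg (hasDerivAt_id t) (hasDerivAt_const t x)
      (fun j => hasDerivAt_const t (u j))).deriv
  · have h1 : HasFDerivAt (fun y : Space n => jetProj S (t, y, u))
        ((0 : Space n →L[ℝ] ℝ).prod ((ContinuousLinearMap.id ℝ (Space n)).prod 0)) x :=
      (hasFDerivAt_const _ _).prodMk ((hasFDerivAt_id x).prodMk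
        (hasFDerivAt_const (fun j : S => u j) x))
    have h2 := (((hg.differentiable (by simp)) _).hasFDerivAt.comp x h1).fderiv
    simp only [pdFn, pdX, partialX]
    erw [h2]
    rfl
  · have h := (hasDerivAt_comp_jetProj (S := S) hg (hasDerivAt_const (u j) t)
      (hasDerivAt_const (u j) x) (υ := fun s => Function.update u j s) (υ' := Pi.single j 1)
      (s := u j) (fun k => by
        by_cases h : k = j
        · subst h; simpa using hasDerivAt_id' (u k)
        · simpa [Function.update_of_ne h, Pi.single_eq_of_ne h]
            using hasDerivAt_const (u j) (u k))).deriv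
    simp only [pdFn, pdU]
    rw [h, Function.update_eq_self]
    congr 2
    refine Prod.ext rfl (Prod.ext rfl ?_)
    funext k
    simp [jetProj, jetVec, Pi.single_apply]

theorem IsLocalOn.pdFn {S : Finset (JetIdx n m c)} {f : JetFn n m c} (hf : IsLocalOn S f)
    (k : BaseIdx n m c) : IsLocalOn S (pdFn k f) := by
  obtain ⟨g, hg, h⟩ := hf
  refine ⟨fun q => fderiv ℝ g q (jetVec S k), ?_, pdFn_eq hg h k⟩
  exact (hg.fderiv_right (m := ∞) (by simp)).clm_apply contDiff_const

theorem pdFn_comm {f : JetFn n m c} (hf : IsLocal f) (k l : BaseIdx n m c) :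
    pdFn k (pdFn l f) = pdFn l (pdFn k f) := by
  obtain ⟨S, g, hg, h⟩ := isLocal_iff.1 hf
  have key : ∀ k l p, BoundaryGauge.pdFn k (BoundaryGauge.pdFn l f) p
      = fderiv ℝ (fderiv ℝ g) (jetProj S p) (jetVec S k) (jetVec S l) := by
    intro k l p
    have hg' : ContDiff ℝ ∞ (fderiv ℝ g) := hg.fderiv_right (m := ∞) (by simp)
    rw [pdFn_eq (g := fun q => fderiv ℝ g q (jetVec S l)) (hg'.clm_apply contDiff_const)
      (pdFn_eq hg h l) k p]
    have := ((hg'.differentiable (by simp)) (jetProj S p)).hasFDerivAt.clm_apply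
      (hasFDerivAt_const (jetVec S l) (jetProj S p))
    rw [this.fderiv]
    simp
  funext p
  rw [key, key]
  have : IsSymmSndFDerivAt ℝ g (jetProj S p) :=
    (hg.contDiffAt).isSymmSndFDerivAt 
      (by rw [minSmoothness_of_isRCLikeNormedField]; exact WithTop.coe_le_coe.2 le_top)
  exact this _ _

theorem pdFn_eq_zero {S : Finset (JetIdx n m c)} {f : JetFn n m c} (hf : IsLocalOn S f)
    {j : JetIdx n m c} (hj : j ∉ S) : pdFn (Sum.inr (Sum.inr j)) f = 0 := by
  obtain ⟨g, hg, h⟩ := hf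
  funext p
  rw [pdFn_eq hg h]
  have : jetVec S (Sum.inr (Sum.inr j)) = 0 := by
    refine Prod.ext rfl (Prod.ext rfl ?_)
    funext k
    have : (k : JetIdx n m c) ≠ j := fun h => hj (h ▸ k.2)
    simp [jetVec, this]
  simp [this]

theorem IsLocalOn.add {S : Finset (JetIdx n m c)} {f f' : JetFn n m c} (h : IsLocalOn S f)
    (h' : IsLocalOn S f') : IsLocalOn S (f + f') := by
  obtain ⟨g, hg, h⟩ := h
  obtain ⟨g', hg', h'⟩ := h'
  exact ⟨g + g', hg.add hg', fun p => by simp [h, h']⟩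

theorem IsLocalOn.mul {S : Finset (JetIdx n m c)} {f f' : JetFn n m c} (h : IsLocalOn S f)
    (h' : IsLocalOn S f') : IsLocalOn S (f * f') := by
  obtain ⟨g, hg, h⟩ := h
  obtain ⟨g', hg', h'⟩ := h'
  exact ⟨g * g', hg.mul hg', fun p => by simp [h, h']⟩

theorem IsLocalOn.const (S : Finset (JetIdx n m c)) (a : ℝ) :
    IsLocalOn S (fun _ => a : JetFn n m c) := ⟨fun _ => a, contDiff_const, fun _ => rfl⟩

theorem exists_common {f f' : JetFn n m c} (h : IsLocal f) (h' : IsLocal f') :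
    ∃ S, IsLocalOn S f ∧ IsLocalOn S f' := by
  obtain ⟨S, h⟩ := isLocal_iff.1 h
  obtain ⟨S', h'⟩ := isLocal_iff.1 h'
  exact ⟨S ∪ S', h.mono Finset.subset_union_left, h'.mono Finset.subset_union_right⟩

variable (n m c) in
/-- The algebra of local functions. -/
def Loc : Subalgebra ℝ (JetFn n m c) where
  carrier := {f | IsLocal f}
  mul_mem' {f f'} h h' := by
    obtain ⟨S, h, h'⟩ := exists_common h h'
    exact isLocal_iff.2 ⟨S, h.mul h'⟩
  add_mem' {f f'} h h' := by
    obtain ⟨S, h, h'⟩ := exists_common h h'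
    exact isLocal_iff.2 ⟨S, h.add h'⟩
  algebraMap_mem' a := isLocal_iff.2 ⟨∅, IsLocalOn.const ∅ a⟩

theorem exists_isLocalOn (f : Loc n m c) : ∃ S, IsLocalOn S f.1 := isLocal_iff.1 f.2

theorem pdFn_add (k : BaseIdx n m c) {f f' : JetFn n m c} (h : IsLocal f) (h' : IsLocal f') :
    pdFn k (f + f') = pdFn k f + pdFn k f' := by
  obtain ⟨S, ⟨g, hg, h⟩, ⟨g', hg', h'⟩⟩ := exists_common h h'
  funext p
  rw [Pi.add_apply, pdFn_eq hg h, pdFn_eq hg' h',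
    pdFn_eq (g := g + g') (hg.add hg') (fun p => by simp [h, h']),
    fderiv_add (hg.differentiable (by simp) _) (hg'.differentiable (by simp) _)]
  rfl

theorem pdFn_mul (k : BaseIdx n m c) {f f' : JetFn n m c} (h : IsLocal f) (h' : IsLocal f') :
    pdFn k (f * f') = f * pdFn k f' + f' * pdFn k f := by
  obtain ⟨S, ⟨g, hg, h⟩, ⟨g', hg', h'⟩⟩ := exists_common h h'
  funext p
  rw [Pi.add_apply, Pi.mul_apply, Pi.mul_apply, pdFn_eq hg h, pdFn_eq hg' h',
    pdFn_eq (g := g * g') (hg.mul hg') (fun p => by simp [h, h']),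
    fderiv_mul (hg.differentiable (by simp) _) (hg'.differentiable (by simp) _), h, h']
  simp

theorem pdFn_const (k : BaseIdx n m c) (a : ℝ) : pdFn k (fun _ => a) = 0 := by
  funext p
  rw [pdFn_eq (S := ∅) (g := fun _ => a) contDiff_const (fun _ => rfl)]
  simp

/-- The partial derivatives as derivations of the algebra of local functions. -/
def pd (k : BaseIdx n m c) : Derivation ℝ (Loc n m c) (Loc n m c) :=
  Derivation.mk'
    { toFun := fun f => ⟨pdFn k f.1, by
        obtain ⟨S, h⟩ := exists_isLocalOn f
        exact isLocal_iff.2 ⟨S, h.pdFn k⟩⟩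
      map_add' := fun f f' => Subtype.ext (pdFn_add k f.2 f'.2)
      map_smul' := fun a f => Subtype.ext (by
        have h : IsLocal (fun _ => a : JetFn n m c) := (Loc n m c).algebraMap_mem a
        have := pdFn_mul k h f.2
        rw [pdFn_const, mul_zero, add_zero] at this
        exact this) }
    (fun f f' => Subtype.ext (pdFn_mul k f.2 f'.2))

theorem pd_comm (k l : BaseIdx n m c) (f : Loc n m c) : pd k (pd l f) = pd l (pd k f) :=
  Subtype.ext (pdFn_comm f.2 k l)

/-- The derivative along the jet coordinate `j`. -/
abbrev pdu (j : JetIdx n m c) : Derivation ℝ (Loc n m c) (Loc n m c) := pd (Sum.inr (Sum.inr j))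

theorem finite_pdu (f : Loc n m c) : {j | pdu j f ≠ 0}.Finite := by
  obtain ⟨S, h⟩ := exists_isLocalOn f
  refine S.finite_toSet.subset fun j hj => ?_
  by_contra hjS
  exact hj (Subtype.ext (pdFn_eq_zero h hjS))

theorem finite_pd (f : Loc n m c) : {k | pd k f ≠ 0}.Finite := by
  refine ((Set.finite_range (Sum.inl : Unit → BaseIdx n m c)).union
    ((Set.finite_range (fun i : Fin n => (Sum.inr (Sum.inl i) : BaseIdx n m c))).union
      ((finite_pdu f).image (fun j => Sum.inr (Sum.inr j))))).subset ?_
  rintro (_ | i | j) h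
  · exact Or.inl ⟨_, rfl⟩
  · exact Or.inr (Or.inl ⟨i, rfl⟩)
  · exact Or.inr (Or.inr ⟨j, h, rfl⟩)

theorem finite_support_mul {κ : Type*} {A : Type*} [CommRing A] (X Y : κ → A)
    (h : {k | Y k ≠ 0}.Finite) : (Function.support fun k => X k * Y k).Finite :=
  h.subset fun _ hk => right_ne_zero_of_mul hk

/-- The derivation `∑_k X_k ∂_k` of the algebra of local functions (a vector field on the jet
space). The sum is finite on each local function, as this depends on finitely many coordinates. -/
def der (X : BaseIdx n m c → Loc n m c) : Derivation ℝ (Loc n m c) (Loc n m c) :=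
  Derivation.mk'
    { toFun := fun f => ∑ᶠ k, X k * pd k f
      map_add' := fun f f' => by
        rw [← finsum_add_distrib (finite_support_mul _ _ (finite_pd f))
          (finite_support_mul _ _ (finite_pd f'))]
        simp [mul_add]
      map_smul' := fun a f => by
        rw [RingHom.id_apply, smul_finsum' _ (finite_support_mul _ _ (finite_pd f))]
        simp }
    (fun f f' => by
      change ∑ᶠ k, X k * pd k (f * f') = f • ∑ᶠ k, X k * pd k f' + f' • ∑ᶠ k, X k * pd k f
      rw [smul_finsum' _ (finite_support_mul _ _ (finite_pd f)),
        smul_finsum' _ (finite_support_mul _ _ (finite_pd f')), ← finsum_add_distrib]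
      · refine finsum_congr fun k => ?_
        rw [Derivation.leibniz]
        simp only [smul_eq_mul]
        ring
      · refine (finite_support_mul X _ (finite_pd f')).subset fun k hk h => hk ?_
        simp [smul_eq_mul, h]
      · refine (finite_support_mul X _ (finite_pd f)).subset fun k hk h => hk ?_
        simp [smul_eq_mul, h])

theorem der_apply (X : BaseIdx n m c → Loc n m c) (f : Loc n m c) :
    der X f = ∑ᶠ k, X k * pd k f := rfl

theorem der_eq_sum (X : BaseIdx n m c → Loc n m c) (f : Loc n m c)
    {s : Finset (BaseIdx n m c)} (hs : ∀ k, k ∉ s → pd k f = 0) :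
    der X f = ∑ k ∈ s, X k * pd k f := by
  rw [der_apply]
  refine finsum_eq_sum_of_support_subset _ fun k hk => ?_
  by_contra h
  exact hk (by simp [hs k h])

theorem der_add (X Y : BaseIdx n m c → Loc n m c) : der (X + Y) = der X + der Y := by
  ext1 f
  rw [Derivation.add_apply, der_apply, der_apply, der_apply,
    ← finsum_add_distrib (finite_support_mul _ _ (finite_pd f))
      (finite_support_mul _ _ (finite_pd f))]
  simp [add_mul]

theorem der_smul (a : ℝ) (X : BaseIdx n m c → Loc n m c) : der (a • X) = a • der X := by
  ext1 f
  rw [Derivation.smul_apply, der_apply, der_apply,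
    smul_finsum' _ (finite_support_mul _ _ (finite_pd f))]
  simp

/-- As the partial derivatives commute, the commutator of two vector fields on the jet space is
the vector field obtained by differentiating the coefficients. -/
theorem lie_der (X Y : BaseIdx n m c → Loc n m c) (f : Loc n m c) :
    der X (der Y f) - der Y (der X f) = der (fun k => der X (Y k) - der Y (X k)) f := by
  set s := (finite_pd f).toFinset with hs
  have hsf : ∀ k, k ∉ s → pd k f = 0 := fun k hk => by simpa [hs] using hk
  have key : ∀ X Y : BaseIdx n m c → Loc n m c, der X (der Y f) =
      ∑ k ∈ s, der X (Y k) * pd k f + ∑ k ∈ s, ∑ l ∈ s, Y k * X l * pd k (pd l f) := by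
    intro X Y
    rw [der_eq_sum Y f hsf, map_sum, ← Finset.sum_add_distrib]
    refine Finset.sum_congr rfl fun k _ => ?_
    rw [Derivation.leibniz, smul_eq_mul, smul_eq_mul, der_eq_sum X (pd k f) (s := s), add_comm,
      mul_comm (pd k f), Finset.mul_sum]
    · congr 1
      refine Finset.sum_congr rfl fun l _ => ?_
      rw [pd_comm]; ring
    · intro l hl
      rw [pd_comm, hsf l hl, map_zero]
  rw [key, key, der_eq_sum _ f hsf, Finset.sum_comm (s := s) (t := s)
    (f := fun k l => Y k * X l * pd k (pd l f))]
  simp only [sub_mul, Finset.sum_sub_distrib]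
  have : ∑ y ∈ s, ∑ x ∈ s, Y x * X y * pd x (pd y f)
      = ∑ k ∈ s, ∑ l ∈ s, X k * Y l * pd k (pd l f) := by
    refine Finset.sum_congr rfl fun k _ => Finset.sum_congr rfl fun l _ => ?_
    rw [pd_comm]; ring
  rw [this]
  ring

/-- The jet coordinate `j` as a local function. -/
def co (j : JetIdx n m c) : Loc n m c :=
  ⟨coord j, isLocal_iff.2 ⟨{j}, fun q => q.2.2 ⟨j, by simp⟩, by fun_prop, fun _ => rfl⟩⟩

/-- A smooth function of the position as a local function. -/
def ofX (f : Space n → ℝ) (hf : ContDiff ℝ ∞ f) : Loc n m c :=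
  ⟨fun p => f p.2.1, isLocal_iff.2 ⟨∅, fun q => f q.2.1, by fun_prop, fun _ => rfl⟩⟩

theorem pdu_co (j k : JetIdx n m c) : pdu j (co k) = if j = k then 1 else 0 := by
  refine Subtype.ext (funext fun p => ?_)
  change pdU j (coord k) p = _
  unfold pdU coord
  split_ifs with h
  · subst h; simp
  · simp [Function.update_of_ne (Ne.symm h)]

theorem pdt_co (k : JetIdx n m c) : pd (Sum.inl ()) (co k) = 0 := by
  refine Subtype.ext (funext fun p => ?_)
  change pdT (coord k) p = _
  simp [pdT, coord]

theorem pdx_co (i : Fin n) (k : JetIdx n m c) : pd (Sum.inr (Sum.inl i)) (co k) = 0 := by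
  refine Subtype.ext (funext fun p => ?_)
  change pdX i (coord k) p = _
  simp [pdX, partialX, coord]

end Local

/-! ### Iterated operators and multi-indices -/

section Iter

variable {n : ℕ}

theorem multiIdx_induction {P : MultiIdx n → Prop} (h0 : P 0)
    (h : ∀ I i, P I → P (I + Pi.single i 1)) (I : MultiIdx n) : P I := by
  obtain ⟨N, hN⟩ : ∃ N, ∑ i, I i = N := ⟨_, rfl⟩
  induction N generalizing I with
  | zero =>
    have : I = 0 := funext fun i => by simpa using (Finset.sum_eq_zero_iff.1 hN) i
    exact this ▸ h0
  | succ N ih =>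
    obtain ⟨i, -, hi⟩ : ∃ i ∈ Finset.univ, I i ≠ 0 :=
      Finset.exists_ne_zero_of_sum_ne_zero (by omega)
    have hI : I = (I - Pi.single i 1) + Pi.single i 1 := by
      funext k
      by_cases hk : k = i
      · subst hk; simp; omega
      · simp [Pi.single_eq_of_ne hk]
    rw [hI]
    refine h _ _ (ih _ ?_)
    have : ∑ k, I k = ∑ k, (I - Pi.single i 1 : MultiIdx n) k + ∑ k, (Pi.single i 1 : MultiIdx n) k := by
      rw [← Finset.sum_add_distrib]
      exact Finset.sum_congr rfl fun k _ => congrFun hI k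
    rw [Finset.sum_pi_single'] at this
    simp at this
    simp
    omega

theorem sgn_add_single (I : MultiIdx n) (i : Fin n) : sgn (I + Pi.single i 1) = -sgn I := by
  have : ∑ k, (I + Pi.single i 1 : MultiIdx n) k = ∑ k, I k + 1 := by
    simp [Finset.sum_add_distrib, Finset.sum_pi_single']
  rw [sgn, this, pow_succ, sgn]
  ring

@[simp] theorem sgn_zero : sgn (0 : MultiIdx n) = 1 := by simp [sgn]

variable {α : Type} {D : Fin n → α → α} {P : α → Prop}

theorem iterOp_zero (f : α) : iterOp D 0 f = f := by
  unfold iterOp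
  induction List.finRange n with
  | nil => rfl
  | cons k l ih => simp

theorem iterate_invariant (hP : ∀ i f, P f → P (D i f)) (i : Fin n) (N : ℕ) {f : α} (hf : P f) :
    P ((D i)^[N] f) := by
  induction N with
  | zero => exact hf
  | succ N ih => rw [Function.iterate_succ_apply']; exact hP i _ ih

theorem iterOp_invariant (hP : ∀ i f, P f → P (D i f)) (I : MultiIdx n) {f : α} (hf : P f) :
    P (iterOp D I f) := by
  unfold iterOp
  induction List.finRange n with
  | nil => exact hf
  | cons k l ih => exact iterate_invariant hP k _ ih

/-- On elements satisfying an invariant predicate under which the operators commute, iterated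
operators can be peeled off one at a time. -/
theorem iterOp_add_single (hP : ∀ i f, P f → P (D i f))
    (hc : ∀ i j f, P f → D i (D j f) = D j (D i f)) (I : MultiIdx n) (i : Fin n) {f : α}
    (hf : P f) : iterOp D (I + Pi.single i 1) f = D i (iterOp D I f) := by
  have hit : ∀ k N g, P g → (D k)^[N] (D i g) = D i ((D k)^[N] g) := by
    intro k N g hg
    induction N with
    | zero => rfl
    | succ N ih =>
      rw [Function.iterate_succ_apply', ih, Function.iterate_succ_apply',
        hc _ _ _ (iterate_invariant hP k N hg)]
  have hinv : ∀ l : List (Fin n), P (l.foldr (fun k h => (D k)^[I k] h) f) := by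
    intro l
    induction l with
    | nil => exact hf
    | cons k l ih => exact iterate_invariant hP k _ ih
  have key : ∀ l : List (Fin n), l.Nodup →
      l.foldr (fun k h => (D k)^[(I + Pi.single i 1 : MultiIdx n) k] h) f =
        if i ∈ l then D i (l.foldr (fun k h => (D k)^[I k] h) f)
        else l.foldr (fun k h => (D k)^[I k] h) f := by
    intro l
    induction l with
    | nil => simp
    | cons k l ih =>
      intro hl
      rw [List.nodup_cons] at hl
      simp only [List.foldr_cons, ih hl.2]
      by_cases hk : k = i
      · subst hk
        simp only [hl.1, if_false, List.mem_cons, true_or, if_true, Pi.add_apply,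
          Pi.single_eq_same]
        rw [Function.iterate_succ_apply']
      · have : (I + Pi.single i 1 : MultiIdx n) k = I k := by simp [Pi.single_eq_of_ne hk]
        rw [this]
        simp only [List.mem_cons, Ne.symm hk, false_or]
        split_ifs
        · exact hit k _ _ (hinv l)
        · rfl
  have := key (List.finRange n) (List.nodup_finRange n)
  simpa [iterOp] using this

end Iter

/-! ### Total derivatives and variations -/

section Total

variable {n m c : ℕ}

theorem der_co (X : BaseIdx n m c → Loc n m c) (j : JetIdx n m c) :
    der X (co j) = X (Sum.inr (Sum.inr j)) := by
  rw [der_eq_sum X (co j) (s := {Sum.inr (Sum.inr j)})]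
  · simp [pdu_co]
  · rintro (_ | i | k) hk
    · exact pdt_co j
    · exact pdx_co i j
    · rw [pdu_co, if_neg]
      rintro rfl
      simp at hk

theorem pd_eq_der (k : BaseIdx n m c) : pd k = der (fun l => if l = k then 1 else 0) := by
  ext1 f
  rw [der_apply, finsum_eq_single _ k (fun l hl => by simp [hl])]
  simp

theorem der_zero_apply (f : Loc n m c) : der 0 f = 0 := by simp [der_apply]

theorem der_val (X : BaseIdx n m c → Loc n m c) (f : Loc n m c) (p) :
    (der X f).1 p = (X (Sum.inl ())).1 p * pdT f.1 p +
      ∑ i, (X (Sum.inr (Sum.inl i))).1 p * pdX i f.1 p +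
      ∑ᶠ j, (X (Sum.inr (Sum.inr j))).1 p * pdU j f.1 p := by
  set s := (finite_pdu f).toFinset with hs
  have hsf : ∀ j, j ∉ s → pdu j f = 0 := fun k hk => by simpa [hs] using hk
  rw [der_eq_sum X f (s := Finset.univ.disjSum (Finset.univ.disjSum s)),
    finsum_eq_sum_of_support_subset (s := s)]
  · rw [Finset.sum_disjSum, Finset.sum_disjSum]
    simp only [Finset.univ_unique, Finset.sum_singleton]
    have : ∀ {ι : Type} (s : Finset ι) (F : ι → Loc n m c),
        (∑ k ∈ s, F k).1 p = ∑ k ∈ s, (F k).1 p := by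
      intro ι s F
      rw [AddSubmonoidClass.coe_finsetSum, Finset.sum_apply]
    rw [← add_assoc]
    simp only [Subalgebra.coe_add, Pi.add_apply, this]
    rfl
  · intro j hj
    by_contra h
    have h0 : pdU j f.1 p = 0 := congrFun (congrArg Subtype.val (hsf j h)) p
    exact hj (by simp [h0])
  · rintro (_ | i | k) hk
    · simp at hk
    · simp at hk
    · exact hsf k (by simpa using hk)

/-- The coefficients of the total derivative. -/
def dCoef (i : Fin n) : BaseIdx n m c → Loc n m c
  | Sum.inl _ => 0
  | Sum.inr (Sum.inl k) => if k = i then 1 else 0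
  | Sum.inr (Sum.inr j) => co (j.1, j.2 + Pi.single i 1)

/-- The total derivative `∂_i` as a derivation. -/
def D (i : Fin n) : Derivation ℝ (Loc n m c) (Loc n m c) := der (dCoef i)

theorem D_coe (i : Fin n) (f : Loc n m c) : (D i f).1 = totalD i f.1 := by
  funext p
  rw [D, der_val, totalD]
  simp only [dCoef]
  rw [Finset.sum_eq_single i]
  · simp; rfl
  · intro k _ hk; simp [hk]
  · simp

theorem D_comm (i k : Fin n) (f : Loc n m c) : D i (D k f) = D k (D i f) := by
  have h : D i (D k f) - D k (D i f) = 0 := by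
    rw [D, D, lie_der, ← der_zero_apply f]
    congr 2
    funext l
    rcases l with _ | l | j
    · simp [dCoef]
    · simp only [dCoef]
      split_ifs <;> simp
    · simp only [dCoef, der_co, Pi.zero_apply]
      rw [add_right_comm, sub_self]
  exact sub_eq_zero.1 h

/-- The iterated total derivative `∂_I` as a linear operator. -/
def Ds (I : MultiIdx n) : Loc n m c →ₗ[ℝ] Loc n m c where
  toFun f := iterOp (fun i g => D i g) I f
  map_add' f g := by
    induction I using multiIdx_induction with
    | h0 => simp [iterOp_zero]
    | h I i ih =>
      simp only [iterOp_add_single (P := fun _ => True) (fun _ _ _ => trivial)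
        (fun i j f _ => D_comm i j f) I i trivial, ih, map_add]
  map_smul' a f := by
    induction I using multiIdx_induction with
    | h0 => simp [iterOp_zero]
    | h I i ih =>
      simp only [iterOp_add_single (P := fun _ => True) (fun _ _ _ => trivial)
        (fun i j f _ => D_comm i j f) I i trivial, ih, Derivation.map_smul, RingHom.id_apply]

@[simp] theorem Ds_zero (f : Loc n m c) : Ds 0 f = f := iterOp_zero f

theorem Ds_add_single (I : MultiIdx n) (i : Fin n) (f : Loc n m c) :
    Ds (I + Pi.single i 1) f = D i (Ds I f) :=
  iterOp_add_single (P := fun _ => True) (fun _ _ _ => trivial)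
    (fun i j f _ => D_comm i j f) I i trivial

/-- A map commuting with the total derivatives commutes with the iterated ones. -/
theorem map_Ds {δ : Loc n m c → Loc n m c} (h : ∀ i f, δ (D i f) = D i (δ f)) (I : MultiIdx n)
    (f : Loc n m c) : δ (Ds I f) = Ds I (δ f) := by
  induction I using multiIdx_induction with
  | h0 => simp
  | h I i ih => rw [Ds_add_single, h, ih, Ds_add_single]

theorem Ds_D (I : MultiIdx n) (i : Fin n) (f : Loc n m c) : Ds I (D i f) = D i (Ds I f) :=
  (map_Ds (fun k g => D_comm i k g) I f).symm

theorem Ds_Ds (I J : MultiIdx n) (f : Loc n m c) : Ds I (Ds J f) = Ds (I + J) f := by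
  induction I using multiIdx_induction with
  | h0 => simp
  | h I i ih => rw [Ds_add_single, ih, add_right_comm, Ds_add_single]

theorem Ds_coe (I : MultiIdx n) (f : Loc n m c) : (Ds I f).1 = totalDs I f.1 := by
  have hP : ∀ (i : Fin n) (f : JetFn n m c), IsLocal f → IsLocal (totalD i f) := by
    intro i f hf
    rw [← D_coe i ⟨f, hf⟩]
    exact (D i ⟨f, hf⟩).2
  have hc : ∀ (i j : Fin n) (f : JetFn n m c), IsLocal f →
      totalD i (totalD j f) = totalD j (totalD i f) := by
    intro i j f hf
    have := congrArg Subtype.val (D_comm i j ⟨f, hf⟩)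
    rwa [D_coe, D_coe, D_coe, D_coe] at this
  induction I using multiIdx_induction with
  | h0 => rw [Ds_zero, totalDs, iterOp_zero]
  | h I i ih => rw [Ds_add_single, D_coe, ih, totalDs, totalDs, iterOp_add_single hP hc I i f.2]

/-- The prolongation of the variation with characteristics `Q`. -/
def V : (FieldIdx m c → Loc n m c) →ₗ[ℝ] Derivation ℝ (Loc n m c) (Loc n m c) where
  toFun Q := der (Sum.elim 0 (Sum.elim 0 (fun j => Ds j.2 (Q j.1))))
  map_add' Q R := by
    rw [← der_add]
    congr 1
    funext k
    rcases k with _ | i | j <;> simp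
  map_smul' a Q := by
    rw [RingHom.id_apply, ← der_smul]
    congr 1
    funext k
    rcases k with _ | i | j <;> simp

theorem V_eq_der (Q : FieldIdx m c → Loc n m c) :
    V Q = der (Sum.elim 0 (Sum.elim 0 (fun j => Ds j.2 (Q j.1)))) := rfl

theorem V_co (Q : FieldIdx m c → Loc n m c) (j : JetIdx n m c) :
    V Q (co j) = Ds j.2 (Q j.1) := der_co _ j

theorem V_coe (Q : FieldIdx m c → Loc n m c) (f : Loc n m c) :
    (V Q f).1 = vary (fun s => (Q s).1) f.1 := by
  funext p
  change (der _ f).1 p = _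
  rw [der_val]
  simp [vary, Ds_coe]

theorem V_D (Q : FieldIdx m c → Loc n m c) (i : Fin n) (f : Loc n m c) :
    V Q (D i f) = D i (V Q f) := by
  have h : V Q (D i f) - D i (V Q f) = 0 := by
    rw [V_eq_der, D, lie_der, ← der_zero_apply f]
    congr 2
    funext l
    rcases l with _ | l | j
    · simp [dCoef]
    · simp only [dCoef]
      split_ifs <;> simp
    · simp only [dCoef, der_co, Pi.zero_apply, Sum.elim_inr]
      rw [Ds_add_single]
      exact sub_self _
  exact sub_eq_zero.1 h

theorem V_Ds (Q : FieldIdx m c → Loc n m c) (I : MultiIdx n) (f : Loc n m c) :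
    V Q (Ds I f) = Ds I (V Q f) := map_Ds (V_D Q) I f

/-- The commutator of two variations is the variation whose characteristics are the commutators of
the characteristics, since variations commute with total derivatives. -/
theorem lie_V (Q R : FieldIdx m c → Loc n m c) (f : Loc n m c) :
    V Q (V R f) - V R (V Q f) = V (fun s => V Q (R s) - V R (Q s)) f := by
  rw [V_eq_der, V_eq_der, V_eq_der, lie_der]
  congr 2
  funext k
  rcases k with _ | i | j
  · simp
  · simp
  · simp only [Sum.elim_inr, map_sub]
    congr 1
    · exact V_Ds Q j.2 (R j.1)
    · exact V_Ds R j.2 (Q j.1)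

/-- The derivative with respect to the explicit time. -/
abbrev pdt : Derivation ℝ (Loc n m c) (Loc n m c) := pd (Sum.inl ())

theorem pdt_D (i : Fin n) (f : Loc n m c) : pdt (D i f) = D i (pdt f) := by
  have h : pdt (D i f) - D i (pdt f) = 0 := by
    rw [pdt, pd_eq_der, D, lie_der, ← pd_eq_der]
    refine Eq.trans (congrArg (fun X => der X f) ?_) (der_zero_apply f)
    funext l
    rcases l with _ | l | j
    · simp [dCoef]
    · simp only [dCoef]
      split_ifs <;> simp_all
    · simp [dCoef, pdt_co]
  exact sub_eq_zero.1 h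

theorem lie_pdt_V (Q : FieldIdx m c → Loc n m c) (f : Loc n m c) :
    pdt (V Q f) - V Q (pdt f) = V (fun s => pdt (Q s)) f := by
  rw [pdt, pd_eq_der, V_eq_der, V_eq_der, lie_der, ← pd_eq_der]
  congr 2
  funext k
  rcases k with _ | i | j
  · simp
  · simp
  · simp only [Sum.elim_inr]
    rw [if_neg (by simp), map_zero, sub_zero]
    exact map_Ds pdt_D j.2 (Q j.1)

/-- The commutator of a total derivative with the derivative along a jet coordinate. -/
theorem pdu_D (s : FieldIdx m c) (I : MultiIdx n) (i : Fin n) (f : Loc n m c) :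
    pdu (s, I) (D i f) = D i (pdu (s, I) f) +
      if I i = 0 then 0 else pdu (s, I - Pi.single i 1) f := by
  have h : pdu (s, I) (D i f) - D i (pdu (s, I) f) =
      if I i = 0 then 0 else pdu (s, I - Pi.single i 1) f := by
    rw [pdu, pd_eq_der, D, lie_der, ← pd_eq_der]
    have : (if I i = 0 then (0 : Loc n m c) else pdu (s, I - Pi.single i 1) f) =
        der (fun l => if I i = 0 then 0 else
          if l = Sum.inr (Sum.inr (s, I - Pi.single i 1)) then 1 else 0) f := by
      split_ifs
      · simp [der_apply]
      · rw [pdu, pd_eq_der]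
    rw [this]
    congr 2
    funext l
    rcases l with _ | l | ⟨s', J⟩
    · simp [dCoef]
    · have h0 : pdu (s, I) (dCoef i (Sum.inr (Sum.inl l)) : Loc n m c) = 0 := by
        simp only [dCoef]
        split_ifs <;> simp
      rw [h0]
      simp
    · have h0 : der (dCoef i) (if (Sum.inr (Sum.inr (s', J)) : BaseIdx n m c) =
          Sum.inr (Sum.inr (s, I)) then (1 : Loc n m c) else 0) = 0 := by
        split_ifs <;> simp
      rw [h0, sub_zero]
      simp only [dCoef]
      rw [pdu_co]
      by_cases hI : I i = 0
      · rw [if_pos hI, if_neg]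
        intro h
        have := congrFun (Prod.ext_iff.1 h).2 i
        simp at this
        omega
      · rw [if_neg hI]
        refine if_congr ?_ rfl rfl
        simp only [Sum.inr.injEq, Prod.mk.injEq]
        constructor
        · rintro ⟨rfl, rfl⟩
          refine ⟨rfl, ?_⟩
          simp
        · rintro ⟨rfl, rfl⟩
          refine ⟨rfl, ?_⟩
          funext k
          by_cases hk : k = i
          · subst hk; simp; omega
          · simp [Pi.single_eq_of_ne hk]
  rw [← h]; ring

end Total

/-! ### Euler operators and integration by parts -/

section Euler

variable {n m c : ℕ}

/-- The fields and multi-indices of the jet coordinates on which `f` depends lie in finite sets. -/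
theorem exists_box (f : Loc n m c) : ∃ (A : Finset (FieldIdx m c)) (B : Finset (MultiIdx n)),
    (∀ s I, s ∉ A → pdu (s, I) f = 0) ∧ ∀ s I, I ∉ B → pdu (s, I) f = 0 := by
  classical
  refine ⟨(finite_pdu f).toFinset.image Prod.fst, (finite_pdu f).toFinset.image Prod.snd, ?_, ?_⟩
  · intro s I h
    by_contra h0
    exact h (Finset.mem_image.2 ⟨(s, I), by simpa using h0, rfl⟩)
  · intro s I h
    by_contra h0
    exact h (Finset.mem_image.2 ⟨(s, I), by simpa using h0, rfl⟩)

theorem V_eq_sum (Q : FieldIdx m c → Loc n m c) {f : Loc n m c} {A : Finset (FieldIdx m c)}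
    {B : Finset (MultiIdx n)} (hA : ∀ s I, s ∉ A → pdu (s, I) f = 0)
    (hB : ∀ s I, I ∉ B → pdu (s, I) f = 0) :
    V Q f = ∑ s ∈ A, ∑ I ∈ B, Ds I (Q s) * pdu (s, I) f := by
  rw [V_eq_der, der_apply,
    ← Finset.sum_product' A B (fun s I => Ds I (Q s) * pdu (s, I) f)]
  rw [finsum_eq_sum_of_support_subset
    (s := (A ×ˢ B).map ⟨fun j => (Sum.inr (Sum.inr j) : BaseIdx n m c), by
      intro a b h; simpa using h⟩)]
  · rw [Finset.sum_map]
    rfl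
  · rintro (_ | i | ⟨s, I⟩) hk
    · simp at hk
    · simp at hk
    · have h0 : pdu (s, I) f ≠ 0 := fun h => hk (by
        change _ * pdu (s, I) f = 0
        rw [h, mul_zero])
      have h1 : s ∈ A := by_contra fun h => h0 (hA s I h)
      have h2 : I ∈ B := by_contra fun h => h0 (hB s I h)
      exact Finset.mem_coe.2 (Finset.mem_map.2 ⟨(s, I), Finset.mem_product.2 ⟨h1, h2⟩, rfl⟩)

theorem finite_adj (s : FieldIdx m c) (P v : Loc n m c) :
    (Function.support fun J : MultiIdx n => sgn J • Ds J (pdu (s, J) P * v)).Finite := by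
  obtain ⟨A, B, -, hB⟩ := exists_box P
  refine B.finite_toSet.subset fun J hJ => ?_
  by_contra h
  exact hJ (by simp [hB s J h])

/-- Formal adjoint of the linearization of `P` along the field `s`, applied to `v`:
`∑_J (-∂)_J (∂P/∂u^s_J · v)`. -/
def adj (s : FieldIdx m c) : Loc n m c →ₗ[ℝ] Loc n m c →ₗ[ℝ] Loc n m c :=
  LinearMap.mk₂ ℝ (fun P v => ∑ᶠ J : MultiIdx n, sgn J • Ds J (pdu (s, J) P * v))
    (fun P P' v => by
      rw [← finsum_add_distrib (finite_adj s P v) (finite_adj s P' v)]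
      simp [add_mul])
    (fun a P v => by
      rw [smul_finsum' _ (finite_adj s P v)]
      simp [smul_comm a])
    (fun P v v' => by
      rw [← finsum_add_distrib (finite_adj s P v) (finite_adj s P v')]
      simp [mul_add])
    (fun a P v => by
      rw [smul_finsum' _ (finite_adj s P v)]
      simp [smul_comm a])

theorem adj_apply (s : FieldIdx m c) (P v : Loc n m c) :
    adj s P v = ∑ᶠ J : MultiIdx n, sgn J • Ds J (pdu (s, J) P * v) := rfl

theorem adj_eq_sum (s : FieldIdx m c) (P v : Loc n m c) {B : Finset (MultiIdx n)}
    (hB : ∀ J, J ∉ B → pdu (s, J) P = 0) :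
    adj s P v = ∑ J ∈ B, sgn J • Ds J (pdu (s, J) P * v) := by
  rw [adj_apply]
  refine finsum_eq_sum_of_support_subset _ fun J hJ => ?_
  by_contra h
  exact hJ (by simp [hB J h])

/-- The Euler operator. -/
def E (s : FieldIdx m c) : Loc n m c →ₗ[ℝ] Loc n m c := (adj s).flip 1

theorem E_eq_adj (s : FieldIdx m c) (f : Loc n m c) : E s f = adj s f 1 := rfl

theorem adj_D (s : FieldIdx m c) (i : Fin n) (P v : Loc n m c) :
    adj s (D i P) v = -adj s P (D i v) := by
  obtain ⟨A, B, -, hB⟩ := exists_box P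
  have hinj : Function.Injective (fun J : MultiIdx n => J + Pi.single i 1) :=
    fun a b h => by simpa using h
  -- `F J` is the part of `∂(D_i P)/∂u^s_J` that comes from the commutator with `D_i`
  set F : MultiIdx n → Loc n m c := fun J =>
    sgn J • Ds J ((if J i = 0 then 0 else pdu (s, J - Pi.single i 1) P) * v) with hF
  have hF1 : ∀ J, F (J + Pi.single i 1) = -(sgn J • D i (Ds J (pdu (s, J) P * v))) := by
    intro J
    simp only [hF]
    rw [if_neg (by simp), add_tsub_cancel_right, sgn_add_single, Ds_add_single, neg_smul]
  have hF0 : ∀ J, J ∉ B.map ⟨_, hinj⟩ → F J = 0 := by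
    intro J hJ
    simp only [hF]
    split_ifs with h
    · simp
    · rw [hB s, zero_mul, map_zero, smul_zero]
      intro hB'
      refine hJ (Finset.mem_map.2 ⟨_, hB', ?_⟩)
      funext k
      by_cases hk : k = i
      · subst hk; simp; omega
      · simp [Pi.single_eq_of_ne hk]
  have h1 : adj s (D i P) v =
      ∑ᶠ J, (sgn J • Ds J (D i (pdu (s, J) P) * v) + F J) := by
    rw [adj_apply]
    refine finsum_congr fun J => ?_
    rw [pdu_D, add_mul, map_add, smul_add]
  have hFs : (Function.support F).Finite :=
    (B.map ⟨_, hinj⟩).finite_toSet.subset fun J hJ => by_contra fun h => hJ (hF0 J h)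
  have hG : ∀ J, J ∉ B → sgn J • Ds J (D i (pdu (s, J) P) * v) = 0 := by
    intro J hJ; simp [hB s J hJ]
  rw [h1, finsum_add_distrib (B.finite_toSet.subset fun J hJ => by_contra fun h => hJ (hG J h))
    hFs, finsum_eq_sum_of_support_subset (s := B) _
      (fun J hJ => by_contra fun h => hJ (hG J h)),
    finsum_eq_sum_of_support_subset (s := B.map ⟨_, hinj⟩) F
      (fun J hJ => by_contra fun h => hJ (hF0 J h)), Finset.sum_map, adj_eq_sum s P _ (hB s),
    ← Finset.sum_add_distrib, ← Finset.sum_neg_distrib]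
  refine Finset.sum_congr rfl fun J _ => ?_
  simp only [Function.Embedding.coeFn_mk]
  rw [hF1, ← smul_neg, ← smul_neg, ← smul_add]
  congr 1
  rw [← Ds_D, Derivation.leibniz, smul_eq_mul, smul_eq_mul, map_add]
  rw [mul_comm v]
  abel

theorem adj_Ds (s : FieldIdx m c) (J : MultiIdx n) (P v : Loc n m c) :
    adj s (Ds J P) v = adj s P (sgn J • Ds J v) := by
  induction J using multiIdx_induction generalizing v with
  | h0 => simp
  | h J i ih =>
    rw [Ds_add_single, adj_D, ih, sgn_add_single, neg_smul, map_neg, Ds_D, Ds_add_single]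

theorem E_D (s : FieldIdx m c) (i : Fin n) (f : Loc n m c) : E s (D i f) = 0 := by
  rw [E_eq_adj, adj_D]
  simp

theorem E_mul (s : FieldIdx m c) (P v : Loc n m c) : E s (P * v) = adj s P v + adj s v P := by
  rw [E_eq_adj, adj_apply, adj_apply, adj_apply,
    ← finsum_add_distrib (finite_adj s P v) (finite_adj s v P)]
  refine finsum_congr fun J => ?_
  rw [Derivation.leibniz, smul_eq_mul, smul_eq_mul, mul_one, ← smul_add, ← map_add]
  congr 2
  ring

theorem E_eq_sum (s : FieldIdx m c) (f : Loc n m c) {B : Finset (MultiIdx n)}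
    (hB : ∀ J, J ∉ B → pdu (s, J) f = 0) : E s f = ∑ J ∈ B, sgn J • Ds J (pdu (s, J) f) := by
  rw [E_eq_adj, adj_eq_sum s f 1 hB]
  simp

theorem E_eq_zero (s : FieldIdx m c) (f : Loc n m c) (h : ∀ J, pdu (s, J) f = 0) :
    E s f = 0 := by
  rw [E_eq_sum s f (B := ∅) (fun J _ => h J), Finset.sum_empty]

theorem adj_eq_zero (s : FieldIdx m c) (f v : Loc n m c) (h : ∀ J, pdu (s, J) f = 0) :
    adj s f v = 0 := by
  rw [adj_eq_sum s f v (B := ∅) (fun J _ => h J), Finset.sum_empty]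

theorem finite_E (f : Loc n m c) : {s | E s f ≠ 0}.Finite := by
  obtain ⟨A, B, hA, -⟩ := exists_box f
  refine A.finite_toSet.subset fun s hs => ?_
  by_contra h
  exact hs (E_eq_zero s f fun J => hA s J h)

theorem pd_coe_u (j : JetIdx n m c) (f : Loc n m c) : (pdu j f).1 = pdU j f.1 := rfl

theorem E_coe (s : FieldIdx m c) (f : Loc n m c) : (E s f).1 = euler s f.1 := by
  obtain ⟨A, B, hA, hB⟩ := exists_box f
  funext p
  rw [E_eq_sum s f (hB s), AddSubmonoidClass.coe_finsetSum, Finset.sum_apply, euler,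
    finsum_eq_sum_of_support_subset (s := B)]
  · refine Finset.sum_congr rfl fun J _ => ?_
    rw [← pd_coe_u, ← Ds_coe]
    rfl
  · intro J hJ
    by_contra h
    refine hJ ?_
    dsimp only
    rw [← pd_coe_u, ← Ds_coe, hB s J h]
    simp

theorem adj_coe (A : Fin m) (P v : Loc n m c) :
    (adj (Sum.inl A) P v).1 = adjLin A P.1 v.1 := by
  obtain ⟨-, B, -, hB⟩ := exists_box P
  funext p
  rw [adj_eq_sum _ P v (hB _), AddSubmonoidClass.coe_finsetSum, Finset.sum_apply, adjLin,
    finsum_eq_sum_of_support_subset (s := B)]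
  · refine Finset.sum_congr rfl fun J _ => ?_
    change sgn J * (Ds J _).1 p = _
    rw [Ds_coe]
    rfl
  · intro J hJ
    by_contra h
    refine hJ ?_
    change sgn J * totalDs J (pdu (Sum.inl A, J) P * v).1 p = 0
    rw [← Ds_coe, hB _ J h]
    simp

/-- The Euler operator of the variation of `f`: the variation of the Euler derivative, corrected
by the adjoint linearization of the characteristics. -/
theorem E_V (s : FieldIdx m c) (Q : FieldIdx m c → Loc n m c) (f : Loc n m c) :
    E s (V Q f) = V Q (E s f) + ∑ᶠ s', adj s (Q s') (E s' f) := by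
  obtain ⟨A, B, hA, hB⟩ := exists_box f
  have h1 : ∑ᶠ s', adj s (Q s') (E s' f) =
      ∑ s' ∈ A, ∑ J ∈ B, adj s (Ds J (Q s')) (pdu (s', J) f) := by
    rw [finsum_eq_sum_of_support_subset (s := A)]
    · refine Finset.sum_congr rfl fun s' _ => ?_
      rw [E_eq_sum s' f (hB s'), map_sum]
      refine Finset.sum_congr rfl fun J _ => ?_
      rw [adj_Ds]
    · intro s' hs'
      by_contra h
      exact hs' (by dsimp only; rw [E_eq_zero s' f fun J => hA s' J h, map_zero])
  have h2 : V Q (E s f) = ∑ s' ∈ A, ∑ J ∈ B, adj s (pdu (s', J) f) (Ds J (Q s')) := by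
    have h3 : ∀ s' J, adj s (pdu (s', J) f) (Ds J (Q s')) =
        ∑ I ∈ B, sgn I • Ds I (Ds J (Q s') * pdu (s', J) (pdu (s, I) f)) := by
      intro s' J
      rw [adj_eq_sum s _ _ (B := B)]
      · refine Finset.sum_congr rfl fun I _ => ?_
        rw [pdu, pd_comm, mul_comm]
      · intro I hI
        rw [pdu, pd_comm, hB s I hI, map_zero]
    simp_rw [h3]
    rw [E_eq_sum s f (hB s), map_sum]
    have h4 : ∀ I, V Q (sgn I • Ds I (pdu (s, I) f)) = ∑ s' ∈ A, ∑ J ∈ B,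
        sgn I • Ds I (Ds J (Q s') * pdu (s', J) (pdu (s, I) f)) := by
      intro I
      rw [Derivation.map_smul, V_Ds, V_eq_sum Q (f := pdu (s, I) f) (A := A) (B := B)]
      · simp_rw [map_sum, Finset.smul_sum]
      · intro s' J h
        rw [pdu, pd_comm, hA s' J h, map_zero]
      · intro s' J h
        rw [pdu, pd_comm, hB s' J h, map_zero]
    simp_rw [h4]
    rw [Finset.sum_comm]
    exact Finset.sum_congr rfl fun s' _ => Finset.sum_comm
  rw [h1, h2, V_eq_sum Q hA hB, map_sum, ← Finset.sum_add_distrib]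
  refine Finset.sum_congr rfl fun s' _ => ?_
  rw [map_sum, ← Finset.sum_add_distrib]
  refine Finset.sum_congr rfl fun J _ => ?_
  rw [E_mul, add_comm]

theorem E_pdt (s : FieldIdx m c) (f : Loc n m c) : E s (pdt f) = pdt (E s f) := by
  obtain ⟨A, B, hA, hB⟩ := exists_box f
  rw [E_eq_sum s f (hB s), E_eq_sum s (pdt f) (B := B), map_sum]
  · refine Finset.sum_congr rfl fun J _ => ?_
    rw [Derivation.map_smul, map_Ds pdt_D, pdu, pd_comm]
  · intro J hJ
    rw [pdu, pd_comm, hB s J hJ, map_zero]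

/-! ### Divergences of currents in an ideal -/

/-- The total divergences of currents with components in `𝔣`. -/
def DivSub (𝔣 : Ideal (Loc n m c)) : Submodule ℝ (Loc n m c) :=
  Submodule.span ℝ {g | ∃ i, ∃ k ∈ 𝔣, g = D i k}

theorem D_mem_DivSub {𝔣 : Ideal (Loc n m c)} {k : Loc n m c} (i : Fin n) (hk : k ∈ 𝔣) :
    D i k ∈ DivSub 𝔣 := Submodule.subset_span ⟨i, k, hk, rfl⟩

theorem E_DivSub {𝔣 : Ideal (Loc n m c)} {g : Loc n m c} (hg : g ∈ DivSub 𝔣)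
    (s : FieldIdx m c) : E s g = 0 := by
  refine Submodule.span_induction (p := fun g _ => E s g = 0) ?_ (map_zero _) ?_ ?_ hg
  · rintro _ ⟨i, k, -, rfl⟩
    exact E_D s i k
  · intro x y _ _ hx hy
    rw [map_add, hx, hy, add_zero]
  · intro a x _ hx
    rw [map_smul, hx, smul_zero]

theorem Ds_mem {𝔣 : Ideal (Loc n m c)} (h𝔣 : ∀ i, ∀ f ∈ 𝔣, D i f ∈ 𝔣) (J : MultiIdx n)
    {f : Loc n m c} (hf : f ∈ 𝔣) : Ds J f ∈ 𝔣 := by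
  induction J using multiIdx_induction with
  | h0 => simpa
  | h J i ih => rw [Ds_add_single]; exact h𝔣 i _ ih

theorem Ds_mul_sub_mem {𝔣 : Ideal (Loc n m c)} (h𝔣 : ∀ i, ∀ f ∈ 𝔣, D i f ∈ 𝔣)
    (J : MultiIdx n) (a b : Loc n m c) (h : a ∈ 𝔣 ∨ b ∈ 𝔣) :
    Ds J a * b - a * (sgn J • Ds J b) ∈ DivSub 𝔣 := by
  induction J using multiIdx_induction generalizing b with
  | h0 => simp
  | h J i ih =>
    have h1 := ih (D i b) (h.imp id (h𝔣 i b))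
    have h2 : Ds J a * b ∈ 𝔣 :=
      h.elim (fun h => 𝔣.mul_mem_right _ (Ds_mem h𝔣 J h)) (fun h => 𝔣.mul_mem_left _ h)
    have h3 := (DivSub 𝔣).sub_mem (D_mem_DivSub i h2) h1
    convert h3 using 1
    rw [Ds_add_single, Ds_add_single, sgn_add_single, Derivation.leibniz, Ds_D]
    simp only [smul_eq_mul, neg_smul]
    ring

/-- Integration by parts: `v · δ_Q P` and `∑_s Q^s · (adjoint linearization of P)(v)` differ by a
divergence of a current in the ideal `𝔣`, as soon as `v` or the characteristics are in `𝔣`. -/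
theorem V_mul_sub_mem {𝔣 : Ideal (Loc n m c)} (h𝔣 : ∀ i, ∀ f ∈ 𝔣, D i f ∈ 𝔣)
    (Q : FieldIdx m c → Loc n m c) (P v : Loc n m c) (h : (∀ s, Q s ∈ 𝔣) ∨ v ∈ 𝔣) :
    V Q P * v - ∑ᶠ s, Q s * adj s P v ∈ DivSub 𝔣 := by
  obtain ⟨A, B, hA, hB⟩ := exists_box P
  rw [V_eq_sum Q hA hB, finsum_eq_sum_of_support_subset (s := A), Finset.sum_mul,
    ← Finset.sum_sub_distrib]
  · refine Submodule.sum_mem _ fun s _ => ?_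
    rw [adj_eq_sum s P v (hB s), Finset.sum_mul, Finset.mul_sum, ← Finset.sum_sub_distrib]
    refine Submodule.sum_mem _ fun J _ => ?_
    rw [mul_assoc]
    exact Ds_mul_sub_mem h𝔣 J _ _ (h.imp (fun h => h s) (fun h => 𝔣.mul_mem_left _ h))
  · intro s hs
    by_contra h
    exact hs (by dsimp only; rw [adj_eq_zero s P v fun J => hA s J h, mul_zero])

theorem V_sub_mem {𝔣 : Ideal (Loc n m c)} (h𝔣 : ∀ i, ∀ f ∈ 𝔣, D i f ∈ 𝔣)
    (Q : FieldIdx m c → Loc n m c) (f : Loc n m c) (h : ∀ s, Q s ∈ 𝔣) :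
    V Q f - ∑ᶠ s, Q s * E s f ∈ DivSub 𝔣 := by
  have := V_mul_sub_mem h𝔣 Q f 1 (Or.inl h)
  rwa [mul_one] at this

theorem E_finsum_mul (s : FieldIdx m c) (Q : FieldIdx m c → Loc n m c) (f : Loc n m c) :
    E s (∑ᶠ s', Q s' * E s' f) =
      ∑ᶠ s', adj s (Q s') (E s' f) + ∑ᶠ s', adj s (E s' f) (Q s') := by
  set A := (finite_E f).toFinset with hA
  have h0 : ∀ s', s' ∉ A → E s' f = 0 := fun s' h => by simpa [hA] using h
  rw [finsum_eq_sum_of_support_subset (s := A), finsum_eq_sum_of_support_subset (s := A),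
    finsum_eq_sum_of_support_subset (s := A), map_sum, ← Finset.sum_add_distrib]
  · exact Finset.sum_congr rfl fun s' _ => E_mul s _ _
  all_goals
    intro s' hs'
    by_contra h
    exact hs' (by dsimp only; simp [h0 s' h])

/-- Self-adjointness of the second variation: the Helmholtz conditions. -/
theorem V_E (s : FieldIdx m c) (Q : FieldIdx m c → Loc n m c) (f : Loc n m c) :
    V Q (E s f) = ∑ᶠ s', adj s (E s' f) (Q s') := by
  have h1 := E_DivSub (V_sub_mem (𝔣 := ⊤) (fun _ _ _ => trivial) Q f fun _ => trivial) s
  rw [map_sub, E_V, E_finsum_mul] at h1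
  have h2 := sub_eq_zero.1 h1
  rw [add_comm] at h2
  exact add_left_cancel h2

/-! ### Local functions independent of a field -/

variable (n) in
/-- The local functions that do not depend on the field `s` and its derivatives. -/
def indep (s : FieldIdx m c) : Subalgebra ℝ (Loc n m c) where
  carrier := {f | ∀ J, pdu (s, J) f = 0}
  mul_mem' {f g} hf hg J := by rw [Derivation.leibniz, hf J, hg J]; simp
  add_mem' {f g} hf hg J := by rw [map_add, hf J, hg J, add_zero]
  algebraMap_mem' a J := Derivation.map_algebraMap _ _

theorem D_mem_indep {s : FieldIdx m c} {f : Loc n m c} (i : Fin n) (hf : f ∈ indep n s) :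
    D i f ∈ indep n s := by
  intro J
  rw [pdu_D, hf J, map_zero, zero_add]
  split_ifs
  · rfl
  · exact hf _

theorem Ds_mem_indep {s : FieldIdx m c} {f : Loc n m c} (I : MultiIdx n) (hf : f ∈ indep n s) :
    Ds I f ∈ indep n s := by
  induction I using multiIdx_induction with
  | h0 => simpa
  | h I i ih => rw [Ds_add_single]; exact D_mem_indep i ih

theorem E_mem_indep {s s' : FieldIdx m c} {f : Loc n m c} (hf : f ∈ indep n s) :
    E s' f ∈ indep n s := by
  obtain ⟨A, B, hA, hB⟩ := exists_box f
  rw [E_eq_sum s' f (hB s')]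
  refine Subalgebra.sum_mem _ fun J _ => Subalgebra.smul_mem _ (Ds_mem_indep J fun I => ?_) _
  rw [pdu, pd_comm, hf I, map_zero]

end Euler

/-! ### Differentiation under the integral sign -/

section Param

variable {H X F : Type} [NormedAddCommGroup H] [NormedSpace ℝ H] [FiniteDimensional ℝ H]
  [NormedAddCommGroup X] [NormedSpace ℝ X] [FiniteDimensional ℝ X] [MeasurableSpace X]
  [BorelSpace X] {μ : Measure X} [IsFiniteMeasureOnCompacts μ]
  [NormedAddCommGroup F] {Ω : Set X}

theorem integrableOn_of_continuous (hb : Bornology.IsBounded Ω) {f : X → F}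
    (hf : Continuous f) : IntegrableOn f Ω μ :=
  (hf.continuousOn.integrableOn_compact hb.isCompact_closure).mono_set subset_closure

variable [NormedSpace ℝ F]

theorem hasFDerivAt_setIntegral (hΩ : MeasurableSet Ω) (hb : Bornology.IsBounded Ω)
    {Φ : H × X → F} (hΦ : ContDiff ℝ 1 Φ) (y₀ : H) :
    HasFDerivAt (fun y => ∫ x in Ω, Φ (y, x) ∂μ)
      (∫ x in Ω, (fderiv ℝ Φ (y₀, x)).comp (ContinuousLinearMap.inl ℝ H X) ∂μ) y₀ := by
  have hc : Continuous fun p : H × X => (fderiv ℝ Φ p).comp (ContinuousLinearMap.inl ℝ H X) :=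
    (hΦ.continuous_fderiv one_ne_zero).clm_comp continuous_const
  have hK : IsCompact (Metric.closedBall y₀ 1 ×ˢ closure Ω) :=
    (ProperSpace.isCompact_closedBall y₀ 1).prod hb.isCompact_closure
  obtain ⟨C, hC⟩ := hK.exists_bound_of_continuousOn hc.continuousOn
  refine hasFDerivAt_integral_of_dominated_of_fderiv_le (Metric.ball_mem_nhds y₀ one_pos)
    (F := fun y x => Φ (y, x))
    (F' := fun y x => (fderiv ℝ Φ (y, x)).comp (ContinuousLinearMap.inl ℝ H X))
    (bound := fun _ => C) ?_ ?_ ?_ ?_ ?_ ?_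
  · refine Filter.Eventually.of_forall fun y => ?_
    exact (integrableOn_of_continuous hb (hΦ.continuous.comp (by fun_prop))).1
  · exact integrableOn_of_continuous hb (hΦ.continuous.comp (by fun_prop))
  · exact (integrableOn_of_continuous hb (hc.comp (by fun_prop))).1
  · refine (ae_restrict_iff' hΩ).2 (Filter.Eventually.of_forall fun x hx y hy => ?_)
    exact hC (y, x) ⟨Metric.ball_subset_closedBall hy, subset_closure hx⟩
  · exact integrableOn_of_continuous hb continuous_const
  · refine Filter.Eventually.of_forall fun x y _ => ?_
    have h1 : HasFDerivAt (fun y : H => (y, x)) (ContinuousLinearMap.inl ℝ H X) y :=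
      hasFDerivAt_prodMk_left y x
    exact ((hΦ.differentiable one_ne_zero) (y, x)).hasFDerivAt.comp y h1

theorem hasDerivAt_setIntegral [CompleteSpace F] (hΩ : MeasurableSet Ω)
    (hb : Bornology.IsBounded Ω) {Φ : ℝ × X → F} (hΦ : ContDiff ℝ 1 Φ) {Φ' : X → F} {s : ℝ}
    (h : ∀ x ∈ Ω, HasDerivAt (fun s => Φ (s, x)) (Φ' x) s) :
    HasDerivAt (fun s => ∫ x in Ω, Φ (s, x) ∂μ) (∫ x in Ω, Φ' x ∂μ) s := by
  have h1 := (hasFDerivAt_setIntegral (μ := μ) hΩ hb hΦ s).hasDerivAt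
  have hc : Continuous fun p : ℝ × X => (fderiv ℝ Φ p).comp (ContinuousLinearMap.inl ℝ ℝ X) :=
    (hΦ.continuous_fderiv one_ne_zero).clm_comp continuous_const
  have hi : Integrable (fun x => (fderiv ℝ Φ (s, x)).comp (ContinuousLinearMap.inl ℝ ℝ X))
      (μ.restrict Ω) :=
    integrableOn_of_continuous hb (hc.comp (f := fun x => (s, x)) (by fun_prop))
  rw [ContinuousLinearMap.integral_apply hi] at h1
  convert h1 using 1
  refine setIntegral_congr_fun hΩ fun x hx => ?_
  have h2 : HasFDerivAt (fun y : ℝ => (y, x)) (ContinuousLinearMap.inl ℝ ℝ X) s :=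
    hasFDerivAt_prodMk_left s x
  exact (h x hx).unique
    (((hΦ.differentiable one_ne_zero) (s, x)).hasFDerivAt.comp s h2).hasDerivAt

/-- The derivative of a parametric integral is a parametric integral with values in another space,
so that the order of differentiability is increased by induction over all target spaces. -/
theorem contDiff_setIntegral_nat (hΩ : MeasurableSet Ω) (hb : Bornology.IsBounded Ω) (N : ℕ) :
    ∀ {F : Type} [NormedAddCommGroup F] [NormedSpace ℝ F]
      {Φ : H × X → F} (_ : ContDiff ℝ ∞ Φ),
      ContDiff ℝ N (fun y => ∫ x in Ω, Φ (y, x) ∂μ) := by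
  induction N with
  | zero =>
    intro F _ _ Φ hΦ
    exact contDiff_zero.2 (continuous_iff_continuousAt.2 fun y =>
      (hasFDerivAt_setIntegral hΩ hb (hΦ.of_le (by simp)) y).continuousAt)
  | succ N ih =>
    intro F _ _ Φ hΦ
    have h := fun y => hasFDerivAt_setIntegral (μ := μ) hΩ hb (hΦ.of_le (by simp)) y
    rw [Nat.cast_succ]
    refine (contDiff_succ_iff_fderiv).2 ⟨fun y => (h y).differentiableAt, by simp, ?_⟩
    have h2 := ih (Φ := fun p : H × X => (fderiv ℝ Φ p).comp (ContinuousLinearMap.inl ℝ H X))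
      ((hΦ.fderiv_right (m := ∞) (by simp)).clm_comp contDiff_const)
    convert h2 using 1
    exact funext fun y => (h y).fderiv

theorem contDiff_setIntegral (hΩ : MeasurableSet Ω) (hb : Bornology.IsBounded Ω)
    {Φ : H × X → F} (hΦ : ContDiff ℝ ∞ Φ) :
    ContDiff ℝ ∞ (fun y => ∫ x in Ω, Φ (y, x) ∂μ) :=
  contDiff_infty.2 fun N => contDiff_setIntegral_nat hΩ hb N hΦ

end Param

/-! ### Local functions on configurations -/

section Config

variable {n m c : ℕ}

theorem partialX_contDiff {f : Space n → ℝ} (i : Fin n) (hf : ContDiff ℝ ∞ f) :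
    ContDiff ℝ ∞ (partialX i f) :=
  (hf.fderiv_right (m := ∞) (by simp)).clm_apply contDiff_const

theorem hasDerivAt_partialX {f : Space n → ℝ} {x : Space n} (i : Fin n)
    (hf : DifferentiableAt ℝ f x) :
    HasDerivAt (fun s : ℝ => f (x + s • EuclideanSpace.single i 1)) (partialX i f x) 0 := by
  have h1 : HasDerivAt (fun s : ℝ => x + s • (EuclideanSpace.single i 1 : Space n))
      (EuclideanSpace.single i 1) 0 := by
    simpa using ((hasDerivAt_id (0 : ℝ)).smul_const
      (EuclideanSpace.single i (1 : ℝ))).const_add x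
  have h2 : HasFDerivAt f (fderiv ℝ f x) (x + (0 : ℝ) • (EuclideanSpace.single i 1 : Space n)) := by
    simpa using hf.hasFDerivAt
  exact h2.comp_hasDerivAt 0 h1

theorem partialX_comm {f : Space n → ℝ} (i k : Fin n) (hf : ContDiff ℝ ∞ f) :
    partialX i (partialX k f) = partialX k (partialX i f) := by
  have h2 : ContDiff ℝ ∞ (fderiv ℝ f) := hf.fderiv_right (m := ∞) (by simp)
  have key : ∀ (i k : Fin n) x, partialX i (partialX k f) x =
      fderiv ℝ (fderiv ℝ f) x (EuclideanSpace.single i 1) (EuclideanSpace.single k 1) := by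
    intro i k x
    have := ((h2.differentiable (by simp)) x).hasFDerivAt.clm_apply
      (hasFDerivAt_const (EuclideanSpace.single k (1 : ℝ)) x)
    unfold partialX
    rw [this.fderiv]
    simp
  funext x
  rw [key, key]
  have : IsSymmSndFDerivAt ℝ f x := (hf.contDiffAt).isSymmSndFDerivAt
    (by rw [minSmoothness_of_isRCLikeNormedField]; exact WithTop.coe_le_coe.2 le_top)
  exact this _ _

theorem iterX_contDiff {f : Space n → ℝ} (I : MultiIdx n) (hf : ContDiff ℝ ∞ f) :
    ContDiff ℝ ∞ (iterOp partialX I f) :=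
  iterOp_invariant (P := fun f => ContDiff ℝ ∞ f) (fun i _ h => partialX_contDiff i h) I hf

theorem iterX_add_single {f : Space n → ℝ} (I : MultiIdx n) (i : Fin n) (hf : ContDiff ℝ ∞ f) :
    iterOp partialX (I + Pi.single i 1) f = partialX i (iterOp partialX I f) :=
  iterOp_add_single (P := fun f => ContDiff ℝ ∞ f) (fun i _ h => partialX_contDiff i h)
    (fun i j _ h => partialX_comm i j h) I i hf

theorem iterX_add_smul {f g : Space n → ℝ} (I : MultiIdx n) (hf : ContDiff ℝ ∞ f)
    (hg : ContDiff ℝ ∞ g) (s : ℝ) (x : Space n) :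
    iterOp partialX I (fun x => f x + s * g x) x =
      iterOp partialX I f x + s * iterOp partialX I g x := by
  induction I using multiIdx_induction generalizing x with
  | h0 => simp [iterOp_zero]
  | h I i ih =>
    have h : ContDiff ℝ ∞ fun x => f x + s * g x := by fun_prop
    rw [iterX_add_single I i h, iterX_add_single I i hf, iterX_add_single I i hg, funext ih]
    have h1 := ((iterX_contDiff I hf).differentiable (by simp)) x
    have h2 := ((iterX_contDiff I hg).differentiable (by simp)) x
    change fderiv ℝ (fun x => iterOp partialX I f x + s * iterOp partialX I g x) x _ =
      fderiv ℝ (iterOp partialX I f) x _ + s * fderiv ℝ (iterOp partialX I g) x _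
    rw [fderiv_fun_add h1 (h2.const_mul s), fderiv_const_mul h2]
    simp

/-- Derivatives at points of an open set only depend on the function on that set. -/
theorem iterX_congr {f g : Space n → ℝ} {Ω : Set (Space n)} (hΩ : IsOpen Ω) (I : MultiIdx n)
    (hf : ContDiff ℝ ∞ f) (hg : ContDiff ℝ ∞ g) (h : ∀ x ∈ Ω, f x = g x) :
    ∀ x ∈ Ω, iterOp partialX I f x = iterOp partialX I g x := by
  induction I using multiIdx_induction with
  | h0 => simpa [iterOp_zero] using h
  | h I i ih =>
    intro x hx
    rw [iterX_add_single I i hf, iterX_add_single I i hg]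
    have : iterOp partialX I f =ᶠ[nhds x] iterOp partialX I g :=
      Filter.eventuallyEq_of_mem (hΩ.mem_nhds hx) ih
    change fderiv ℝ (iterOp partialX I f) x _ = fderiv ℝ (iterOp partialX I g) x _
    rw [this.fderiv_eq]

/-- Smooth configurations. -/
def Sm (u : Config n m c) : Prop := ∀ s, ContDiff ℝ ∞ (u s)

theorem jet_add_single {u : Config n m c} (hu : Sm u) (x : Space n) (s : FieldIdx m c)
    (I : MultiIdx n) (i : Fin n) :
    jet u x (s, I + Pi.single i 1) = partialX i (fun y => jet u y (s, I)) x :=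
  congrFun (iterX_add_single I i (hu s)) x

/-- Chain rule along a path in the jet space whose velocity is given by a vector field. -/
theorem hasDerivAt_path (f : Loc n m c) (X : BaseIdx n m c → Loc n m c)
    {τ : ℝ → ℝ} {ξ : ℝ → Space n} {υ : ℝ → JetIdx n m c → ℝ} {s : ℝ}
    {ξ' : Space n}
    (hτ : HasDerivAt τ ((X (Sum.inl ())).1 (τ s, ξ s, υ s)) s) (hξ : HasDerivAt ξ ξ' s)
    (hξ' : ∀ i, ξ' i = (X (Sum.inr (Sum.inl i))).1 (τ s, ξ s, υ s))
    (hυ : ∀ j, HasDerivAt (fun s => υ s j) ((X (Sum.inr (Sum.inr j))).1 (τ s, ξ s, υ s)) s) :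
    HasDerivAt (fun s => f.1 (τ s, ξ s, υ s)) ((der X f).1 (τ s, ξ s, υ s)) s := by
  obtain ⟨S, g, hg, h⟩ := exists_isLocalOn f
  have h1 := hasDerivAt_comp_jetProj (S := S) hg hτ hξ hυ
  simp_rw [h]
  convert h1 using 1
  set p := (τ s, ξ s, υ s) with hp
  rw [der_val, finsum_eq_sum_of_support_subset (s := S)]
  · have hT : pdT f.1 p = fderiv ℝ g (jetProj S p) (jetVec S (Sum.inl ())) :=
      pdFn_eq hg h (Sum.inl ()) p
    have hX : ∀ i, pdX i f.1 p = fderiv ℝ g (jetProj S p) (jetVec S (Sum.inr (Sum.inl i))) :=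
      fun i => pdFn_eq hg h (Sum.inr (Sum.inl i)) p
    have hU : ∀ j, pdU j f.1 p = fderiv ℝ g (jetProj S p) (jetVec S (Sum.inr (Sum.inr j))) :=
      fun j => pdFn_eq hg h (Sum.inr (Sum.inr j)) p
    simp_rw [hT, hX, hU, ← smul_eq_mul, ← map_smul, ← map_sum, ← map_add]
    congr 1
    refine Prod.ext ?_ (Prod.ext ?_ ?_)
    · simp [jetVec, jetProj, Prod.fst_sum]
    · ext i
      simp [jetVec, jetProj, Prod.fst_sum, Prod.snd_sum, hξ', Pi.single_apply]
    · funext j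
      have := j.2
      simp [jetVec, jetProj, Prod.snd_sum, Finset.sum_apply]
  · intro j hj
    by_contra hjS
    have : pdU j f.1 = 0 := pdFn_eq_zero ⟨g, hg, h⟩ hjS
    exact hj (by simp [this])

/-- Joint smoothness, in the parameter and the position, of a local function along a straight
line of configurations. -/
theorem contDiff_line (f : Loc n m c) {u w : Config n m c} (hu : Sm u) (hw : Sm w) (t α : ℝ) :
    ContDiff ℝ ∞ (fun p : ℝ × Space n =>
      ev f.1 (t + α * p.1) (fun s x => u s x + p.1 * w s x) p.2) := by
  obtain ⟨S, g, hg, h⟩ := exists_isLocalOn f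
  have h1 : ∀ p : ℝ × Space n, ev f.1 (t + α * p.1) (fun s x => u s x + p.1 * w s x) p.2 =
      g (t + α * p.1, p.2, fun j : S => iterOp partialX j.1.2 (u j.1.1) p.2 +
        p.1 * iterOp partialX j.1.2 (w j.1.1) p.2) := by
    intro p
    rw [ev, h, jetProj]
    congr 3
    funext j
    exact iterX_add_smul j.1.2 (hu j.1.1) (hw j.1.1) p.1 p.2
  rw [funext h1]
  refine hg.comp ?_
  refine (by fun_prop : ContDiff ℝ ∞ fun p : ℝ × Space n => t + α * p.1).prodMk
    (contDiff_snd.prodMk (contDiff_pi.2 fun j => ?_))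
  have h2 := (iterX_contDiff j.1.2 (hu j.1.1)).comp
    (contDiff_snd : ContDiff ℝ ∞ (Prod.snd : ℝ × Space n → _))
  have h3 := (iterX_contDiff j.1.2 (hw j.1.1)).comp
    (contDiff_snd : ContDiff ℝ ∞ (Prod.snd : ℝ × Space n → _))
  exact h2.add (contDiff_fst.mul h3)

theorem ev_contDiff (f : Loc n m c) {u : Config n m c} (hu : Sm u) (t : ℝ) :
    ContDiff ℝ ∞ (ev f.1 t u) := by
  have h := (contDiff_line f hu hu t 0).comp
    (contDiff_prodMk_right (𝕜 := ℝ) (n := ∞) (E := ℝ) (F := Space n) 0)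
  simpa [Function.comp_def] using h

theorem ev_D (i : Fin n) (f : Loc n m c) {u : Config n m c} (hu : Sm u) (t : ℝ) :
    ev (D i f).1 t u = partialX i (ev f.1 t u) := by
  funext x
  have h1 := hasDerivAt_partialX (x := x) i (((ev_contDiff f hu t).differentiable (by simp)) x)
  have h2 := hasDerivAt_path f (dCoef i) (τ := fun _ => t)
    (ξ := fun s : ℝ => x + s • EuclideanSpace.single i 1)
    (υ := fun s => jet u (x + s • EuclideanSpace.single i 1)) (s := 0)
    (ξ' := EuclideanSpace.single i 1) (hasDerivAt_const _ _) ?_ ?_ ?_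
  · have := h2.unique h1
    simpa [ev, D] using this
  · simpa using ((hasDerivAt_id (0 : ℝ)).smul_const
      (EuclideanSpace.single i (1 : ℝ))).const_add x
  · intro k
    simp only [dCoef, PiLp.single_apply]
    split_ifs <;> rfl
  · intro j
    have h3 := hasDerivAt_partialX (x := x) (f := fun y => jet u y j) i
      (((iterX_contDiff j.2 (hu j.1)).differentiable (by simp)) x)
    rw [← jet_add_single hu] at h3
    simpa [dCoef, co, coord] using h3

theorem ev_Ds (I : MultiIdx n) (f : Loc n m c) {u : Config n m c} (hu : Sm u) (t : ℝ) :
    ev (Ds I f).1 t u = iterOp partialX I (ev f.1 t u) := by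
  induction I using multiIdx_induction with
  | h0 => rw [Ds_zero, iterOp_zero]
  | h I i ih => rw [Ds_add_single, ev_D i _ hu, ih, iterX_add_single I i (ev_contDiff f hu t)]

/-- Derivative of a local function along a straight line of configurations whose direction has
the jets of the characteristics `Q`. -/
theorem hasDerivAt_line (f : Loc n m c) {u w : Config n m c} (hu : Sm u) (hw : Sm w) (t α : ℝ)
    (Q : FieldIdx m c → Loc n m c) {x : Space n}
    (hQ : ∀ s I, jet w x (s, I) = ev (Ds I (Q s)).1 t u x) :
    HasDerivAt (fun s : ℝ => ev f.1 (t + α * s) (fun l y => u l y + s * w l y) x)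
      (ev (α • pdt f + V Q f).1 t u x) 0 := by
  set Y : BaseIdx n m c → Loc n m c := Sum.elim 0 (Sum.elim 0 (fun j => Ds j.2 (Q j.1))) with hY
  set T : BaseIdx n m c → Loc n m c := fun k => if k = Sum.inl () then 1 else 0 with hT
  have h2 := hasDerivAt_path f (α • T + Y)
    (τ := fun s => t + α * s) (ξ := fun _ : ℝ => x)
    (υ := fun s => jet (fun l y => u l y + s * w l y) x) (s := 0) (ξ' := 0) ?_
    (hasDerivAt_const _ _) ?_ ?_
  · have h3 : der (α • T + Y) f = α • pdt f + V Q f := by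
      rw [der_add, der_smul, hT, ← pd_eq_der, hY, ← V_eq_der]
      rfl
    rw [h3] at h2
    simpa [ev] using h2
  · simpa [hT, hY] using ((hasDerivAt_id (0 : ℝ)).const_mul α).const_add t
  · intro i; simp [hT, hY]
  · intro j
    have h3 : (fun s : ℝ => jet (fun l y => u l y + s * w l y) x j) =
        fun s : ℝ => jet u x j + s * jet w x j :=
      funext fun s => iterX_add_smul j.2 (hu j.1) (hw j.1) s x
    rw [h3]
    have h4 := ((hasDerivAt_id (0 : ℝ)).mul_const (jet w x j)).const_add (jet u x j)
    simpa [ev, hQ j.1 j.2, hT, hY] using h4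

end Config

/-! ### Functions that are flat on the boundary of a region -/

section Flat

variable {n m c : ℕ} {Ω : Set (Space n)}

/-- All derivatives of `w` vanish on the boundary of `Ω`. -/
def FlatFn (Ω : Set (Space n)) (w : Space n → ℝ) : Prop :=
  ∀ I, ∀ x ∈ frontier Ω, iterOp partialX I w x = 0

theorem fderiv_eq_sum (f : Space n → ℝ) (x : Space n) :
    fderiv ℝ f x = ∑ i, partialX i f x • (EuclideanSpace.proj i : Space n →L[ℝ] ℝ) := by
  refine ContinuousLinearMap.coe_injective
    ((EuclideanSpace.basisFun (Fin n) ℝ).toBasis.ext fun i => ?_)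
  simp [partialX, PiLp.single_apply]

theorem FlatFn.partialX {w : Space n → ℝ} (hw : ContDiff ℝ ∞ w) (h : FlatFn Ω w) (i : Fin n) :
    FlatFn Ω (partialX i w) := by
  intro I x hx
  have h1 : iterOp BoundaryGauge.partialX I (BoundaryGauge.partialX i w) =
      BoundaryGauge.partialX i (iterOp BoundaryGauge.partialX I w) := by
    induction I using multiIdx_induction with
    | h0 => simp [iterOp_zero]
    | h I k ih =>
      rw [iterX_add_single I k (partialX_contDiff i hw), ih, iterX_add_single I k hw,
        partialX_comm k i (iterX_contDiff I hw)]
  rw [h1, ← iterX_add_single I i hw]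
  exact h _ x hx

/-- At a boundary point the function and its derivative vanish, and the extension by zero is
dominated by the function itself. -/
theorem hasFDerivAt_indicator (hΩ : IsOpen Ω) {w : Space n → ℝ} (hw : ContDiff ℝ ∞ w)
    (h : FlatFn Ω w) (x : Space n) :
    HasFDerivAt (Ω.indicator w) (Ω.indicator (fderiv ℝ w) x) x := by
  have hd := ((hw.differentiable (by simp)) x).hasFDerivAt
  by_cases hx : x ∈ Ω
  · rw [Set.indicator_of_mem hx]
    refine hd.congr_of_eventuallyEq ?_
    exact Filter.eventuallyEq_of_mem (hΩ.mem_nhds hx) fun y hy => Set.indicator_of_mem hy w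
  · rw [Set.indicator_of_notMem hx]
    by_cases hx' : x ∈ closure Ω
    · have hf : x ∈ frontier Ω := ⟨hx', by rwa [hΩ.interior_eq]⟩
      have h0 : w x = 0 := by simpa [iterOp_zero] using h 0 x hf
      have h1 : fderiv ℝ w x = 0 := by
        rw [fderiv_eq_sum]
        refine Finset.sum_eq_zero fun i _ => ?_
        have := (h.partialX hw i) 0 x hf
        rw [iterOp_zero] at this
        rw [this, zero_smul]
      rw [h1, hasFDerivAt_iff_isLittleO] at hd
      rw [hasFDerivAt_iff_isLittleO]
      refine (Asymptotics.IsBigO.of_bound 1 (Filter.Eventually.of_forall fun y => ?_)).trans_isLittleO hd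
      simp only [h0, Set.indicator_of_notMem hx, sub_zero, one_mul]
      by_cases hy : y ∈ Ω
      · simp [Set.indicator_of_mem hy]
      · simp [Set.indicator_of_notMem hy]
    · refine (hasFDerivAt_const (0 : ℝ) x).congr_of_eventuallyEq ?_
      refine Filter.eventuallyEq_of_mem (isClosed_closure.isOpen_compl.mem_nhds hx') fun y hy => ?_
      exact Set.indicator_of_notMem (fun h => hy (subset_closure h)) w

theorem partialX_indicator (hΩ : IsOpen Ω) {w : Space n → ℝ} (hw : ContDiff ℝ ∞ w)
    (h : FlatFn Ω w) (i : Fin n) :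
    partialX i (Ω.indicator w) = Ω.indicator (partialX i w) := by
  funext x
  unfold partialX
  rw [(hasFDerivAt_indicator hΩ hw h x).fderiv]
  by_cases hx : x ∈ Ω
  · rw [Set.indicator_of_mem hx, Set.indicator_of_mem hx]
  · rw [Set.indicator_of_notMem hx, Set.indicator_of_notMem hx]; rfl

/-- The extension by zero of a smooth function that is flat on the boundary is smooth. -/
theorem contDiff_indicator (hΩ : IsOpen Ω) {w : Space n → ℝ} (hw : ContDiff ℝ ∞ w)
    (h : FlatFn Ω w) : ContDiff ℝ ∞ (Ω.indicator w) := by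
  refine contDiff_infty.2 fun N => ?_
  induction N generalizing w with
  | zero =>
    exact contDiff_zero.2 (continuous_iff_continuousAt.2 fun x =>
      (hasFDerivAt_indicator hΩ hw h x).continuousAt)
  | succ N ih =>
    rw [Nat.cast_succ]
    refine contDiff_succ_iff_fderiv.2
      ⟨fun x => (hasFDerivAt_indicator hΩ hw h x).differentiableAt, by simp, ?_⟩
    rw [funext fun x => fderiv_eq_sum (Ω.indicator w) x]
    refine ContDiff.sum fun i _ => ?_
    rw [partialX_indicator hΩ hw h i]
    exact (ih (partialX_contDiff i hw) (h.partialX hw i)).smul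
      (contDiff_const (c := (EuclideanSpace.proj i : Space n →L[ℝ] ℝ)))

theorem iterX_indicator (hΩ : IsOpen Ω) {w : Space n → ℝ} (hw : ContDiff ℝ ∞ w)
    (h : FlatFn Ω w) (I : MultiIdx n) :
    iterOp partialX I (Ω.indicator w) = Ω.indicator (iterOp partialX I w) := by
  have : iterOp partialX I (Ω.indicator w) = Ω.indicator (iterOp partialX I w) ∧
      FlatFn Ω (iterOp partialX I w) := by
    induction I using multiIdx_induction with
    | h0 => simpa [iterOp_zero] using h
    | h I i ih =>
      rw [iterX_add_single I i (contDiff_indicator hΩ hw h), ih.1, iterX_add_single I i hw,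
        partialX_indicator hΩ (iterX_contDiff I hw) ih.2]
      exact ⟨rfl, ih.2.partialX (iterX_contDiff I hw) i⟩
  exact this.1

theorem setIntegral_partialX_eq_zero (hΩ : IsOpen Ω) (hb : Bornology.IsBounded Ω)
    {w : Space n → ℝ} (hw : ContDiff ℝ ∞ w) (h : FlatFn Ω w) (i : Fin n) :
    ∫ x in Ω, partialX i w x = 0 := by
  rw [← integral_indicator hΩ.measurableSet, ← partialX_indicator hΩ hw h i]
  have hc := contDiff_indicator hΩ hw h
  have hs : HasCompactSupport (Ω.indicator w) := by
    refine HasCompactSupport.of_support_subset_isCompact hb.isCompact_closure ?_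
    exact (Function.support_subset_iff'.2 fun x hx => Set.indicator_of_notMem hx w).trans
      subset_closure
  have hi : Integrable (Ω.indicator w) := hc.continuous.integrable_of_hasCompactSupport hs
  have hi' : Integrable (partialX i (Ω.indicator w)) :=
    (partialX_contDiff i hc).continuous.integrable_of_hasCompactSupport
      ((hs.fderiv (𝕜 := ℝ)).comp_left
        (g := fun L : Space n →L[ℝ] ℝ => L (EuclideanSpace.single i 1)) rfl)
  have := integral_mul_fderiv_eq_neg_fderiv_mul_of_integrable (μ := volume)
    (f := fun _ : Space n => (1 : ℝ)) (g := Ω.indicator w)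
    (v := EuclideanSpace.single i (1 : ℝ)) (by simp)
    (by simp only [one_mul]; exact hi') (by simpa using hi)
    (fun _ _ => by fun_prop) (fun x _ => hc.differentiable (by simp) x)
  simp only [one_mul, fderiv_fun_const, Pi.zero_apply, _root_.zero_apply, zero_mul,
    integral_zero, neg_zero] at this
  exact this

theorem iterX_zero (I : MultiIdx n) : iterOp partialX I (fun _ : Space n => (0 : ℝ)) = 0 := by
  induction I using multiIdx_induction with
  | h0 => rw [iterOp_zero]; rfl
  | h I i ih =>
    rw [iterX_add_single I i contDiff_const, ih]
    funext x
    simp [partialX]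

/-- The ideal of local functions that are flat on the boundary at the time `t` and the
configuration `u`. -/
def flatAt (Ω : Set (Space n)) (t : ℝ) (u : Config n m c) : Ideal (Loc n m c) where
  carrier := {f | ∀ I, ∀ x ∈ frontier Ω, ev (Ds I f).1 t u x = 0}
  add_mem' {f g} hf hg I x hx := by
    rw [map_add]
    change (Ds I f).1 _ + (Ds I g).1 _ = 0
    have h1 := hf I x hx
    have h2 := hg I x hx
    unfold ev at h1 h2
    rw [h1, h2, add_zero]
  zero_mem' I x _ := by rw [map_zero]; rfl
  smul_mem' g f hf I x hx := by
    rw [smul_eq_mul]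
    induction I using multiIdx_induction generalizing f g with
    | h0 =>
      have := hf 0 x hx
      unfold ev at this
      rw [Ds_zero] at this ⊢
      change g.1 _ * f.1 _ = 0
      rw [this, mul_zero]
    | h I i ih =>
      have hDf : ∀ I, ∀ x ∈ frontier Ω, ev (Ds I (D i f)).1 t u x = 0 := by
        intro I x hx
        rw [Ds_D, ← Ds_add_single]
        exact hf _ x hx
      rw [Ds_add_single, ← Ds_D, Derivation.leibniz, smul_eq_mul, smul_eq_mul, map_add,
        mul_comm f]
      have h1 := ih g (D i f) hDf
      have h2 := ih (D i g) f hf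
      change (Ds I _).1 _ + (Ds I _).1 _ = 0
      unfold ev at h1 h2
      rw [h1, h2, add_zero]

theorem D_mem_flatAt {t : ℝ} {u : Config n m c} (i : Fin n) (f : Loc n m c)
    (hf : f ∈ flatAt Ω t u) : D i f ∈ flatAt Ω t u := by
  intro I x hx
  rw [Ds_D, ← Ds_add_single]
  exact hf _ x hx

theorem mem_flatAt_iff {t : ℝ} {u : Config n m c} (hu : Sm u) (f : Loc n m c) :
    f ∈ flatAt Ω t u ↔ FlatFn Ω (ev f.1 t u) :=
  forall_congr' fun I => forall₂_congr fun x _ => by rw [ev_Ds I f hu]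

theorem setIntegral_DivSub (hΩ : IsOpen Ω) (hb : Bornology.IsBounded Ω) {t : ℝ}
    {u : Config n m c} (hu : Sm u) {g : Loc n m c} (hg : g ∈ DivSub (flatAt Ω t u)) :
    ∫ x in Ω, ev g.1 t u x = 0 := by
  have hi : ∀ f : Loc n m c, IntegrableOn (ev f.1 t u) Ω :=
    fun f => integrableOn_of_continuous hb (ev_contDiff f hu t).continuous
  refine Submodule.span_induction (p := fun g _ => ∫ x in Ω, ev g.1 t u x = 0) ?_ ?_ ?_ ?_ hg
  · rintro _ ⟨i, k, hk, rfl⟩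
    rw [ev_D i k hu]
    exact setIntegral_partialX_eq_zero hΩ hb (ev_contDiff k hu t) ((mem_flatAt_iff hu k).1 hk) i
  · simp [ev]
  · intro f g _ _ hf hg
    have := integral_add (hi f) (hi g)
    rw [hf, hg, add_zero] at this
    exact this
  · intro a f _ hf
    have := integral_const_mul (μ := volume.restrict Ω) a (ev f.1 t u)
    rw [hf, mul_zero] at this
    exact this

/-! ### Local functions that vanish over the region -/

/-- The ideal of local functions that vanish on all jets over `Ω`. -/
def vanish (Ω : Set (Space n)) : Ideal (Loc n m c) where
  carrier := {f | ∀ t, ∀ x ∈ Ω, ∀ u, f.1 (t, x, u) = 0}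
  add_mem' {f g} hf hg t x hx u := by
    change f.1 _ + g.1 _ = 0
    rw [hf t x hx, hg t x hx, add_zero]
  zero_mem' t x _ u := rfl
  smul_mem' g f hf t x hx u := by
    change g.1 _ * f.1 _ = 0
    rw [hf t x hx, mul_zero]

theorem pd_mem_vanish (hΩ : IsOpen Ω) {f : Loc n m c} (hf : f ∈ vanish Ω)
    (k : BaseIdx n m c) : pd k f ∈ vanish Ω := by
  intro t x hx u
  rcases k with _ | i | j
  · change deriv (fun s => f.1 (s, x, u)) t = 0
    rw [funext fun s => hf s x hx u, deriv_const]
  · change fderiv ℝ (fun y => f.1 (t, y, u)) x _ = 0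
    have : (fun y => f.1 (t, y, u)) =ᶠ[nhds x] fun _ => 0 :=
      Filter.eventuallyEq_of_mem (hΩ.mem_nhds hx) fun y hy => hf t y hy u
    rw [this.fderiv_eq]
    simp
  · change deriv (fun s => f.1 (t, x, Function.update u j s)) (u j) = 0
    rw [funext fun s => hf t x hx _, deriv_const]

theorem der_mem_vanish (hΩ : IsOpen Ω) {f : Loc n m c} (hf : f ∈ vanish Ω)
    (X : BaseIdx n m c → Loc n m c) : der X f ∈ vanish Ω := by
  rw [der_eq_sum X f (s := (finite_pd f).toFinset) (fun k hk => by simpa using hk)]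
  exact Ideal.sum_mem _ fun k _ => Ideal.mul_mem_left _ _ (pd_mem_vanish hΩ hf k)

theorem D_mem_vanish (hΩ : IsOpen Ω) {f : Loc n m c} (i : Fin n) (hf : f ∈ vanish Ω) :
    D i f ∈ vanish Ω := der_mem_vanish hΩ hf _

theorem V_mem_vanish (hΩ : IsOpen Ω) {f : Loc n m c} (Q : FieldIdx m c → Loc n m c)
    (hf : f ∈ vanish Ω) : V Q f ∈ vanish Ω := der_mem_vanish hΩ hf _

theorem smul_mem_ideal (𝔣 : Ideal (Loc n m c)) (a : ℝ) {f : Loc n m c} (hf : f ∈ 𝔣) :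
    a • f ∈ 𝔣 := by
  rw [Algebra.smul_def]
  exact 𝔣.mul_mem_left _ hf

theorem adj_mem_right {𝔣 : Ideal (Loc n m c)} (h𝔣 : ∀ i, ∀ f ∈ 𝔣, D i f ∈ 𝔣)
    (s : FieldIdx m c) (P : Loc n m c) {v : Loc n m c} (hv : v ∈ 𝔣) : adj s P v ∈ 𝔣 := by
  obtain ⟨-, B, -, hB⟩ := exists_box P
  rw [adj_eq_sum s P v (hB s)]
  exact Ideal.sum_mem _ fun J _ => smul_mem_ideal _ _ (Ds_mem h𝔣 J (Ideal.mul_mem_left _ _ hv))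

theorem adj_mem_left {𝔣 : Ideal (Loc n m c)} (h𝔣 : ∀ i, ∀ f ∈ 𝔣, D i f ∈ 𝔣)
    (hpd : ∀ k, ∀ f ∈ 𝔣, pd k f ∈ 𝔣)
    (s : FieldIdx m c) {P : Loc n m c} (v : Loc n m c) (hP : P ∈ 𝔣) : adj s P v ∈ 𝔣 := by
  obtain ⟨-, B, -, hB⟩ := exists_box P
  rw [adj_eq_sum s P v (hB s)]
  exact Ideal.sum_mem _ fun J _ => smul_mem_ideal _ _
    (Ds_mem h𝔣 J (Ideal.mul_mem_right _ _ (hpd _ _ hP)))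

theorem E_mem_vanish (hΩ : IsOpen Ω) {f : Loc n m c} (s : FieldIdx m c) (hf : f ∈ vanish Ω) :
    E s f ∈ vanish Ω :=
  adj_mem_left (fun i _ h => D_mem_vanish hΩ i h) (fun k _ h => pd_mem_vanish hΩ h k) s 1 hf

/-- A variation whose characteristics lie in a differential ideal maps into the ideal. -/
theorem V_mem_of_char_mem {𝔣 : Ideal (Loc n m c)} (h𝔣 : ∀ i, ∀ f ∈ 𝔣, D i f ∈ 𝔣)
    {Q : FieldIdx m c → Loc n m c} (hQ : ∀ s, Q s ∈ 𝔣) (f : Loc n m c) : V Q f ∈ 𝔣 := by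
  obtain ⟨A, B, hA, hB⟩ := exists_box f
  rw [V_eq_sum Q hA hB]
  exact Ideal.sum_mem _ fun s _ => Ideal.sum_mem _ fun J _ =>
    Ideal.mul_mem_right _ _ (Ds_mem h𝔣 J (hQ s))

theorem vanish_closure {f : Loc n m c} (hf : f ∈ vanish Ω) (t : ℝ) {x : Space n}
    (hx : x ∈ closure Ω) (u : JetIdx n m c → ℝ) : f.1 (t, x, u) = 0 := by
  obtain ⟨S, g, hg, h⟩ := exists_isLocalOn f
  have hc : Continuous fun y => f.1 (t, y, u) := by
    have : (fun y => f.1 (t, y, u)) = fun y => g (t, y, fun j => u j) := funext fun y => h _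
    rw [this]
    exact hg.continuous.comp (by fun_prop)
  have hcl : IsClosed {y | f.1 (t, y, u) = 0} := isClosed_eq hc continuous_const
  exact closure_minimal (fun y hy => hf t y hy u) hcl hx

theorem vanish_le_flatAt (hΩ : IsOpen Ω) (t : ℝ) (u : Config n m c) :
    vanish Ω ≤ flatAt Ω t u := fun _ hf I _ hx =>
  vanish_closure (Ds_mem (fun i _ h => D_mem_vanish hΩ i h) I hf) t (frontier_subset_closure hx) _

/-! ### Configurations with prescribed jets -/

theorem iterX_exp (κ : Fin n → ℝ) (x : Space n) (I : MultiIdx n) :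
    iterOp partialX I (fun y : Space n => Real.exp (∑ i, κ i * (y i - x i))) =
      fun y => (∏ i, κ i ^ I i) * Real.exp (∑ i, κ i * (y i - x i)) := by
  have hs : ContDiff ℝ ∞ (fun y : Space n => Real.exp (∑ i, κ i * (y i - x i))) := by fun_prop
  induction I using multiIdx_induction with
  | h0 => simp [iterOp_zero]
  | h I i ih =>
    rw [iterX_add_single I i hs, ih]
    funext y
    have h1 : HasFDerivAt (fun y : Space n => ∑ i, κ i * (y i - x i))
        (∑ i, κ i • (EuclideanSpace.proj i : Space n →L[ℝ] ℝ)) y := by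
      refine HasFDerivAt.fun_sum fun i _ => ?_
      have h2 : HasFDerivAt (fun y : Space n => y i) (EuclideanSpace.proj i : Space n →L[ℝ] ℝ) y :=
        (EuclideanSpace.proj i : Space n →L[ℝ] ℝ).hasFDerivAt
      exact (h2.sub_const (x i)).const_mul (κ i)
    have h3 := (h1.exp.const_mul (∏ i, κ i ^ I i)).fderiv
    unfold partialX
    rw [h3]
    have h4 : ∏ k, κ k ^ (I + Pi.single i 1 : MultiIdx n) k = (∏ k, κ k ^ I k) * κ i := by
      simp only [Pi.add_apply, pow_add, Finset.prod_mul_distrib]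
      congr 1
      rw [Finset.prod_eq_single i]
      · simp
      · intro k _ hk; simp [Pi.single_eq_of_ne hk]
      · simp
    rw [h4]
    simp [PiLp.single_apply]
    ring

/-- The smooth configurations all of whose derivatives vanish on the boundary of `Ω`. -/
def flatConfig (Ω : Set (Space n)) : Submodule ℝ (Config n m c) where
  carrier := {w | Sm w ∧ ∀ s, FlatFn Ω (w s)}
  add_mem' {w w'} h h' := by
    refine ⟨fun s => (h.1 s).add (h'.1 s), fun s I x hx => ?_⟩
    have := iterX_add_smul I (h.1 s) (h'.1 s) 1 x
    simp only [one_mul] at this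
    change iterOp partialX I (fun x => w s x + w' s x) x = 0
    rw [this, h.2 s I x hx, h'.2 s I x hx, add_zero]
  zero_mem' := ⟨fun s => contDiff_const, fun s I x _ => congrFun (iterX_zero I) x⟩
  smul_mem' a w h := by
    refine ⟨fun s => contDiff_const.mul (h.1 s), fun s I x hx => ?_⟩
    have := iterX_add_smul I (contDiff_const (c := (0 : ℝ))) (h.1 s) a x
    simp only [zero_add] at this
    change iterOp partialX I (fun x => a * w s x) x = 0
    rw [this, h.2 s I x hx, iterX_zero]
    simp

/-- The jet at a point, restricted to finitely many coordinates. -/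
def jetMap (Ω : Set (Space n)) (S : Finset (JetIdx n m c)) (x : Space n) :
    flatConfig (m := m) (c := c) Ω →ₗ[ℝ] (S → ℝ) where
  toFun w j := jet w.1 x j
  map_add' w w' := by
    funext j
    have := iterX_add_smul j.1.2 (w.2.1 j.1.1) (w'.2.1 j.1.1) 1 x
    simp only [one_mul] at this
    exact this
  map_smul' a w := by
    funext j
    have := iterX_add_smul j.1.2 (contDiff_const (c := (0 : ℝ))) (w.2.1 j.1.1) a x
    rw [iterX_zero] at this
    simp only [zero_add, Pi.zero_apply] at this
    exact this

/-- Any finite part of a jet at a point of `Ω` is attained: a linear relation between the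
derivatives at the point would, on exponentials, give a vanishing polynomial. -/
theorem jetMap_surjective (hΩ : IsOpen Ω) (S : Finset (JetIdx n m c)) {x : Space n}
    (hx : x ∈ Ω) : Function.Surjective (jetMap Ω S x) := by
  classical
  rw [← LinearMap.range_eq_top]
  by_contra hne
  obtain ⟨f, hf, hle⟩ := Submodule.exists_le_ker_of_lt_top _ (lt_top_iff_ne_top.2 hne)
  refine hf (LinearMap.pi_ext' fun j₀ => ?_)
  obtain ⟨ε, hε, hball⟩ := Metric.isOpen_iff.1 hΩ x hx
  let ψ : ContDiffBump x := ⟨ε / 4, ε / 2, by positivity, by linarith⟩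
  have hψs : tsupport ψ ⊆ Ω := by
    rw [ψ.tsupport_eq]
    exact (Metric.closedBall_subset_ball (by change ε / 2 < ε; linarith)).trans hball
  set s₀ := j₀.1.1 with hs₀
  have key : ∀ κ : Fin n → ℝ,
      ∑ j : S, (if j.1.1 = s₀ then f (Pi.single j 1) * ∏ i, κ i ^ j.1.2 i else 0) = 0 := by
    intro κ
    have he : ContDiff ℝ ∞ (fun y : Space n => Real.exp (∑ i, κ i * (y i - x i))) := by fun_prop
    have hψe : ContDiff ℝ ∞ (fun y => ψ y * Real.exp (∑ i, κ i * (y i - x i))) :=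
      ψ.contDiff.mul he
    have hflat : FlatFn Ω (fun y => ψ y * Real.exp (∑ i, κ i * (y i - x i))) := by
      intro I y hy
      have hy' : y ∈ (tsupport ψ)ᶜ := fun h => hy.2 (by rw [hΩ.interior_eq]; exact hψs h)
      rw [iterX_congr (isClosed_tsupport ψ).isOpen_compl I hψe
        (contDiff_const (c := (0 : ℝ))) (fun z hz => ?_) y hy', iterX_zero, Pi.zero_apply]
      rw [image_eq_zero_of_notMem_tsupport hz, zero_mul]
    let w : flatConfig (m := m) (c := c) Ω :=
      ⟨fun s => if s = s₀ then fun y => ψ y * Real.exp (∑ i, κ i * (y i - x i)) else fun _ => 0,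
        fun s => by dsimp only; split_ifs; exacts [hψe, contDiff_const],
        fun s => by
          dsimp only
          split_ifs
          exacts [hflat, fun I y _ => congrFun (iterX_zero I) y]⟩
    have hw : ∀ j : S, jetMap Ω S x w j = if j.1.1 = s₀ then ∏ i, κ i ^ j.1.2 i else 0 := by
      intro j
      change iterOp partialX j.1.2 (if j.1.1 = s₀ then _ else _) x = _
      split_ifs with h
      · rw [iterX_congr Metric.isOpen_ball j.1.2 hψe he (fun z hz => ?_) x
          (Metric.mem_ball_self (ε := ε / 4) (by positivity)), iterX_exp]
        · simp
        · rw [ψ.one_of_mem_closedBall (Metric.ball_subset_closedBall hz), one_mul]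
      · rw [iterX_zero, Pi.zero_apply]
    have h0 : f (jetMap Ω S x w) = 0 := hle ⟨w, rfl⟩
    rw [LinearMap.pi_apply_eq_sum_univ] at h0
    refine Eq.trans (Finset.sum_congr rfl fun j _ => ?_) h0
    rw [hw, smul_eq_mul]
    have : (fun k => if j = k then (1 : ℝ) else 0) = Pi.single j 1 := by
      funext k; simp [Pi.single_apply, eq_comm]
    rw [this]
    split_ifs <;> ring
  set P : MvPolynomial (Fin n) ℝ := ∑ j : S,
    (if j.1.1 = s₀ then
      MvPolynomial.monomial (Finsupp.equivFunOnFinite.symm j.1.2) (f (Pi.single j 1)) else 0)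
    with hP
  have hP0 : P = 0 := by
    refine MvPolynomial.funext fun κ => ?_
    rw [map_zero, hP, map_sum, ← key κ]
    refine Finset.sum_congr rfl fun j _ => ?_
    split_ifs
    · rw [MvPolynomial.eval_monomial, Finsupp.prod_fintype _ _ (by simp)]
      simp
    · simp
  have h1 := congrArg (MvPolynomial.coeff (Finsupp.equivFunOnFinite.symm j₀.1.2)) hP0
  rw [hP, MvPolynomial.coeff_sum, Finset.sum_eq_single j₀] at h1
  · rw [if_pos hs₀.symm, MvPolynomial.coeff_monomial, if_pos rfl, MvPolynomial.coeff_zero] at h1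
    ext
    simpa using h1
  · intro j _ hj
    split_ifs with h
    · rw [MvPolynomial.coeff_monomial, if_neg]
      intro h2
      exact hj (Subtype.ext (Prod.ext h (Finsupp.equivFunOnFinite.symm.injective h2)))
    · simp
  · simp

end Flat

namespace GaugeTheory

/-! ### Functionals and boundary values on admissible configurations -/

section Functional

variable {n m c r : ℕ} (T : GaugeTheory n m c r)

/-- Integration over the region, as a linear functional on local functions. -/
def int (t : ℝ) {u : Config n m c} (hu : Sm u) : Loc n m c →ₗ[ℝ] ℝ where
  toFun f := T.functional f.1 t u
  map_add' f g := integral_add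
    (integrableOn_of_continuous T.bounded (ev_contDiff f hu t).continuous)
    (integrableOn_of_continuous T.bounded (ev_contDiff g hu t).continuous)
  map_smul' a f := integral_const_mul (μ := volume.restrict T.Ω) a (ev f.1 t u)

/-- The local functions whose functional vanishes on admissible configurations. -/
def null : Submodule ℝ (Loc n m c) where
  carrier := {f | ∀ t u, T.Adm u → T.functional f.1 t u = 0}
  add_mem' {f g} hf hg t u hu := by
    have := map_add (T.int t hu.1) f g
    change T.functional (f + g).1 t u = T.functional f.1 t u + T.functional g.1 t u at this
    rw [this, hf t u hu, hg t u hu, add_zero]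
  zero_mem' t u hu := map_zero (T.int t hu.1)
  smul_mem' a f hf t u hu := by
    have := map_smul (T.int t hu.1) a f
    change T.functional (a • f).1 t u = a * T.functional f.1 t u at this
    rw [this, hf t u hu, mul_zero]

/-- The local functions that vanish on the boundary at all admissible configurations. -/
def bd : Ideal (Loc n m c) where
  carrier := {f | ∀ t u, T.Adm u → ∀ x ∈ frontier T.Ω, ev f.1 t u x = 0}
  add_mem' {f g} hf hg t u hu x hx := by
    have h1 := hf t u hu x hx
    have h2 := hg t u hu x hx
    unfold ev at h1 h2
    change f.1 _ + g.1 _ = 0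
    rw [h1, h2, add_zero]
  zero_mem' t u _ x _ := rfl
  smul_mem' g f hf t u hu x hx := by
    have h1 := hf t u hu x hx
    unfold ev at h1
    change g.1 _ * f.1 _ = 0
    rw [h1, mul_zero]

/-- The local functions that vanish on the boundary, together with all their derivatives, at all
admissible configurations. -/
def flat : Ideal (Loc n m c) where
  carrier := {f | ∀ t u, T.Adm u → f ∈ flatAt T.Ω t u}
  add_mem' hf hg t u hu := (flatAt T.Ω t u).add_mem (hf t u hu) (hg t u hu)
  zero_mem' t u _ := (flatAt T.Ω t u).zero_mem
  smul_mem' g _ hf t u hu := (flatAt T.Ω t u).smul_mem g (hf t u hu)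

theorem mem_flat_iff {f : Loc n m c} : f ∈ T.flat ↔ ∀ I, Ds I f ∈ T.bd :=
  ⟨fun h I t u hu x hx => h t u hu I x hx, fun h t u hu I x hx => h I t u hu x hx⟩

theorem flat_le_bd : T.flat ≤ T.bd := fun f hf => by simpa using T.mem_flat_iff.1 hf 0

theorem D_mem_flat (i : Fin n) (f : Loc n m c) (hf : f ∈ T.flat) : D i f ∈ T.flat :=
  fun t u hu => D_mem_flatAt i f (hf t u hu)

theorem vanish_le_flat : vanish T.Ω ≤ T.flat := fun _ hf t u _ =>
  vanish_le_flatAt T.isOpen t u hf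

theorem vanish_le_null {f : Loc n m c} (hf : f ∈ vanish T.Ω) : f ∈ T.null := fun t _ _ =>
  setIntegral_eq_zero_of_forall_eq_zero fun x hx => hf t x hx _

theorem DivSub_flat_le_null {f : Loc n m c} (hf : f ∈ DivSub T.flat) : f ∈ T.null := by
  intro t u hu
  refine setIntegral_DivSub T.isOpen T.bounded hu.1 (Submodule.span_mono ?_ hf)
  rintro _ ⟨i, k, hk, rfl⟩
  exact ⟨i, k, hk t u hu, rfl⟩

theorem adm_add {u w : Config n m c} (hu : T.Adm u) (hw : Sm w) (hf : ∀ s, FlatFn T.Ω (w s))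
    (ε : ℝ) : T.Adm (fun s x => u s x + ε * w s x) := by
  refine ⟨fun s => (hu.1 s).add (contDiff_const.mul (hw s)), fun a I t x hx => ?_⟩
  rw [← hu.2 a I t x hx, ev, ev]
  congr 3
  funext j
  change iterOp partialX j.2 (fun x => u j.1 x + ε * w j.1 x) x = iterOp partialX j.2 (u j.1) x
  rw [iterX_add_smul j.2 (hu.1 j.1) (hw j.1) ε x, hf j.1 j.2 x hx, mul_zero, add_zero]

/-- Derivative of a functional along a straight line of configurations. -/
theorem hasDerivAt_functional (f : Loc n m c) {u w : Config n m c} (hu : Sm u) (hw : Sm w)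
    (t α : ℝ) (Q : FieldIdx m c → Loc n m c)
    (hQ : ∀ s I, ∀ x ∈ T.Ω, jet w x (s, I) = ev (Ds I (Q s)).1 t u x) :
    HasDerivAt (fun s : ℝ => T.functional f.1 (t + α * s) (fun l y => u l y + s * w l y))
      (T.functional (α • pdt f + V Q f).1 t u) 0 :=
  hasDerivAt_setIntegral (μ := volume) T.isOpen.measurableSet T.bounded
    ((contDiff_line f hu hw t α).of_le (by simp)) fun x hx =>
      hasDerivAt_line f hu hw t α Q fun s I => hQ s I x hx

/-- Variations that are flat on the boundary are tangent to the admissible configurations: cut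
off outside the region, they can be added to the configuration. -/
theorem functional_V_of_flatAt {f : Loc n m c} (hf : f ∈ T.null) (t : ℝ) {u : Config n m c}
    (hu : T.Adm u) (Q : FieldIdx m c → Loc n m c) (hQ : ∀ s, Q s ∈ flatAt T.Ω t u) :
    T.functional (V Q f).1 t u = 0 := by
  have hs : ∀ s, ContDiff ℝ ∞ (ev (Q s).1 t u) := fun s => ev_contDiff (Q s) hu.1 t
  have hfl : ∀ s, FlatFn T.Ω (ev (Q s).1 t u) := fun s => (mem_flatAt_iff hu.1 _).1 (hQ s)
  set w : Config n m c := fun s => T.Ω.indicator (ev (Q s).1 t u) with hw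
  have hws : Sm w := fun s => contDiff_indicator T.isOpen (hs s) (hfl s)
  have hwf : ∀ s, FlatFn T.Ω (w s) := by
    intro s I x hx
    rw [hw, iterX_indicator T.isOpen (hs s) (hfl s), Set.indicator_of_notMem]
    have := hx.2
    rwa [T.isOpen.interior_eq] at this
  have h := T.hasDerivAt_functional f hu.1 hws t 0 Q (by
    intro s I x hx
    change iterOp partialX I (w s) x = _
    rw [hw, iterX_indicator T.isOpen (hs s) (hfl s), Set.indicator_of_mem hx, ev_Ds I _ hu.1])
  have h0 : (fun s : ℝ => T.functional f.1 (t + 0 * s) (fun l y => u l y + s * w l y)) =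
      fun _ => 0 := funext fun s => hf _ _ (T.adm_add hu hws hwf s)
  rw [h0, zero_smul, zero_add] at h
  exact h.unique (hasDerivAt_const _ _)

theorem V_mem_null_of_flat {f : Loc n m c} (hf : f ∈ T.null) (Q : FieldIdx m c → Loc n m c)
    (hQ : ∀ s, Q s ∈ T.flat) : V Q f ∈ T.null := fun t _ hu =>
  T.functional_V_of_flatAt hf t hu Q fun s => hQ s t _ hu

theorem pdt_mem_null {f : Loc n m c} (hf : f ∈ T.null) : pdt f ∈ T.null := by
  intro t u hu
  have h := T.hasDerivAt_functional f hu.1 (w := fun _ _ => 0) (fun _ => contDiff_const) t 1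
    (fun _ => 0) (by
      intro s I x _
      rw [map_zero]
      exact congrFun (iterX_zero I) x)
  have h1 : V (fun _ => 0) f = 0 := by
    have : V (n := n) (0 : FieldIdx m c → Loc n m c) = 0 := map_zero V
    exact congrArg (fun d => d f) this
  have h0 : (fun s : ℝ => T.functional f.1 (t + 1 * s)
      (fun l y => u l y + s * (fun (_ : FieldIdx m c) (_ : Space n) => (0 : ℝ)) l y)) =
      fun _ => 0 := funext fun s => by
    simp only [mul_zero, add_zero]
    exact hf _ _ hu
  rw [h0, h1, one_smul, add_zero] at h
  exact h.unique (hasDerivAt_const _ _)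

theorem pdt_mem_bd {f : Loc n m c} (hf : f ∈ T.bd) : pdt f ∈ T.bd := by
  intro t u hu x hx
  change deriv (fun s => f.1 (s, x, jet u x)) t = 0
  have : (fun s => f.1 (s, x, jet u x)) = fun _ => 0 := funext fun s => hf s u hu x hx
  rw [this, deriv_const]

/-- Every finite part of a jet over the region is attained by an admissible configuration, so
local functions vanishing on admissible configurations over the region vanish on all jets. -/
theorem mem_vanish_of_forall_adm (hne : ∃ u, T.Adm u) {f : Loc n m c}
    (hf : ∀ t u, T.Adm u → ∀ x ∈ T.Ω, ev f.1 t u x = 0) : f ∈ vanish T.Ω := by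
  obtain ⟨u₀, hu₀⟩ := hne
  intro t x hx v
  obtain ⟨S, g, hg, h⟩ := exists_isLocalOn f
  obtain ⟨w, hw⟩ := jetMap_surjective (m := m) (c := c) T.isOpen S hx
    (fun j => v j - jet u₀ x j)
  have h1 := hf t _ (T.adm_add hu₀ w.2.1 w.2.2 1) x hx
  rw [ev, h] at h1
  rw [h, ← h1]
  congr 1
  refine Prod.ext rfl (Prod.ext rfl (funext fun j => ?_))
  change v j = iterOp partialX j.1.2 (fun x => u₀ j.1.1 x + 1 * w.1 j.1.1 x) x
  rw [iterX_add_smul j.1.2 (hu₀.1 _) (w.2.1 _)]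
  have h2 : iterOp partialX j.1.2 (w.1 j.1.1) x = v j - jet u₀ x j := congrFun hw j
  have h3 : iterOp partialX j.1.2 (u₀ j.1.1) x = jet u₀ x j := rfl
  rw [h2, h3]
  ring

/-- The fundamental lemma of the calculus of variations: the Euler derivatives of a vanishing
functional vanish. -/
theorem E_mem_vanish_of_null (hne : ∃ u, T.Adm u) {f : Loc n m c} (hf : f ∈ T.null)
    (s : FieldIdx m c) : E s f ∈ vanish T.Ω := by
  refine T.mem_vanish_of_forall_adm hne fun t u hu => ?_
  have hc := (ev_contDiff (E s f) hu.1 t).continuous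
  have hae : ∀ᵐ x, x ∈ T.Ω → ev (E s f).1 t u x = 0 := by
    refine T.isOpen.ae_eq_zero_of_integral_contDiff_smul_eq_zero
      (hc.locallyIntegrable.locallyIntegrableOn _) fun ψ hψ _ hψs => ?_
    set Q : FieldIdx m c → Loc n m c := Pi.single s (ofX ψ hψ) with hQ
    have hflat : ∀ s', Q s' ∈ flatAt T.Ω t u := by
      intro s'
      by_cases h : s' = s
      · subst h
        rw [hQ, Pi.single_eq_same, mem_flatAt_iff hu.1]
        intro I x hx
        have hx' : x ∈ (tsupport ψ)ᶜ := fun h => hx.2 (by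
          rw [T.isOpen.interior_eq]; exact hψs h)
        have := iterX_congr (isClosed_tsupport ψ).isOpen_compl I hψ
          (contDiff_const (c := (0 : ℝ)))
          (fun z hz => image_eq_zero_of_notMem_tsupport hz) x hx'
        rw [iterX_zero] at this
        exact this
      · rw [hQ, Pi.single_eq_of_ne h]
        exact Ideal.zero_mem _
    have h1 := T.functional_V_of_flatAt hf t hu Q hflat
    have h2 := setIntegral_DivSub T.isOpen T.bounded hu.1
      (V_sub_mem (𝔣 := flatAt T.Ω t u) D_mem_flatAt Q f hflat)
    have h3 : ∑ᶠ s', Q s' * E s' f = ofX ψ hψ * E s f := by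
      rw [finsum_eq_single _ s fun s' hs' => by rw [hQ, Pi.single_eq_of_ne hs', zero_mul], hQ,
        Pi.single_eq_same]
    rw [h3] at h2
    have h4 := map_sub (T.int t hu.1) (V Q f) (ofX ψ hψ * E s f)
    change T.functional _ t u = T.functional _ t u - T.functional _ t u at h4
    unfold GaugeData.functional at h4 h1
    rw [h2, h1, zero_sub, eq_comm, neg_eq_zero] at h4
    rw [← h4, ← setIntegral_eq_integral_of_forall_compl_eq_zero (s := T.Ω)]
    · rfl
    · intro x hx
      rw [image_eq_zero_of_notMem_tsupport fun h => hx (hψs h), zero_smul]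
  intro x hx
  have h1 : (ev (E s f).1 t u) =ᵐ[volume.restrict T.Ω] fun _ => 0 :=
    (ae_restrict_iff' T.isOpen.measurableSet).2 hae
  exact Measure.eqOn_open_of_ae_eq h1 T.isOpen hc.continuousOn continuousOn_const hx

end Functional

/-! ### The theory in terms of the algebra of local functions -/

section Bundled

variable {n m c r : ℕ} (T : GaugeTheory n m c r)

/-- The constraints as local functions. -/
def φL (a : Fin c) : Loc n m c := ⟨T.φ a, T.φ_local a⟩

/-- The operators defining the boundary fields as local functions. -/
def χL (α : Fin r) : Loc n m c := ⟨T.χ α, T.χ_local α⟩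

/-- The bulk hamiltonian density as a local function. -/
def hL : Loc n m c := ⟨T.h, T.h_local⟩

/-- The smeared constraints `λ^a φ_a`. -/
def lamφ : Loc n m c := ∑ a, co (Sum.inr (0, a), 0) * T.φL a

/-- The density of the hamiltonian as a local function. -/
def HL : Loc n m c := T.hL + T.lamφ + ∑ i, D i ⟨T.b i, T.b_local i⟩

/-- The density of the variation of `z^A` generated by `G`. -/
def hamL (G : Loc n m c) (A : Fin m) : Loc n m c := ∑ B, T.σ A B • E (Sum.inl B) G

/-- The characteristics of the time evolution of the fields. -/
def flowL : FieldIdx m c → Loc n m c :=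
  Sum.elim (T.hamL T.HL) (fun la => co (Sum.inr (la.1 + 1, la.2), 0))

/-- The time evolution `δ_t` as a derivation. -/
def dtL : Derivation ℝ (Loc n m c) (Loc n m c) := pdt + V T.flowL

/-- The characteristics of `δ̃` for a transformation with local components. -/
def tildeL (Z : Fin m → Loc n m c) (Λ : Fin c → Loc n m c) : FieldIdx m c → Loc n m c :=
  Sum.elim Z (fun la => T.dtL^[la.1] (Λ la.2))

/-- The density of the unmodified Poisson bracket. -/
def poissonL (F G : Loc n m c) : Loc n m c := ∑ A, E (Sum.inl A) F * T.hamL G A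

theorem coe_sum {ι : Type} (s : Finset ι) (F : ι → Loc n m c) (p) :
    (∑ k ∈ s, F k).1 p = ∑ k ∈ s, (F k).1 p := by
  rw [AddSubmonoidClass.coe_finsetSum, Finset.sum_apply]

theorem HL_coe : T.HL.1 = T.H := by
  funext p
  change T.h p + T.lamφ.1 p + (∑ i, D i ⟨T.b i, T.b_local i⟩).1 p = _
  rw [lamφ, coe_sum, coe_sum]
  simp_rw [D_coe]
  rfl

theorem hamL_coe (G : Loc n m c) (A : Fin m) : (T.hamL G A).1 = T.ham G.1 A := by
  funext p
  rw [hamL, coe_sum, GaugeData.ham]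
  simp_rw [← E_coe]
  rfl

theorem flowL_coe (s : FieldIdx m c) : (T.flowL s).1 = T.flow s := by
  rcases s with A | la
  · change (T.hamL T.HL A).1 = T.ham T.H A
    rw [hamL_coe, HL_coe]
  · rfl

theorem dtL_apply (f : Loc n m c) : T.dtL f = pdt f + V T.flowL f := rfl

theorem dtL_coe (f : Loc n m c) : (T.dtL f).1 = T.dt f.1 := by
  funext p
  change pdT f.1 p + (V T.flowL f).1 p = pdT f.1 p + vary T.flow f.1 p
  rw [V_coe, funext T.flowL_coe]

theorem dtL_iterate_coe (k : ℕ) (f : Loc n m c) : (T.dtL^[k] f).1 = T.dt^[k] f.1 := by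
  induction k with
  | zero => rfl
  | succ k ih => rw [Function.iterate_succ_apply', Function.iterate_succ_apply', dtL_coe, ih]

theorem tildeL_coe (Z : Fin m → Loc n m c) (Λ : Fin c → Loc n m c) (s : FieldIdx m c) :
    (T.tildeL Z Λ s).1 = T.tilde (fun A => (Z A).1, fun a => (Λ a).1) s := by
  rcases s with A | la
  · rfl
  · exact T.dtL_iterate_coe la.1 (Λ la.2)

theorem poissonL_coe (F G : Loc n m c) : (T.poissonL F G).1 = T.poisson F.1 G.1 := by
  funext p
  rw [poissonL, coe_sum, GaugeData.poisson]
  refine Finset.sum_congr rfl fun A _ => ?_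
  change (E (Sum.inl A) F).1 p * (T.hamL G A).1 p = _
  rw [hamL_coe, GaugeData.ham, Finset.mul_sum, E_coe]
  exact Finset.sum_congr rfl fun B _ => (mul_assoc _ _ _).symm

theorem vary_tildeL_coe (Z : Fin m → Loc n m c) (Λ : Fin c → Loc n m c) (f : Loc n m c) :
    (V (T.tildeL Z Λ) f).1 = vary (T.tilde (fun A => (Z A).1, fun a => (Λ a).1)) f.1 := by
  rw [V_coe, funext (T.tildeL_coe Z Λ)]

/-- Preservation of the external boundary conditions, for bundled characteristics. -/
structure PresE (Q : FieldIdx m c → Loc n m c) : Prop where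
  bd : ∀ f ∈ T.bd, V Q f ∈ T.bd
  null : ∀ f ∈ T.null, V Q f ∈ T.null

theorem presE_iff (Q : FieldIdx m c → Loc n m c) :
    T.PresE Q ↔ T.PreservesExternal (fun s => (Q s).1) := by
  constructor
  · rintro ⟨h1, h2⟩
    refine ⟨fun s => (Q s).2, fun f hf h => ?_, fun f hf h => ?_⟩
    · have := h1 ⟨f, hf⟩ h
      intro t u hu x hx
      have := this t u hu x hx
      rwa [V_coe] at this
    · have := h2 ⟨f, hf⟩ h
      intro t u hu
      have := this t u hu
      rwa [V_coe] at this
  · rintro ⟨-, h1, h2⟩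
    refine ⟨fun f hf t u hu x hx => ?_, fun f hf t u hu => ?_⟩
    · rw [V_coe]
      exact h1 f.1 f.2 hf t u hu x hx
    · rw [V_coe]
      exact h2 f.1 f.2 hf t u hu

/-- Preservation of the internal boundary conditions, for bundled characteristics. -/
structure PresI (Q : FieldIdx m c → Loc n m c) : Prop extends T.PresE Q where
  chi : ∀ k α, V Q (T.dtL^[k] (T.χL α)) ∈ T.bd

theorem presI_iff (Q : FieldIdx m c → Loc n m c) :
    T.PresI Q ↔ T.PreservesInternal (fun s => (Q s).1) := by
  have h : ∀ k α t u x, ev (V Q (T.dtL^[k] (T.χL α))).1 t u x =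
      ev (vary (fun s => (Q s).1) (T.dt^[k] (T.χ α))) t u x := by
    intro k α t u x
    rw [V_coe, dtL_iterate_coe]
    rfl
  constructor
  · rintro ⟨h1, h2⟩
    refine ⟨(T.presE_iff Q).1 h1, fun k α t u hu x hx => ?_⟩
    rw [← h]
    exact h2 k α t u hu x hx
  · rintro ⟨h1, h2⟩
    refine ⟨(T.presE_iff Q).2 h1, fun k α t u hu x hx => ?_⟩
    rw [h]
    exact h2 k α t u hu x hx

theorem presE_flow : T.PresE T.flowL := by
  rw [presE_iff, funext T.flowL_coe]
  exact T.flow_preserves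

theorem dtL_mem_bd {f : Loc n m c} (hf : f ∈ T.bd) : T.dtL f ∈ T.bd :=
  T.bd.add_mem (T.pdt_mem_bd hf) (T.presE_flow.bd f hf)

theorem dtL_mem_null {f : Loc n m c} (hf : f ∈ T.null) : T.dtL f ∈ T.null :=
  T.null.add_mem (T.pdt_mem_null hf) (T.presE_flow.null f hf)

theorem dtL_D (i : Fin n) (f : Loc n m c) : T.dtL (D i f) = D i (T.dtL f) := by
  rw [dtL_apply, dtL_apply, pdt_D, V_D, map_add]

theorem dtL_Ds (I : MultiIdx n) (f : Loc n m c) : T.dtL (Ds I f) = Ds I (T.dtL f) :=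
  map_Ds T.dtL_D I f

theorem PresE.flat {T : GaugeTheory n m c r} {Q : FieldIdx m c → Loc n m c} (hQ : T.PresE Q)
    {f : Loc n m c} (hf : f ∈ T.flat) : V Q f ∈ T.flat := by
  rw [mem_flat_iff] at hf ⊢
  intro I
  rw [← V_Ds]
  exact hQ.bd _ (hf I)

/-- Variations that are flat on the boundary preserve the external boundary conditions. -/
theorem presE_of_flat {W : FieldIdx m c → Loc n m c} (hW : ∀ s, W s ∈ T.flat) : T.PresE W where
  bd f _ := T.flat_le_bd (V_mem_of_char_mem T.D_mem_flat hW f)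
  null _ hf := T.V_mem_null_of_flat hf W hW

theorem PresE.add {T : GaugeTheory n m c r} {Q R : FieldIdx m c → Loc n m c} (hQ : T.PresE Q)
    (hR : T.PresE R) : T.PresE (Q + R) := by
  constructor
  · intro f hf
    rw [map_add]
    exact T.bd.add_mem (hQ.bd f hf) (hR.bd f hf)
  · intro f hf
    rw [map_add]
    exact T.null.add_mem (hQ.null f hf) (hR.null f hf)

/-- The commutator of two variations. -/
def comm (Q R : FieldIdx m c → Loc n m c) : FieldIdx m c → Loc n m c :=
  fun s => V Q (R s) - V R (Q s)

theorem V_comm (Q R : FieldIdx m c → Loc n m c) (f : Loc n m c) :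
    V (comm Q R) f = V Q (V R f) - V R (V Q f) := (lie_V Q R f).symm

theorem PresE.comm {T : GaugeTheory n m c r} {Q R : FieldIdx m c → Loc n m c} (hQ : T.PresE Q)
    (hR : T.PresE R) : T.PresE (comm Q R) := by
  constructor
  · intro f hf
    rw [V_comm]
    exact T.bd.sub_mem (hQ.bd _ (hR.bd f hf)) (hR.bd _ (hQ.bd f hf))
  · intro f hf
    rw [V_comm]
    exact T.null.sub_mem (hQ.null _ (hR.null f hf)) (hR.null _ (hQ.null f hf))

/-- The commutator of a variation with the time evolution. -/
def commT (Q : FieldIdx m c → Loc n m c) : FieldIdx m c → Loc n m c :=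
  fun s => V Q (T.flowL s) - T.dtL (Q s)

theorem V_commT (Q : FieldIdx m c → Loc n m c) (f : Loc n m c) :
    V (T.commT Q) f = V Q (T.dtL f) - T.dtL (V Q f) := by
  have h : T.commT Q = comm Q T.flowL - fun s => pdt (Q s) := by
    funext s
    simp only [commT, comm, dtL_apply, Pi.sub_apply]
    ring
  rw [h, map_sub]
  change V (comm Q T.flowL) f - V (fun s => pdt (Q s)) f = _
  rw [V_comm, ← lie_pdt_V, dtL_apply, dtL_apply, map_add]
  ring

/-- Commutation with the time evolution preserves the variations that are tangent to the
internal boundary conditions. -/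
theorem PresI.commT {T : GaugeTheory n m c r} {Q : FieldIdx m c → Loc n m c} (hQ : T.PresI Q) :
    T.PresI (T.commT Q) where
  bd f hf := by
    rw [V_commT]
    exact T.bd.sub_mem (hQ.bd _ (T.dtL_mem_bd hf)) (T.dtL_mem_bd (hQ.bd f hf))
  null f hf := by
    rw [V_commT]
    exact T.null.sub_mem (hQ.null _ (T.dtL_mem_null hf)) (T.dtL_mem_null (hQ.null f hf))
  chi k α := by
    rw [V_commT, ← Function.iterate_succ_apply' T.dtL]
    exact T.bd.sub_mem (hQ.chi _ α) (T.dtL_mem_bd (hQ.chi k α))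

/-! ### The ideal of the constraints -/

/-- The ideal generated, over the region, by the constraints and their derivatives. -/
def constr : Ideal (Loc n m c) :=
  Ideal.span (Set.range fun j : Fin c × MultiIdx n => Ds j.2 (T.φL j.1)) ⊔ vanish T.Ω

theorem Ds_φL_mem (a : Fin c) (J : MultiIdx n) : Ds J (T.φL a) ∈ T.constr :=
  Ideal.mem_sup_left (Ideal.subset_span ⟨(a, J), rfl⟩)

theorem φL_mem (a : Fin c) : T.φL a ∈ T.constr := by simpa using T.Ds_φL_mem a 0

theorem vanish_le_constr : vanish T.Ω ≤ T.constr := le_sup_right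

theorem constr_le {𝔣 : Ideal (Loc n m c)} (h1 : ∀ a J, Ds J (T.φL a) ∈ 𝔣)
    (h2 : vanish T.Ω ≤ 𝔣) : T.constr ≤ 𝔣 :=
  sup_le (Ideal.span_le.2 (by rintro _ ⟨j, rfl⟩; exact h1 j.1 j.2)) h2

theorem derivation_mem_constr (δ : Derivation ℝ (Loc n m c) (Loc n m c))
    (h1 : ∀ a J, δ (Ds J (T.φL a)) ∈ T.constr) (h2 : ∀ f ∈ vanish T.Ω, δ f ∈ T.constr)
    {f : Loc n m c} (hf : f ∈ T.constr) : δ f ∈ T.constr := by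
  let 𝔣 : Ideal (Loc n m c) :=
    { carrier := {f | f ∈ T.constr ∧ δ f ∈ T.constr}
      add_mem' := fun hf hg => ⟨T.constr.add_mem hf.1 hg.1, by
        rw [map_add]; exact T.constr.add_mem hf.2 hg.2⟩
      zero_mem' := ⟨T.constr.zero_mem, by rw [map_zero]; exact T.constr.zero_mem⟩
      smul_mem' := fun g f hf => ⟨T.constr.smul_mem g hf.1, by
        rw [smul_eq_mul, Derivation.leibniz]
        exact T.constr.add_mem (T.constr.smul_mem _ hf.2) (T.constr.mul_mem_right _ hf.1)⟩ }
  have h : T.constr ≤ 𝔣 := T.constr_le (fun a J => ⟨T.Ds_φL_mem a J, h1 a J⟩)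
    (fun f hf => ⟨T.vanish_le_constr hf, h2 f hf⟩)
  exact (h hf).2

theorem D_mem_constr (i : Fin n) (f : Loc n m c) (hf : f ∈ T.constr) : D i f ∈ T.constr :=
  T.derivation_mem_constr (D i)
    (fun a J => by rw [← Ds_add_single]; exact T.Ds_φL_mem a _)
    (fun _ hf => T.vanish_le_constr (D_mem_vanish T.isOpen i hf)) hf

theorem mem_constr_of_inConstraintIdeal {f : Loc n m c} (hf : T.InConstraintIdeal f.1) :
    f ∈ T.constr := by
  obtain ⟨S, k, hk, h⟩ := hf
  set g : Loc n m c := ∑ j ∈ S, (⟨k j, hk j⟩ : Loc n m c) * Ds j.2 (T.φL j.1) with hg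
  have h1 : f - g ∈ vanish T.Ω := by
    intro t x hx u
    change f.1 _ - g.1 _ = 0
    rw [h t x hx u, hg, coe_sum, sub_eq_zero]
    refine Finset.sum_congr rfl fun j _ => ?_
    change _ = k j _ * (Ds j.2 (T.φL j.1)).1 _
    rw [Ds_coe]
    rfl
  have h2 : g ∈ T.constr := Ideal.sum_mem _ fun j _ => T.constr.mul_mem_left _ (T.Ds_φL_mem _ _)
  have := T.constr.add_mem (T.vanish_le_constr h1) h2
  rwa [sub_add_cancel] at this

theorem indep_of_onlyZ {f : Loc n m c} (hf : OnlyZ f.1) (la : ℕ × Fin c) :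
    f ∈ indep n (Sum.inr la) := by
  intro J
  refine Subtype.ext (funext fun p => ?_)
  change deriv (fun s => f.1 (p.1, p.2.1, Function.update p.2.2 (Sum.inr la, J) s)) _ = 0
  have : (fun s => f.1 (p.1, p.2.1, Function.update p.2.2 (Sum.inr la, J) s)) =
      fun _ => f.1 (p.1, p.2.1, p.2.2) := funext fun s => hf _ _ _ _ _ fun A I => by
    rw [Function.update_of_ne (by simp)]
  rw [this, deriv_const]

theorem pdt_of_onlyZ {f : Loc n m c} (hf : OnlyZ f.1) : pdt f = 0 := by
  refine Subtype.ext (funext fun p => ?_)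
  change deriv (fun s => f.1 (s, p.2.1, p.2.2)) _ = 0
  have : (fun s => f.1 (s, p.2.1, p.2.2)) =
      fun _ => f.1 (p.1, p.2.1, p.2.2) := funext fun s => hf _ _ _ _ _ fun A I => rfl
  rw [this, deriv_const]

theorem indep_of_onlyZLam {f : Loc n m c} (hf : OnlyZLam f.1) (l : ℕ) (a : Fin c) :
    f ∈ indep n (Sum.inr (l + 1, a)) := by
  intro J
  refine Subtype.ext (funext fun p => ?_)
  change deriv (fun s => f.1 (p.1, p.2.1, Function.update p.2.2 (Sum.inr (l + 1, a), J) s)) _ = 0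
  have : (fun s => f.1 (p.1, p.2.1, Function.update p.2.2 (Sum.inr (l + 1, a), J) s)) =
      fun _ => f.1 (p.1, p.2.1, p.2.2) := funext fun s => hf _ _ _ _ _
    (fun A I => by rw [Function.update_of_ne (by simp)])
    (fun b I => by rw [Function.update_of_ne (by simp)])
  rw [this, deriv_const]

theorem φL_indep (a : Fin c) (la : ℕ × Fin c) : T.φL a ∈ indep n (Sum.inr la) :=
  indep_of_onlyZ (T.φ_only a) la

theorem HL_indep (l : ℕ) (a : Fin c) : T.HL ∈ indep n (Sum.inr (l + 1, a)) := by
  refine add_mem (add_mem (indep_of_onlyZ T.h_only _) (sum_mem fun b _ => mul_mem ?_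
    (T.φL_indep b _))) (sum_mem fun i _ => D_mem_indep i (indep_of_onlyZLam (T.b_only i) l a))
  intro J
  rw [pdu_co, if_neg (by simp)]

theorem hamL_add (F G : Loc n m c) : T.hamL (F + G) = T.hamL F + T.hamL G := by
  funext A
  simp [hamL, Finset.sum_add_distrib]

theorem hamL_DivSub {F : Loc n m c} {𝔣 : Ideal (Loc n m c)} (hF : F ∈ DivSub 𝔣) :
    T.hamL F = 0 := by
  funext A
  simp [hamL, E_DivSub hF]

theorem hamL_HL : T.hamL T.HL = T.hamL T.hL + T.hamL T.lamφ := by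
  rw [HL, hamL_add, hamL_add, T.hamL_DivSub (F := ∑ i, D i ⟨T.b i, T.b_local i⟩) (𝔣 := ⊤),
    add_zero]
  exact Submodule.sum_mem _ fun i _ => D_mem_DivSub i trivial

theorem V_congr_of_indep {f : Loc n m c} (hf : ∀ la, f ∈ indep n (Sum.inr la))
    {Q R : FieldIdx m c → Loc n m c} (h : ∀ A, Q (Sum.inl A) = R (Sum.inl A)) :
    V Q f = V R f := by
  obtain ⟨A, B, hA, hB⟩ := exists_box f
  rw [V_eq_sum Q hA hB, V_eq_sum R hA hB]
  refine Finset.sum_congr rfl fun s _ => Finset.sum_congr rfl fun J _ => ?_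
  rcases s with C | la
  · rw [h]
  · rw [hf la J, mul_zero, mul_zero]

/-- The constraints are first class, so that their time derivatives are combinations of them. -/
theorem dtL_φL_mem (a : Fin c) : T.dtL (T.φL a) ∈ T.constr := by
  have hlam : T.lamφ.1 = fun p => ∑ b, p.2.2 (Sum.inr (0, b), 0) * T.φ b p := by
    funext p
    rw [lamφ, coe_sum]
    rfl
  set Q : Loc n m c → FieldIdx m c → Loc n m c := fun G => Sum.elim (T.hamL G) 0 with hQ
  have hQc : ∀ G, (fun s => (Q G s).1) = T.hamVar G.1 := by
    intro G
    funext s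
    rcases s with A | la
    · exact T.hamL_coe G A
    · rfl
  have h1 : V (Q T.hL) (T.φL a) ∈ T.constr := by
    refine T.mem_constr_of_inConstraintIdeal ?_
    rw [V_coe, hQc]
    exact T.h_firstClass a
  have h2 : V (Q T.lamφ) (T.φL a) ∈ T.constr := by
    refine T.mem_constr_of_inConstraintIdeal ?_
    rw [V_coe, hQc, hlam]
    exact T.φ_firstClass a
  have h3 : V T.flowL (T.φL a) = V (Q T.hL + Q T.lamφ) (T.φL a) :=
    V_congr_of_indep (T.φL_indep a) fun A => by
      change T.hamL T.HL A = T.hamL T.hL A + T.hamL T.lamφ A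
      rw [hamL_HL]
      rfl
  rw [dtL_apply, pdt_of_onlyZ (T.φ_only a), zero_add, h3, map_add]
  exact T.constr.add_mem h1 h2

theorem dtL_mem_vanish {f : Loc n m c} (hf : f ∈ vanish T.Ω) : T.dtL f ∈ vanish T.Ω :=
  (vanish T.Ω).add_mem (pd_mem_vanish T.isOpen hf _) (V_mem_vanish T.isOpen _ hf)

theorem dtL_mem_constr (f : Loc n m c) (hf : f ∈ T.constr) : T.dtL f ∈ T.constr :=
  T.derivation_mem_constr T.dtL
    (fun a J => by
      rw [dtL_Ds]
      exact Ds_mem T.D_mem_constr J (T.dtL_φL_mem a))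
    (fun _ hf => T.vanish_le_constr (T.dtL_mem_vanish hf)) hf

/-- The external boundary conditions state that the constraints are flat on the boundary. -/
theorem constr_le_flat : T.constr ≤ T.flat :=
  T.constr_le (fun a J => T.mem_flat_iff.2 fun I t u hu x hx => by
      rw [Ds_Ds, Ds_coe]
      exact hu.2 a _ t x hx) T.vanish_le_flat

theorem ev_constr {f : Loc n m c} (hf : f ∈ T.constr) (t : ℝ) {u : Config n m c}
    (hu : T.OnShell u) {x : Space n} (hx : x ∈ T.Ω) : ev f.1 t u x = 0 := by
  let 𝔣 : Ideal (Loc n m c) :=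
    { carrier := {f | ev f.1 t u x = 0}
      add_mem' := fun {f g} hf hg => by
        change f.1 _ + g.1 _ = 0
        have h1 : f.1 _ = 0 := hf
        have h2 : g.1 _ = 0 := hg
        rw [h1, h2, add_zero]
      zero_mem' := rfl
      smul_mem' := fun g f hf => by
        have h1 : f.1 _ = 0 := hf
        change g.1 _ * f.1 _ = 0
        rw [h1, mul_zero] }
  refine T.constr_le (𝔣 := 𝔣) (fun a J => ?_) (fun f hf => hf t x hx _) hf
  change ev (Ds J (T.φL a)).1 t u x = 0
  rw [ev_Ds J _ hu.1.1, iterX_congr T.isOpen J (ev_contDiff _ hu.1.1 t)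
    (contDiff_const (c := (0 : ℝ))) (fun y hy => hu.2 a t y (subset_closure hy)) x hx, iterX_zero]
  rfl

end Bundled

/-! ### Generators of external symmetries -/

section Generators

variable {n m c r : ℕ} (T : GaugeTheory n m c r)

/-- Contraction with the Poisson structure. -/
def sig (y : Fin m → Loc n m c) (A : Fin m) : Loc n m c := ∑ B, T.σ A B • y B

theorem hamL_eq_sig (G : Loc n m c) : T.hamL G = T.sig (fun B => E (Sum.inl B) G) := rfl

theorem map_sig (δ : Loc n m c →ₗ[ℝ] Loc n m c) (y : Fin m → Loc n m c) (A : Fin m) :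
    δ (T.sig y A) = T.sig (fun B => δ (y B)) A := by
  simp [sig, map_sum]

theorem der_sig (δ : Derivation ℝ (Loc n m c) (Loc n m c)) (y : Fin m → Loc n m c) (A : Fin m) :
    δ (T.sig y A) = T.sig (fun B => δ (y B)) A := T.map_sig δ.toLinearMap y A

theorem sig_sub (x y : Fin m → Loc n m c) (A : Fin m) :
    T.sig (fun B => x B - y B) A = T.sig x A - T.sig y A := by
  simp [sig, smul_sub]

theorem sig_mem (𝔣 : Ideal (Loc n m c)) {y : Fin m → Loc n m c} (hy : ∀ B, y B ∈ 𝔣)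
    (A : Fin m) : T.sig y A ∈ 𝔣 :=
  Ideal.sum_mem _ fun B _ => smul_mem_ideal _ _ (hy B)

theorem σ_swap (A B : Fin m) : T.σ A B = -T.σ B A := by
  have := congrFun (congrFun T.σ_antisymm B) A
  simpa using this

/-- The Poisson structure is antisymmetric, under any bilinear operation. -/
theorem sum_sig_left (β : Loc n m c →ₗ[ℝ] Loc n m c →ₗ[ℝ] Loc n m c) (x y : Fin m → Loc n m c) :
    ∑ A, β (T.sig x A) (y A) = -∑ A, β (x A) (T.sig y A) := by
  simp only [sig, map_sum, LinearMap.sum_apply, map_smul, LinearMap.smul_apply]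
  rw [Finset.sum_comm, ← Finset.sum_neg_distrib]
  refine Finset.sum_congr rfl fun A _ => ?_
  rw [← Finset.sum_neg_distrib]
  refine Finset.sum_congr rfl fun B _ => ?_
  rw [σ_swap, neg_smul]

theorem sum_sig_mul (x y : Fin m → Loc n m c) :
    ∑ A, T.sig x A * y A = -∑ A, x A * T.sig y A :=
  T.sum_sig_left (LinearMap.mul ℝ (Loc n m c)) x y

theorem poissonL_swap (F G : Loc n m c) : T.poissonL F G = -T.poissonL G F := by
  have := T.sum_sig_mul (fun B => E (Sum.inl B) F) (fun B => E (Sum.inl B) G)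
  rw [eq_neg_iff_add_eq_zero] at this ⊢
  rw [← this, add_comm, poissonL, poissonL]
  congr 1
  exact Finset.sum_congr rfl fun A _ => mul_comm _ _

theorem finsum_field {F : FieldIdx m c → Loc n m c} (hF : (Function.support F).Finite) :
    ∑ᶠ s, F s = ∑ A, F (Sum.inl A) + ∑ᶠ la, F (Sum.inr la) := by
  have hi : (Function.support fun la => F (Sum.inr la)).Finite :=
    hF.preimage (f := Sum.inr) Sum.inr_injective.injOn
  rw [finsum_eq_sum_of_support_subset (s := Finset.univ.disjSum hi.toFinset),
    Finset.sum_disjSum, finsum_eq_sum_of_support_subset (s := hi.toFinset)]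
  · simp
  · rintro (A | la) h
    · simp
    · simpa using h

theorem finite_mul_E (Q : FieldIdx m c → Loc n m c) (f : Loc n m c) :
    (Function.support fun s => Q s * E s f).Finite :=
  (finite_E f).subset fun _ h => right_ne_zero_of_mul h

theorem finite_adj_E (s : FieldIdx m c) (Q : FieldIdx m c → Loc n m c) (f : Loc n m c) :
    (Function.support fun s' => adj s (Q s') (E s' f)).Finite :=
  (finite_E f).subset fun s' h h0 => h (by
    have h0' : E s' f = 0 := h0
    simp [h0'])

theorem finite_adj_E' (s : FieldIdx m c) (Q : FieldIdx m c → Loc n m c) (f : Loc n m c) :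
    (Function.support fun s' => adj s (E s' f) (Q s')).Finite :=
  (finite_E f).subset fun s' h h0 => h (by
    have h0' : E s' f = 0 := h0
    simp [h0'])

/-- The density of the smeared constraints `φ_a Λ^a`. -/
def smear (Λ : Fin c → Loc n m c) : Loc n m c := ∑ a, T.φL a * Λ a

theorem smear_sub_mem {Λ Λ' : Fin c → Loc n m c} (hΛ : ∀ a, Λ a - Λ' a ∈ vanish T.Ω) :
    T.smear Λ - T.smear Λ' ∈ vanish T.Ω := by
  rw [smear, smear, ← Finset.sum_sub_distrib]
  refine Ideal.sum_mem _ fun a _ => ?_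
  rw [← mul_sub]
  exact Ideal.mul_mem_left _ _ (hΛ a)

theorem E_smear (s : FieldIdx m c) (Λ : Fin c → Loc n m c) :
    E s (T.smear Λ) = ∑ a, adj s (T.φL a) (Λ a) + ∑ a, adj s (Λ a) (T.φL a) := by
  rw [smear, map_sum, ← Finset.sum_add_distrib]
  exact Finset.sum_congr rfl fun a _ => E_mul s _ _

theorem E_smear_lam_mem (la : ℕ × Fin c) (Λ : Fin c → Loc n m c) :
    E (Sum.inr la) (T.smear Λ) ∈ T.constr := by
  rw [E_smear, Finset.sum_eq_zero fun a _ => adj_eq_zero _ _ _ (T.φL_indep a la), zero_add]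
  exact Ideal.sum_mem _ fun a _ => adj_mem_right T.D_mem_constr _ _ (T.φL_mem a)

theorem adj_co (s s' : FieldIdx m c) (v : Loc n m c) :
    adj s (co (s', 0)) v = if s = s' then v else 0 := by
  rw [adj_eq_sum s _ v (B := {0}) (fun J hJ => by
    rw [pdu_co, if_neg]
    intro h
    exact hJ (by simpa using (Prod.ext_iff.1 h).2))]
  rw [Finset.sum_singleton, pdu_co]
  by_cases h : s = s'
  · simp [h]
  · rw [if_neg (fun h' => h (Prod.ext_iff.1 h').1), if_neg h]
    simp

theorem E_HL_lam (a : Fin c) : E (Sum.inr (0, a)) T.HL = T.φL a := by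
  have h1 : E (Sum.inr (0, a)) T.hL = 0 := E_eq_zero _ _ (indep_of_onlyZ T.h_only _)
  have h2 : E (Sum.inr (0, a)) T.lamφ = T.φL a := by
    rw [lamφ, map_sum, Finset.sum_eq_single a]
    · rw [E_mul, adj_co, if_pos rfl, adj_eq_zero _ _ _ (T.φL_indep a _), add_zero]
    · intro b _ hb
      rw [E_mul, adj_co, if_neg (by simpa using Ne.symm hb), adj_eq_zero _ _ _ (T.φL_indep b _),
        add_zero]
    · simp
  rw [HL, map_add, map_add, h1, h2, map_sum, Finset.sum_eq_zero fun i _ => E_D _ i _]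
  simp

theorem E_HL_lam_succ (l : ℕ) (a : Fin c) : E (Sum.inr (l + 1, a)) T.HL = 0 :=
  E_eq_zero _ _ (T.HL_indep l a)

/-- A sum over the fields of terms linear in the Euler derivatives of the hamiltonian. -/
theorem finsum_HL {F : FieldIdx m c → Loc n m c} (hF : (Function.support F).Finite)
    (h0 : ∀ s, E s T.HL = 0 → F s = 0) :
    ∑ᶠ s, F s = ∑ A, F (Sum.inl A) + ∑ a, F (Sum.inr (0, a)) := by
  rw [finsum_field hF]
  congr 1
  have hinj : Function.Injective (fun a : Fin c => ((0 : ℕ), a)) := fun a b h => by simpa using h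
  rw [finsum_eq_sum_of_support_subset (s := Finset.univ.map ⟨_, hinj⟩), Finset.sum_map]
  · rfl
  · rintro ⟨l, a⟩ h
    rcases l with _ | l
    · simp
    · exact absurd (h0 _ (T.E_HL_lam_succ l a)) h

/-- The characteristics of the transformation generated by a couple. -/
def chars (G : Loc n m c) (Λ : Fin c → Loc n m c) : FieldIdx m c → Loc n m c :=
  T.tildeL (T.hamL G) Λ

theorem chars_lam (G : Loc n m c) (Λ : Fin c → Loc n m c) (l : ℕ) (a : Fin c) :
    T.chars G Λ (Sum.inr (l, a)) = T.dtL^[l] (Λ a) := rfl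

/-- A couple of local functions that generates an external symmetry. Invariance of the action is
expressed by the absence of bulk terms in `δ_t G - {G, H} - δ̃_G H`. -/
structure Ext (G : Loc n m c) (Λ : Fin c → Loc n m c) : Prop where
  presE : T.PresE (T.chars G Λ)
  sources : ∀ Q, T.PresI Q → ∀ α,
    V (T.chars G Λ) (V Q (T.χL α)) - V Q (V (T.chars G Λ) (T.χL α)) ∈ T.bd
  diff : ∀ Q, T.PresI Q → V Q G - ∑ᶠ s, Q s * E s G ∈ T.null
  inv : ∃ v : Fin n → Loc n m c, (∀ Q, T.PresI Q → V Q (∑ i, D i (v i)) ∈ T.null) ∧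
    T.dtL G - T.poissonL G T.HL - V (T.chars G Λ) T.HL - ∑ i, D i (v i) ∈ T.null

variable {T} {G : Loc n m c} {Λ : Fin c → Loc n m c}

/-- The time derivative of a generator is, up to a divergence, the smeared constraints. -/
theorem Ext.E_dtL (h : T.Ext G Λ) (hne : ∃ u, T.Adm u) (s : FieldIdx m c) :
    E s (T.dtL G) - E s (T.smear Λ) ∈ vanish T.Ω := by
  obtain ⟨v, -, hv⟩ := h.inv
  have h1 := T.E_mem_vanish_of_null hne hv s
  have h2 := E_DivSub (V_sub_mem (𝔣 := ⊤) (fun _ _ _ => trivial) (T.chars G Λ) T.HL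
    fun _ => trivial) s
  rw [T.finsum_HL (finite_mul_E _ _) (fun s hs => by rw [hs, mul_zero])] at h2
  have h3 : ∑ A, T.chars G Λ (Sum.inl A) * E (Sum.inl A) T.HL = -T.poissonL G T.HL := by
    rw [poissonL_swap, neg_neg, poissonL]
    exact Finset.sum_congr rfl fun A _ => mul_comm _ _
  have h4 : ∑ a, T.chars G Λ (Sum.inr (0, a)) * E (Sum.inr (0, a)) T.HL = T.smear Λ :=
    Finset.sum_congr rfl fun a _ => by rw [E_HL_lam, mul_comm]; rfl
  rw [h3, h4, map_sub, map_add, map_neg, sub_eq_zero] at h2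
  have h5 : E s (∑ i, D i (v i)) = 0 := by
    rw [map_sum, Finset.sum_eq_zero fun i _ => E_D s i _]
  rw [map_sub, map_sub, map_sub, h2, h5] at h1
  convert h1 using 1
  ring

variable (T) in
/-- Besides commuting with the time evolution, the Euler operator of `λ^{(l+1)}` picks up the one of
`λ^{(l)}`, whose time derivative it is. -/
theorem E_lam_dtL (l : ℕ) (b : Fin c) (G : Loc n m c) :
    E (Sum.inr (l + 1, b)) (T.dtL G) =
      T.dtL (E (Sum.inr (l + 1, b)) G) + E (Sum.inr (l, b)) G := by
  rw [dtL_apply, dtL_apply, map_add, E_pdt, E_V, finsum_eq_single _ (Sum.inr (l, b)), ← add_assoc]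
  · congr 1
    change adj _ (co (Sum.inr (l + 1, b), 0)) _ = _
    rw [adj_co, if_pos rfl]
  · rintro (A | ⟨l', b'⟩) hs
    · refine adj_eq_zero _ _ _ ?_
      have : T.hamL T.HL A ∈ indep n (Sum.inr (l + 1, b)) :=
        Subalgebra.sum_mem _ fun B _ => Subalgebra.smul_mem _ (E_mem_indep (T.HL_indep l b)) _
      exact this
    · change adj _ (co (Sum.inr (l' + 1, b'), 0)) _ = _
      rw [adj_co, if_neg]
      intro h
      refine hs ?_
      simp only [Sum.inr.injEq, Prod.mk.injEq, add_left_inj] at h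
      rw [h.1, h.2]

/-- The recursion that determines the derivatives of a generator along the time derivatives of
the multipliers. -/
theorem Ext.E_lam (h : T.Ext G Λ) (hne : ∃ u, T.Adm u) (l : ℕ) (b : Fin c) :
    E (Sum.inr (l, b)) G - (E (Sum.inr (l + 1, b)) (T.smear Λ) -
      T.dtL (E (Sum.inr (l + 1, b)) G)) ∈ vanish T.Ω := by
  have h1 := h.E_dtL hne (Sum.inr (l + 1, b))
  rw [E_lam_dtL] at h1
  convert h1 using 1
  ring

theorem exists_E_lam_bound (f : Loc n m c) :
    ∃ N, ∀ l, N ≤ l → ∀ b, E (Sum.inr (l, b)) f = 0 := by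
  have hi : {la : ℕ × Fin c | E (Sum.inr la) f ≠ 0}.Finite :=
    (finite_E f).preimage (f := Sum.inr) Sum.inr_injective.injOn
  obtain ⟨N, hN⟩ := (hi.image Prod.fst).bddAbove
  refine ⟨N + 1, fun l hl b => ?_⟩
  by_contra h
  have := hN ⟨(l, b), h, rfl⟩
  simp at this
  omega

theorem descending_induction {P : ℕ → Prop} (N : ℕ) (h0 : ∀ l, N ≤ l → P l)
    (h1 : ∀ l, P (l + 1) → P l) (l : ℕ) : P l := by
  have : ∀ k l, N ≤ l + k → P l := by
    intro k
    induction k with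
    | zero => exact fun l hl => h0 l hl
    | succ k ih => exact fun l hl => h1 l (ih (l + 1) (by omega))
  exact this N l (by omega)

/-- The derivatives of a generator along the multipliers are combinations of constraints: they
vanish for high time derivatives of the multipliers, and the recursion descends from there. -/
theorem Ext.E_lam_mem (h : T.Ext G Λ) (hne : ∃ u, T.Adm u) (la : ℕ × Fin c) :
    E (Sum.inr la) G ∈ T.constr := by
  obtain ⟨l, b⟩ := la
  obtain ⟨N, hN⟩ := exists_E_lam_bound G
  refine descending_induction (P := fun l => E (Sum.inr (l, b)) G ∈ T.constr) N
    (fun l hl => by rw [hN l hl]; exact T.constr.zero_mem) (fun l hl => ?_) l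
  have h1 := T.constr.add_mem (T.vanish_le_constr (h.E_lam hne l b))
    (T.constr.sub_mem (T.E_smear_lam_mem (l + 1, b) Λ) (T.dtL_mem_constr _ hl))
  rwa [sub_add_cancel] at h1

/-- Generators of the same transformation of the multipliers have the same derivatives along the
multipliers. -/
theorem Ext.E_lam_sub_mem {G' : Loc n m c} {Λ' : Fin c → Loc n m c} (h : T.Ext G Λ)
    (h' : T.Ext G' Λ') (hne : ∃ u, T.Adm u) (hΛ : ∀ a, Λ a - Λ' a ∈ vanish T.Ω)
    (la : ℕ × Fin c) : E (Sum.inr la) (G - G') ∈ vanish T.Ω := by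
  obtain ⟨l, b⟩ := la
  obtain ⟨N, hN⟩ := exists_E_lam_bound (G - G')
  refine descending_induction (P := fun l => E (Sum.inr (l, b)) (G - G') ∈ vanish T.Ω) N
    (fun l hl => by rw [hN l hl]; exact (vanish T.Ω).zero_mem) (fun l hl => ?_) l
  have h0 := T.smear_sub_mem hΛ
  have h1 := E_mem_vanish T.isOpen (Sum.inr (l + 1, b)) h0
  have h2 := (vanish T.Ω).add_mem ((vanish T.Ω).sub_mem (h.E_lam hne l b) (h'.E_lam hne l b))
    ((vanish T.Ω).sub_mem h1 (T.dtL_mem_vanish hl))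
  convert h2 using 1
  simp only [map_sub]
  ring

/-- The commutator of an external symmetry with the time evolution vanishes on the constraint
surface. -/
theorem Ext.commT_mem (h : T.Ext G Λ) (hne : ∃ u, T.Adm u) (s : FieldIdx m c) :
    T.commT (T.chars G Λ) s ∈ T.constr := by
  rcases s with A | ⟨l, a⟩
  · have hA : T.commT (T.chars G Λ) (Sum.inl A) = T.sig (fun B =>
        V (T.chars G Λ) (E (Sum.inl B) T.HL) - T.dtL (E (Sum.inl B) G)) A := by
      change V (T.chars G Λ) (T.sig _ A) - T.dtL (T.sig _ A) = _
      rw [der_sig, der_sig, sig_sub]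
    rw [hA]
    refine T.sig_mem _ (fun B => ?_) A
    have h1 : V (T.chars G Λ) (E (Sum.inl B) T.HL) =
        ∑ A, adj (Sum.inl B) (E (Sum.inl A) T.HL) (T.hamL G A) +
          ∑ a, adj (Sum.inl B) (T.φL a) (Λ a) := by
      rw [V_E, T.finsum_HL (finite_adj_E' _ _ _) (fun s hs => by rw [hs]; simp)]
      congr 1
      exact Finset.sum_congr rfl fun a _ => by rw [E_HL_lam]; rfl
    have h2 : E (Sum.inl B) (T.dtL G) = T.dtL (E (Sum.inl B) G) -
        ∑ A, adj (Sum.inl B) (E (Sum.inl A) T.HL) (T.hamL G A) := by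
      have h3 : ∑ A, adj (Sum.inl B) (T.hamL T.HL A) (E (Sum.inl A) G) =
          -∑ A, adj (Sum.inl B) (E (Sum.inl A) T.HL) (T.hamL G A) :=
        T.sum_sig_left (adj (Sum.inl B)) (fun A => E (Sum.inl A) T.HL)
          (fun A => E (Sum.inl A) G)
      rw [dtL_apply, dtL_apply, map_add, E_pdt, E_V, finsum_field (finite_adj_E _ _ _),
        finsum_eq_zero_of_forall_eq_zero, add_zero, sub_eq_add_neg, ← h3, ← add_assoc]
      · rfl
      · intro la
        change adj _ (co (Sum.inr (la.1 + 1, la.2), 0)) _ = 0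
        rw [adj_co, if_neg (by simp)]
    have h4 := h.E_dtL hne (Sum.inl B)
    rw [E_smear, h2] at h4
    have h5 : ∑ a, adj (Sum.inl B) (Λ a) (T.φL a) ∈ T.constr :=
      Ideal.sum_mem _ fun a _ => adj_mem_right T.D_mem_constr _ _ (T.φL_mem a)
    have h6 := T.constr.neg_mem (T.constr.add_mem (T.vanish_le_constr h4) h5)
    rw [h1]
    convert h6 using 1
    ring
  · have : T.commT (T.chars G Λ) (Sum.inr (l, a)) = 0 := by
      change V (T.chars G Λ) (co (Sum.inr (l + 1, a), 0)) - T.dtL (T.dtL^[l] (Λ a)) = 0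
      rw [V_co, Ds_zero, chars_lam, Function.iterate_succ_apply', sub_self]
    rw [this]
    exact T.constr.zero_mem

theorem Ext.V_dtL_sub_mem (h : T.Ext G Λ) (hne : ∃ u, T.Adm u) (f : Loc n m c) :
    V (T.chars G Λ) (T.dtL f) - T.dtL (V (T.chars G Λ) f) ∈ T.constr := by
  rw [← V_commT]
  exact V_mem_of_char_mem T.D_mem_constr (h.commT_mem hne) f

theorem Ext.V_iterate_sub_mem (h : T.Ext G Λ) (hne : ∃ u, T.Adm u) (l : ℕ) (f : Loc n m c) :
    V (T.chars G Λ) (T.dtL^[l] f) - T.dtL^[l] (V (T.chars G Λ) f) ∈ T.constr := by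
  induction l with
  | zero => simp
  | succ l ih =>
    rw [Function.iterate_succ_apply', Function.iterate_succ_apply']
    have h1 := T.constr.add_mem (h.V_dtL_sub_mem hne (T.dtL^[l] f)) (T.dtL_mem_constr _ ih)
    convert h1 using 1
    rw [map_sub]
    ring

end Generators

/-! ### The bracket of generators -/

section Bracket

variable {n m c r : ℕ} (T : GaugeTheory n m c r)

/-- The modified bracket `{G₂, G₁}_g`. -/
def brG (G₁ : Loc n m c) (Λ₁ : Fin c → Loc n m c) (G₂ : Loc n m c) (Λ₂ : Fin c → Loc n m c) :
    Loc n m c :=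
  V (T.chars G₁ Λ₁) G₂ - V (T.chars G₂ Λ₂) G₁ - T.poissonL G₂ G₁

/-- The action of the bracket of couples on the multipliers. -/
def brΛ (G₁ : Loc n m c) (Λ₁ : Fin c → Loc n m c) (G₂ : Loc n m c) (Λ₂ : Fin c → Loc n m c)
    (a : Fin c) : Loc n m c :=
  V (T.chars G₁ Λ₁) (Λ₂ a) - V (T.chars G₂ Λ₂) (Λ₁ a)

/-- The Euler derivative of `δ̃₁ G₂`, without the contribution of the canonical fields to the
adjoint linearization. -/
def halfE (G₁ : Loc n m c) (Λ₁ : Fin c → Loc n m c) (G₂ : Loc n m c) (s : FieldIdx m c) :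
    Loc n m c :=
  V (T.chars G₁ Λ₁) (E s G₂) +
    ∑ᶠ la, adj s (T.chars G₁ Λ₁ (Sum.inr la)) (E (Sum.inr la) G₂)

/-- The contributions of the canonical fields to the adjoint linearizations in the Euler derivatives
of `δ̃₁ G₂` and `δ̃₂ G₁` cancel against those of the Poisson bracket. -/
theorem E_brG (G₁ : Loc n m c) (Λ₁ : Fin c → Loc n m c) (G₂ : Loc n m c)
    (Λ₂ : Fin c → Loc n m c) (s : FieldIdx m c) :
    E s (T.brG G₁ Λ₁ G₂ Λ₂) = T.halfE G₁ Λ₁ G₂ s - T.halfE G₂ Λ₂ G₁ s := by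
  have h1 : E s (T.poissonL G₂ G₁) = ∑ A, adj s (T.hamL G₁ A) (E (Sum.inl A) G₂) -
      ∑ A, adj s (T.hamL G₂ A) (E (Sum.inl A) G₁) := by
    have h2 : ∑ A, adj s (T.hamL G₂ A) (E (Sum.inl A) G₁) =
        -∑ A, adj s (E (Sum.inl A) G₂) (T.hamL G₁ A) :=
      T.sum_sig_left (adj s) (fun A => E (Sum.inl A) G₂) (fun A => E (Sum.inl A) G₁)
    rw [h2, sub_neg_eq_add, poissonL, map_sum, ← Finset.sum_add_distrib]
    exact Finset.sum_congr rfl fun A _ => by rw [E_mul, add_comm]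
  rw [brG, map_sub, map_sub, E_V, E_V, finsum_field (finite_adj_E _ _ _),
    finsum_field (finite_adj_E _ _ _), h1, halfE, halfE]
  change _ + (∑ A, adj s (T.hamL G₁ A) _ + _) - (_ + (∑ A, adj s (T.hamL G₂ A) _ + _)) - _ = _
  ring

variable {T} {G₁ G₂ : Loc n m c} {Λ₁ Λ₂ : Fin c → Loc n m c}

theorem Ext.halfE_sub_mem (h₂ : T.Ext G₂ Λ₂) (hne : ∃ u, T.Adm u)
    (s : FieldIdx m c) :
    T.halfE G₁ Λ₁ G₂ s - V (T.chars G₁ Λ₁) (E s G₂) ∈ T.constr := by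
  rw [halfE, add_sub_cancel_left]
  exact finsum_induction (fun f => f ∈ T.constr) T.constr.zero_mem
    (fun _ _ => T.constr.add_mem) fun la =>
      adj_mem_right T.D_mem_constr _ _ (h₂.E_lam_mem hne la)

variable (T) in
/-- The difference between the transformation generated by the bracket of two couples and the
commutator of the transformations generated by the couples. -/
def triv (G₁ : Loc n m c) (Λ₁ : Fin c → Loc n m c) (G₂ : Loc n m c) (Λ₂ : Fin c → Loc n m c) :
    FieldIdx m c → Loc n m c :=
  T.chars (T.brG G₁ Λ₁ G₂ Λ₂) (T.brΛ G₁ Λ₁ G₂ Λ₂) - comm (T.chars G₁ Λ₁) (T.chars G₂ Λ₂)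

/-- The bracket and the commutator agree on the constraint surface. -/
theorem Ext.triv_mem (h₁ : T.Ext G₁ Λ₁) (h₂ : T.Ext G₂ Λ₂) (hne : ∃ u, T.Adm u)
    (s : FieldIdx m c) : T.triv G₁ Λ₁ G₂ Λ₂ s ∈ T.constr := by
  rcases s with A | ⟨l, a⟩
  · have hA : T.triv G₁ Λ₁ G₂ Λ₂ (Sum.inl A) = T.sig (fun B =>
        (T.halfE G₁ Λ₁ G₂ (Sum.inl B) - V (T.chars G₁ Λ₁) (E (Sum.inl B) G₂)) -
        (T.halfE G₂ Λ₂ G₁ (Sum.inl B) - V (T.chars G₂ Λ₂) (E (Sum.inl B) G₁))) A := by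
      change T.sig (fun B => E (Sum.inl B) (T.brG G₁ Λ₁ G₂ Λ₂)) A -
        (V (T.chars G₁ Λ₁) (T.sig (fun B => E (Sum.inl B) G₂) A) -
          V (T.chars G₂ Λ₂) (T.sig (fun B => E (Sum.inl B) G₁) A)) = _
      rw [der_sig, der_sig, ← sig_sub, ← sig_sub]
      congr 1
      funext B
      rw [E_brG]
      ring
    rw [hA]
    exact T.sig_mem _ (fun B => T.constr.sub_mem (h₂.halfE_sub_mem hne _)
      (h₁.halfE_sub_mem hne _)) A
  · have h3 := T.constr.sub_mem (h₂.V_iterate_sub_mem hne l (Λ₁ a))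
      (h₁.V_iterate_sub_mem hne l (Λ₂ a))
    convert h3 using 1
    change T.dtL^[l] (V (T.chars G₁ Λ₁) (Λ₂ a) - V (T.chars G₂ Λ₂) (Λ₁ a)) -
      (V (T.chars G₁ Λ₁) (T.dtL^[l] (Λ₂ a)) - V (T.chars G₂ Λ₂) (T.dtL^[l] (Λ₁ a))) = _
    rw [iterate_map_sub]
    ring

variable (T) in
theorem V_chars_br (G₁ : Loc n m c) (Λ₁ : Fin c → Loc n m c) (G₂ : Loc n m c)
    (Λ₂ : Fin c → Loc n m c) (f : Loc n m c) :
    V (T.chars (T.brG G₁ Λ₁ G₂ Λ₂) (T.brΛ G₁ Λ₁ G₂ Λ₂)) f =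
      V (T.chars G₁ Λ₁) (V (T.chars G₂ Λ₂) f) - V (T.chars G₂ Λ₂) (V (T.chars G₁ Λ₁) f) +
        V (T.triv G₁ Λ₁ G₂ Λ₂) f := by
  rw [← V_comm, triv, map_sub, Derivation.sub_apply]
  ring

theorem Ext.V_triv_mem (h₁ : T.Ext G₁ Λ₁) (h₂ : T.Ext G₂ Λ₂) (hne : ∃ u, T.Adm u)
    (f : Loc n m c) : V (T.triv G₁ Λ₁ G₂ Λ₂) f ∈ T.constr :=
  V_mem_of_char_mem T.D_mem_constr (h₁.triv_mem h₂ hne) f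

theorem Ext.bracket_presE (h₁ : T.Ext G₁ Λ₁) (h₂ : T.Ext G₂ Λ₂) (hne : ∃ u, T.Adm u) :
    T.PresE (T.chars (T.brG G₁ Λ₁ G₂ Λ₂) (T.brΛ G₁ Λ₁ G₂ Λ₂)) := by
  have h := (h₁.presE.comm h₂.presE).add
    (T.presE_of_flat fun s => T.constr_le_flat (h₁.triv_mem h₂ hne s))
  rwa [triv, add_sub_cancel] at h

/-- The commutator of an external symmetry with a variation that is tangent to the internal
boundary conditions is again tangent to them. -/
theorem Ext.comm_presI {G : Loc n m c} {Λ : Fin c → Loc n m c} (h : T.Ext G Λ)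
    (hne : ∃ u, T.Adm u) {Q : FieldIdx m c → Loc n m c} (hQ : T.PresI Q) :
    T.PresI (comm (T.chars G Λ) Q) where
  toPresE := h.presE.comm hQ.toPresE
  chi k α := by
    induction k generalizing Q with
    | zero =>
      rw [Function.iterate_zero, id, V_comm]
      exact h.sources Q hQ α
    | succ k ih =>
      rw [Function.iterate_succ_apply']
      set g := T.dtL^[k] (T.χL α) with hg
      have hR : ∀ f, V (T.commT (T.chars G Λ)) f ∈ T.flat := fun f =>
        T.constr_le_flat (V_mem_of_char_mem T.D_mem_constr (h.commT_mem hne) f)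
      have h1 := T.bd.add_mem (T.dtL_mem_bd (ih hQ)) (ih hQ.commT)
      have h2 := T.bd.sub_mem (T.flat_le_bd (hR (V Q g))) (T.flat_le_bd (hQ.flat (hR g)))
      have h3 := T.bd.add_mem h1 h2
      convert h3 using 1
      simp only [V_comm, V_commT, map_sub]
      ring

/-- The variation of the boundary fields under the bracket depends on the boundary fields only: as
`[δ̃_i, Q]` is tangent to the internal boundary conditions, this is the Jacobi identity for
commutators. -/
theorem Ext.bracket_sources (h₁ : T.Ext G₁ Λ₁) (h₂ : T.Ext G₂ Λ₂) (hne : ∃ u, T.Adm u)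
    (Q : FieldIdx m c → Loc n m c) (hQ : T.PresI Q) (α : Fin r) :
    V (T.chars (T.brG G₁ Λ₁ G₂ Λ₂) (T.brΛ G₁ Λ₁ G₂ Λ₂)) (V Q (T.χL α)) -
      V Q (V (T.chars (T.brG G₁ Λ₁ G₂ Λ₂) (T.brΛ G₁ Λ₁ G₂ Λ₂)) (T.χL α)) ∈ T.bd := by
  have hW : ∀ f, V (T.triv G₁ Λ₁ G₂ Λ₂) f ∈ T.flat := fun f =>
    T.constr_le_flat (h₁.V_triv_mem h₂ hne f)
  have h3 := T.bd.sub_mem (h₁.sources _ (h₂.comm_presI hne hQ) α)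
    (h₂.sources _ (h₁.comm_presI hne hQ) α)
  have h4 := T.bd.sub_mem (T.flat_le_bd (hW (V Q (T.χL α))))
    (T.flat_le_bd (hQ.flat (hW (T.χL α))))
  have h5 := T.bd.add_mem h3 h4
  convert h5 using 1
  rw [V_chars_br, V_chars_br]
  simp only [V_comm, map_sub, map_add]
  ring

theorem finite_halfE (G₁ : Loc n m c) (Λ₁ : Fin c → Loc n m c) (G₂ : Loc n m c)
    (Q : FieldIdx m c → Loc n m c) :
    (Function.support fun s => Q s * T.halfE G₁ Λ₁ G₂ s).Finite := by
  have hi : (Function.support fun la : ℕ × Fin c => E (Sum.inr la) G₂).Finite :=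
    (finite_E G₂).preimage (f := Sum.inr) Sum.inr_injective.injOn
  have hP : ∀ P : Loc n m c, ∃ A : Finset (FieldIdx m c), ∀ v s, s ∉ A → adj s P v = 0 := by
    intro P
    obtain ⟨A, B, hA, -⟩ := exists_box P
    exact ⟨A, fun v s hs => adj_eq_zero s P v fun J => hA s J hs⟩
  choose A hA using hP
  refine ((finite_E G₂).union (hi.toFinset.finite_toSet.biUnion fun la _ =>
    (A (T.chars G₁ Λ₁ (Sum.inr la))).finite_toSet)).subset fun s hs => ?_
  by_contra hn
  simp only [Set.mem_union, Set.mem_iUnion, not_or, not_exists] at hn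
  have h1 : E s G₂ = 0 := by simpa using hn.1
  refine hs ?_
  dsimp only
  rw [halfE, h1, map_zero, zero_add, finsum_eq_zero_of_forall_eq_zero, mul_zero]
  intro la
  by_cases hla : E (Sum.inr la) G₂ = 0
  · rw [hla, map_zero]
  · exact hA _ _ s fun h => hn.2 la (by simpa using hla) h

/-- Variation of `δ̃₁ G₂`, up to functionals that vanish on admissible configurations. -/
theorem Ext.V_V_sub_mem (h₁ : T.Ext G₁ Λ₁) (h₂ : T.Ext G₂ Λ₂) (hne : ∃ u, T.Adm u)
    {Q : FieldIdx m c → Loc n m c} (hQ : T.PresI Q) :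
    V Q (V (T.chars G₁ Λ₁) G₂) - ∑ᶠ s, Q s * T.halfE G₁ Λ₁ G₂ s -
      ∑ A, V Q (T.hamL G₁ A) * E (Sum.inl A) G₂ ∈ T.null := by
  set X := T.chars G₁ Λ₁ with hX
  have h3 := T.null.sub_mem (h₁.presE.null _ (h₂.diff Q hQ)) (h₂.diff _ (h₁.comm_presI hne hQ))
  rw [← hX] at h3
  set A := (finite_E G₂).toFinset with hA
  have hA0 : ∀ s, s ∉ A → E s G₂ = 0 := fun s hs => by simpa [hA] using hs
  have hsum : ∀ F : FieldIdx m c → Loc n m c, (∀ s, E s G₂ = 0 → F s = 0) →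
      ∑ᶠ s, F s = ∑ s ∈ A, F s := fun F hF =>
    finsum_eq_sum_of_support_subset _ fun s hs => by
      by_contra h
      exact hs (hF s (hA0 s h))
  have h4 : V X (∑ᶠ s, Q s * E s G₂) - ∑ᶠ s, comm X Q s * E s G₂ =
      ∑ᶠ s, Q s * V X (E s G₂) + ∑ᶠ s, V Q (X s) * E s G₂ := by
    rw [hsum _ fun s hs => by rw [hs, mul_zero], hsum _ fun s hs => by rw [hs, mul_zero],
      hsum _ fun s hs => by rw [hs, map_zero, mul_zero], hsum _ fun s hs => by rw [hs, mul_zero],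
      map_sum, ← Finset.sum_sub_distrib, ← Finset.sum_add_distrib]
    refine Finset.sum_congr rfl fun s _ => ?_
    rw [Derivation.leibniz, smul_eq_mul, smul_eq_mul, comm]
    ring
  have hi : (Function.support fun la : ℕ × Fin c => E (Sum.inr la) G₂).Finite :=
    (finite_E G₂).preimage (f := Sum.inr) Sum.inr_injective.injOn
  set B := hi.toFinset with hB
  have hB0 : ∀ la, la ∉ B → E (Sum.inr la) G₂ = 0 := fun la h => by simpa [hB] using h
  have hsumB : ∀ F : ℕ × Fin c → Loc n m c, (∀ la, E (Sum.inr la) G₂ = 0 → F la = 0) →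
      ∑ᶠ la, F la = ∑ la ∈ B, F la := fun F hF =>
    finsum_eq_sum_of_support_subset _ fun s hs => by
      by_contra h
      exact hs (hF s (hB0 s h))
  have hfin : ∀ la, (Function.support fun s =>
      Q s * adj s (X (Sum.inr la)) (E (Sum.inr la) G₂)).Finite := by
    intro la
    obtain ⟨A', B', hA', -⟩ := exists_box (X (Sum.inr la))
    refine A'.finite_toSet.subset fun s hs => ?_
    by_contra h
    exact hs (by dsimp only; rw [adj_eq_zero _ _ _ fun J => hA' s J h, mul_zero])
  -- integration by parts in the terms with multipliers, which are proportional to constraints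
  have h5 : ∑ᶠ la, V Q (X (Sum.inr la)) * E (Sum.inr la) G₂ -
      ∑ᶠ s, Q s * ∑ᶠ la, adj s (X (Sum.inr la)) (E (Sum.inr la) G₂) ∈ T.null := by
    have h6 : ∀ s, Q s * ∑ᶠ la, adj s (X (Sum.inr la)) (E (Sum.inr la) G₂) =
        ∑ la ∈ B, Q s * adj s (X (Sum.inr la)) (E (Sum.inr la) G₂) := by
      intro s
      rw [hsumB _ fun la h => by rw [h, map_zero], Finset.mul_sum]
    rw [finsum_congr h6, finsum_sum_comm _ _ fun la _ => hfin la,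
      hsumB _ fun la h => by rw [h, mul_zero], ← Finset.sum_sub_distrib]
    refine Submodule.sum_mem _ fun la _ => T.DivSub_flat_le_null ?_
    exact V_mul_sub_mem T.D_mem_flat Q _ _
      (Or.inr (T.constr_le_flat (h₂.E_lam_mem hne la)))
  have h7 : ∑ᶠ s, Q s * T.halfE G₁ Λ₁ G₂ s = ∑ᶠ s, Q s * V X (E s G₂) +
      ∑ᶠ s, Q s * ∑ᶠ la, adj s (X (Sum.inr la)) (E (Sum.inr la) G₂) := by
    have hf1 : (Function.support fun s => Q s * V X (E s G₂)).Finite :=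
      (finite_E G₂).subset fun s hs h0 => hs (by
        have h0' : E s G₂ = 0 := h0
        simp [h0'])
    have hf2 := finite_halfE (T := T) G₁ Λ₁ G₂ Q
    rw [← finsum_add_distrib hf1]
    · exact finsum_congr fun s => by rw [halfE, mul_add]
    · refine (hf1.union hf2).subset fun s hs => ?_
      by_contra hn
      simp only [Set.mem_union, Function.mem_support, not_or, not_not] at hn
      refine hs ?_
      have := hn.2
      rwa [halfE, mul_add, ← hX, hn.1, zero_add] at this
  have h8 : ∑ᶠ s, V Q (X s) * E s G₂ = ∑ A, V Q (T.hamL G₁ A) * E (Sum.inl A) G₂ +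
      ∑ᶠ la, V Q (X (Sum.inr la)) * E (Sum.inr la) G₂ :=
    finsum_field (finite_mul_E _ _)
  have h9 := T.null.add_mem h3 h5
  convert h9 using 1
  have h10 : V X (V Q G₂ - ∑ᶠ s, Q s * E s G₂) - (V (comm X Q) G₂ - ∑ᶠ s, comm X Q s * E s G₂) =
      V Q (V X G₂) -
        (V X (∑ᶠ s, Q s * E s G₂) - ∑ᶠ s, comm X Q s * E s G₂) := by
    rw [V_comm, map_sub]
    ring
  rw [h10, h4, h7, h8]
  ring

/-- The bracket of generators has a well-defined variation. -/
theorem Ext.bracket_diff (h₁ : T.Ext G₁ Λ₁) (h₂ : T.Ext G₂ Λ₂) (hne : ∃ u, T.Adm u)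
    (Q : FieldIdx m c → Loc n m c) (hQ : T.PresI Q) :
    V Q (T.brG G₁ Λ₁ G₂ Λ₂) - ∑ᶠ s, Q s * E s (T.brG G₁ Λ₁ G₂ Λ₂) ∈ T.null := by
  have h3 := T.null.sub_mem (h₁.V_V_sub_mem h₂ hne hQ) (h₂.V_V_sub_mem h₁ hne hQ)
  convert h3 using 1
  have h4 : ∑ᶠ s, Q s * E s (T.brG G₁ Λ₁ G₂ Λ₂) =
      ∑ᶠ s, Q s * T.halfE G₁ Λ₁ G₂ s - ∑ᶠ s, Q s * T.halfE G₂ Λ₂ G₁ s := by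
    rw [← finsum_sub_distrib (finite_halfE _ _ _ _) (finite_halfE _ _ _ _)]
    exact finsum_congr fun s => by rw [E_brG, mul_sub]
  have h5 : V Q (T.poissonL G₂ G₁) = ∑ A, V Q (T.hamL G₁ A) * E (Sum.inl A) G₂ -
      ∑ A, V Q (T.hamL G₂ A) * E (Sum.inl A) G₁ := by
    have h6 := T.sum_sig_mul (fun A => V Q (E (Sum.inl A) G₂)) (fun A => E (Sum.inl A) G₁)
    have h7 : ∑ A, V Q (T.hamL G₂ A) * E (Sum.inl A) G₁ =
        -∑ A, V Q (E (Sum.inl A) G₂) * T.hamL G₁ A := by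
      rw [hamL_eq_sig, hamL_eq_sig, ← h6]
      exact Finset.sum_congr rfl fun A _ => by rw [der_sig]
    rw [h7, poissonL, map_sum, sub_neg_eq_add, ← Finset.sum_add_distrib]
    refine Finset.sum_congr rfl fun A _ => ?_
    rw [Derivation.leibniz, smul_eq_mul, smul_eq_mul]
    ring
  rw [h4, brG, map_sub, map_sub, h5]
  ring

/-- External symmetries preserve the functionals that depend on the boundary fields only. -/
theorem Ext.V_depends {G : Loc n m c} {Λ : Fin c → Loc n m c} (h : T.Ext G Λ)
    (hne : ∃ u, T.Adm u) {w : Loc n m c} (hw : ∀ Q, T.PresI Q → V Q w ∈ T.null)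
    (Q : FieldIdx m c → Loc n m c) (hQ : T.PresI Q) : V Q (V (T.chars G Λ) w) ∈ T.null := by
  have h1 := T.null.sub_mem (h.presE.null _ (hw Q hQ)) (hw _ (h.comm_presI hne hQ))
  rw [V_comm] at h1
  convert h1 using 1
  ring

theorem Ext.sum_commT_mul (F f : Loc n m c) (Λ : Fin c → Loc n m c) :
    ∑ᶠ s, T.commT (T.chars F Λ) s * E s f = ∑ A, E (Sum.inl A) f *
      (V (T.chars F Λ) (T.hamL T.HL A) - T.dtL (T.hamL F A)) := by
  rw [finsum_field (finite_mul_E _ _), finsum_eq_zero_of_forall_eq_zero, add_zero]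
  · exact Finset.sum_congr rfl fun A _ => mul_comm _ _
  · rintro ⟨l, a⟩
    have : T.commT (T.chars F Λ) (Sum.inr (l, a)) = 0 := by
      change V (T.chars F Λ) (co (Sum.inr (l + 1, a), 0)) - T.dtL (T.dtL^[l] (Λ a)) = 0
      rw [V_co, Ds_zero, chars_lam, Function.iterate_succ_apply', sub_self]
    rw [this, zero_mul]

variable (T) in
theorem der_poissonL (δ : Derivation ℝ (Loc n m c) (Loc n m c)) (F G : Loc n m c) :
    δ (T.poissonL F G) = ∑ A, E (Sum.inl A) F * δ (T.hamL G A) -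
      ∑ A, δ (T.hamL F A) * E (Sum.inl A) G := by
  have h6 := T.sum_sig_mul (fun A => δ (E (Sum.inl A) F)) (fun A => E (Sum.inl A) G)
  have h7 : ∑ A, δ (T.hamL F A) * E (Sum.inl A) G =
      -∑ A, δ (E (Sum.inl A) F) * T.hamL G A := by
    rw [hamL_eq_sig, hamL_eq_sig, ← h6]
    exact Finset.sum_congr rfl fun A _ => by rw [der_sig]
  rw [h7, poissonL, map_sum, sub_neg_eq_add, ← Finset.sum_add_distrib]
  refine Finset.sum_congr rfl fun A _ => ?_
  rw [Derivation.leibniz, smul_eq_mul, smul_eq_mul]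
  ring

/-- Invariance of the action under the bracket, with boundary term `δ̃₁ V₂ - δ̃₂ V₁`. The bulk terms
cancel by the Leibniz rule, up to flat variations of `G₁`, `G₂` and `H`. -/
theorem Ext.bracket_inv (h₁ : T.Ext G₁ Λ₁) (h₂ : T.Ext G₂ Λ₂) (hne : ∃ u, T.Adm u) :
    ∃ v : Fin n → Loc n m c, (∀ Q, T.PresI Q → V Q (∑ i, D i (v i)) ∈ T.null) ∧
      T.dtL (T.brG G₁ Λ₁ G₂ Λ₂) - T.poissonL (T.brG G₁ Λ₁ G₂ Λ₂) T.HL -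
        V (T.chars (T.brG G₁ Λ₁ G₂ Λ₂) (T.brΛ G₁ Λ₁ G₂ Λ₂)) T.HL - ∑ i, D i (v i) ∈ T.null := by
  obtain ⟨v₁, hv₁, hb₁⟩ := h₁.inv
  obtain ⟨v₂, hv₂, hb₂⟩ := h₂.inv
  have hdiv : ∑ i, D i (V (T.chars G₁ Λ₁) (v₂ i) - V (T.chars G₂ Λ₂) (v₁ i)) =
      V (T.chars G₁ Λ₁) (∑ i, D i (v₂ i)) - V (T.chars G₂ Λ₂) (∑ i, D i (v₁ i)) := by
    rw [map_sum, map_sum, ← Finset.sum_sub_distrib]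
    exact Finset.sum_congr rfl fun i _ => by rw [V_D, V_D, map_sub]
  refine ⟨fun i => V (T.chars G₁ Λ₁) (v₂ i) - V (T.chars G₂ Λ₂) (v₁ i), fun Q hQ => ?_, ?_⟩
  · rw [hdiv, map_sub]
    exact T.null.sub_mem (h₁.V_depends hne hv₂ Q hQ) (h₂.V_depends hne hv₁ Q hQ)
  rw [hdiv]
  set w₁ := ∑ i, D i (v₁ i)
  set w₂ := ∑ i, D i (v₂ i)
  -- flat variations do not contribute boundary terms
  have hR₁ := T.DivSub_flat_le_null (V_sub_mem T.D_mem_flat (T.commT (T.chars G₁ Λ₁)) G₂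
    fun s => T.constr_le_flat (h₁.commT_mem hne s))
  have hR₂ := T.DivSub_flat_le_null (V_sub_mem T.D_mem_flat (T.commT (T.chars G₂ Λ₂)) G₁
    fun s => T.constr_le_flat (h₂.commT_mem hne s))
  have hW := T.DivSub_flat_le_null (V_sub_mem T.D_mem_flat (T.triv G₁ Λ₁ G₂ Λ₂) T.HL
    fun s => T.constr_le_flat (h₁.triv_mem h₂ hne s))
  rw [V_commT, Ext.sum_commT_mul] at hR₁ hR₂
  have hWsum : ∑ᶠ s, T.triv G₁ Λ₁ G₂ Λ₂ s * E s T.HL =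
      ∑ A, T.hamL (T.brG G₁ Λ₁ G₂ Λ₂) A * E (Sum.inl A) T.HL -
        ∑ A, V (T.chars G₁ Λ₁) (T.hamL G₂ A) * E (Sum.inl A) T.HL +
        ∑ A, V (T.chars G₂ Λ₂) (T.hamL G₁ A) * E (Sum.inl A) T.HL := by
    rw [T.finsum_HL (finite_mul_E _ _) (fun s hs => by rw [hs, mul_zero]),
      Finset.sum_eq_zero (f := fun a => T.triv G₁ Λ₁ G₂ Λ₂ (Sum.inr (0, a)) * _), add_zero,
      ← Finset.sum_sub_distrib, ← Finset.sum_add_distrib]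
    · refine Finset.sum_congr rfl fun A _ => ?_
      change (T.hamL (T.brG G₁ Λ₁ G₂ Λ₂) A - (V (T.chars G₁ Λ₁) (T.hamL G₂ A) - V (T.chars G₂ Λ₂) (T.hamL G₁ A))) * _ = _
      ring
    · intro a _
      have : T.triv G₁ Λ₁ G₂ Λ₂ (Sum.inr (0, a)) = 0 := by
        change (V (T.chars G₁ Λ₁) (Λ₂ a) - V (T.chars G₂ Λ₂) (Λ₁ a)) - (V (T.chars G₁ Λ₁) (Λ₂ a) - V (T.chars G₂ Λ₂) (Λ₁ a)) = 0
        ring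
      rw [this, zero_mul]
  rw [hWsum] at hW
  have h3 := T.null.sub_mem (h₁.presE.null _ hb₂) (h₂.presE.null _ hb₁)
  have h4 := T.null.sub_mem (T.null.add_mem (T.null.sub_mem h3 hR₁) hR₂) hW
  convert h4 using 1
  have e1 : T.poissonL (T.brG G₁ Λ₁ G₂ Λ₂) T.HL =
      -∑ A, T.hamL (T.brG G₁ Λ₁ G₂ Λ₂) A * E (Sum.inl A) T.HL := by
    rw [poissonL_swap, poissonL]
    congr 1
    exact Finset.sum_congr rfl fun A _ => mul_comm _ _
  have e2 := T.der_poissonL (V (T.chars G₁ Λ₁)) G₂ T.HL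
  have e3 := T.der_poissonL (V (T.chars G₂ Λ₂)) G₁ T.HL
  have e4 := T.der_poissonL T.dtL G₂ G₁
  have e5 : T.dtL (T.brG G₁ Λ₁ G₂ Λ₂) =
      T.dtL (V (T.chars G₁ Λ₁) G₂) - T.dtL (V (T.chars G₂ Λ₂) G₁) - T.dtL (T.poissonL G₂ G₁) := by
    rw [brG, map_sub, map_sub]
  have e6 : ∑ A, T.dtL (T.hamL G₂ A) * E (Sum.inl A) G₁ =
      ∑ A, E (Sum.inl A) G₁ * T.dtL (T.hamL G₂ A) :=
    Finset.sum_congr rfl fun A _ => mul_comm _ _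
  rw [V_chars_br, e5, e4, e1, e6]
  simp only [map_sub, mul_sub, Finset.sum_sub_distrib, e2, e3]
  ring

/-- The bracket of generators of external symmetries generates an external symmetry. -/
theorem Ext.bracket (h₁ : T.Ext G₁ Λ₁) (h₂ : T.Ext G₂ Λ₂) (hne : ∃ u, T.Adm u) :
    T.Ext (T.brG G₁ Λ₁ G₂ Λ₂) (T.brΛ G₁ Λ₁ G₂ Λ₂) where
  presE := h₁.bracket_presE h₂ hne
  sources := h₁.bracket_sources h₂ hne
  diff := h₁.bracket_diff h₂ hne
  inv := h₁.bracket_inv h₂ hne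

end Bracket

end GaugeTheory

/-! ### Local functions without Euler derivatives are divergences -/

section Poincare

variable {n m c : ℕ}

theorem Ds_co_zero (s : FieldIdx m c) (I : MultiIdx n) :
    Ds I (co (s, 0)) = (co (s, I) : Loc n m c) := by
  induction I using multiIdx_induction with
  | h0 => exact Ds_zero _
  | h I i ih =>
    rw [Ds_add_single, ih]
    exact der_co _ _

theorem contDiff_comp_jet (f : Loc n m c) {Y : Type} [NormedAddCommGroup Y] [NormedSpace ℝ Y]
    {τ : Y → ℝ} {ξ : Y → Space n} {υ : Y → JetIdx n m c → ℝ} (hτ : ContDiff ℝ ∞ τ)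
    (hξ : ContDiff ℝ ∞ ξ) (hυ : ∀ j, ContDiff ℝ ∞ fun y => υ y j) :
    ContDiff ℝ ∞ fun y => f.1 (τ y, ξ y, υ y) := by
  obtain ⟨S, g, hg, h⟩ := exists_isLocalOn f
  simp_rw [h]
  exact hg.comp (hτ.prodMk (hξ.prodMk (contDiff_pi.2 fun j => hυ j)))

theorem contDiff_scale (f : Loc n m c) (p : ℝ × Space n × (JetIdx n m c → ℝ)) :
    ContDiff ℝ ∞ fun ε : ℝ => f.1 (p.1, p.2.1, ε • p.2.2) :=
  contDiff_comp_jet f contDiff_const contDiff_const fun j => by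
    simp only [Pi.smul_apply, smul_eq_mul]
    fun_prop

theorem bounded_unitInterval : Bornology.IsBounded (Set.Ioc (0 : ℝ) 1) := Metric.isBounded_Ioc 0 1

theorem isLocal_average (f : Loc n m c) :
    IsLocal fun p : ℝ × Space n × (JetIdx n m c → ℝ) =>
      ∫ ε in Set.Ioc (0 : ℝ) 1, f.1 (p.1, p.2.1, ε • p.2.2) := by
  obtain ⟨S, g, hg, h⟩ := exists_isLocalOn f
  refine isLocal_iff.2 ⟨S, fun q => ∫ ε in Set.Ioc (0 : ℝ) 1, g (q.1, q.2.1, ε • q.2.2),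
    ?_, fun p => ?_⟩
  · exact contDiff_setIntegral (Φ := fun r : (ℝ × Space n × (S → ℝ)) × ℝ =>
      g (r.1.1, r.1.2.1, r.2 • r.1.2.2)) measurableSet_Ioc bounded_unitInterval
      (hg.comp (by fun_prop))
  · simp_rw [h]
    rfl

/-- The average of a local function over the segment from the zero configuration. -/
def hop : Loc n m c →ₗ[ℝ] Loc n m c where
  toFun f := ⟨fun p => ∫ ε in Set.Ioc (0 : ℝ) 1, f.1 (p.1, p.2.1, ε • p.2.2), isLocal_average f⟩
  map_add' f f' := Subtype.ext (funext fun p => integral_add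
    (integrableOn_of_continuous bounded_unitInterval (contDiff_scale f p).continuous)
    (integrableOn_of_continuous bounded_unitInterval (contDiff_scale f' p).continuous))
  map_smul' a f := Subtype.ext (funext fun p =>
    integral_const_mul (μ := volume.restrict (Set.Ioc (0 : ℝ) 1)) a
      fun ε => f.1 (p.1, p.2.1, ε • p.2.2))

theorem D_hop (i : Fin n) (f : Loc n m c) : D i (hop f) = hop (D i f) := by
  refine Subtype.ext (funext fun p => ?_)
  obtain ⟨t, x, u⟩ := p
  set υ : ℝ → JetIdx n m c → ℝ := fun s j => u j + s * u (j.1, j.2 + Pi.single i 1) with hυ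
  set ξ : ℝ → Space n := fun s => x + s • EuclideanSpace.single i 1 with hξ
  have hξd : HasDerivAt ξ (EuclideanSpace.single i 1) 0 := by
    simpa [hξ] using (hasDerivAt_id (0 : ℝ)).smul_const (EuclideanSpace.single i (1 : ℝ))
  have hυ0 : υ 0 = u := by funext j; simp [hυ]
  have hξ0 : ξ 0 = x := by simp [hξ]
  have hυd : ∀ j, HasDerivAt (fun s => υ s j) (u (j.1, j.2 + Pi.single i 1)) 0 := fun j => by
    simpa [hυ] using (hasDerivAt_id (0 : ℝ)).mul_const (u (j.1, j.2 + Pi.single i 1))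
  have hco : ∀ (k : Fin n) q, (EuclideanSpace.single i (1 : ℝ) : Space n) k =
      (dCoef i (Sum.inr (Sum.inl k)) : Loc n m c).1 q := by
    intro k q
    by_cases h : k = i
    · subst h
      simp only [dCoef, if_true, PiLp.single_apply]
      rfl
    · simp only [dCoef, if_neg h, PiLp.single_apply]
      rfl
  have h1 : HasDerivAt (fun s => (hop f).1 (t, ξ s, υ s)) ((D i (hop f)).1 (t, x, u)) 0 := by
    have := hasDerivAt_path (hop f) (dCoef i) (τ := fun _ => t) (hasDerivAt_const 0 t) hξd
      (fun k => hco k _) (fun j => (hυd j).congr_deriv (by rw [hυ0, hξ0]; rfl))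
    rw [hυ0, hξ0] at this
    exact this
  have h2 : HasDerivAt (fun s => (hop f).1 (t, ξ s, υ s)) ((hop (D i f)).1 (t, x, u)) 0 := by
    refine hasDerivAt_setIntegral (Φ := fun q : ℝ × ℝ => f.1 (t, ξ q.1, q.2 • υ q.1))
      measurableSet_Ioc bounded_unitInterval
      ((contDiff_comp_jet f contDiff_const ?_ ?_).of_le (by simp)) fun ε _ => ?_
    · rw [hξ]
      fun_prop
    · intro j
      simp only [hυ, Pi.smul_apply, smul_eq_mul]
      fun_prop
    · have := hasDerivAt_path f (dCoef i) (τ := fun _ => t) (υ := fun s => ε • υ s)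
        (hasDerivAt_const 0 t) hξd (fun k => hco k _)
        (fun j => ((hυd j).const_mul ε).congr_deriv (by rw [hυ0, hξ0]; rfl))
      simp only [hυ0, hξ0] at this
      exact this
  exact h1.unique h2

theorem Ds_hop (I : MultiIdx n) (f : Loc n m c) : Ds I (hop f) = hop (Ds I f) :=
  (map_Ds (δ := fun f => hop f) (fun i f => (D_hop i f).symm) I f).symm

theorem hop_mem_vanish {Ω : Set (Space n)} {f : Loc n m c} (hf : f ∈ vanish Ω) :
    hop f ∈ vanish Ω := fun t x hx _ =>
  setIntegral_eq_zero_of_forall_eq_zero fun _ _ => hf t x hx _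

/-- The value of a local function at the zero configuration. -/
def atZero (f : Loc n m c) : Loc n m c :=
  ⟨fun p => f.1 (p.1, p.2.1, 0), isLocal_iff.2 ⟨∅, fun q => f.1 (q.1, q.2.1, 0),
    contDiff_comp_jet f (by fun_prop) (by fun_prop) fun j => contDiff_const, fun _ => rfl⟩⟩

theorem sub_atZero_eq (f : Loc n m c) {A : Finset (FieldIdx m c)} {B : Finset (MultiIdx n)}
    (hA : ∀ s I, s ∉ A → pdu (s, I) f = 0) (hB : ∀ s I, I ∉ B → pdu (s, I) f = 0) :
    f - atZero f = ∑ s ∈ A, ∑ I ∈ B, co (s, I) * hop (pdu (s, I) f) := by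
  refine Subtype.ext (funext fun p => ?_)
  obtain ⟨t, x, u⟩ := p
  set F' : ℝ → ℝ := fun ε => ∑ s ∈ A, ∑ I ∈ B, u (s, I) * (pdu (s, I) f).1 (t, x, ε • u) with hF'
  have hd : ∀ ε : ℝ, HasDerivAt (fun ε : ℝ => f.1 (t, x, ε • u)) (F' ε) ε := by
    intro ε
    have h1 := hasDerivAt_path f (X := Sum.elim 0 (Sum.elim 0 fun j => algebraMap ℝ _ (u j)))
      (τ := fun _ => t) (ξ := fun _ => x) (υ := fun ε => ε • u) (s := ε) (ξ' := 0)
      (hasDerivAt_const ε t) (hasDerivAt_const ε x) (fun _ => rfl)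
      (fun j => (hasDerivAt_id ε).mul_const (u j) |>.congr_deriv (by rw [one_mul]; rfl))
    refine h1.congr_deriv ?_
    rw [der_val, finsum_eq_sum_of_support_subset (s := A ×ˢ B), Finset.sum_product]
    · change (0 : ℝ) * _ + ∑ i, (0 : ℝ) * _ + _ = _
      rw [zero_mul, zero_add, Finset.sum_eq_zero fun _ _ => zero_mul _, zero_add]
      rfl
    · rintro ⟨s, I⟩ h
      by_contra hn
      have h0 : pdu (s, I) f = 0 := by
        rw [Finset.coe_product, Set.mem_prod, not_and_or] at hn
        exact hn.elim (hA s I) (hB s I)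
      refine h ?_
      dsimp only
      rw [← pd_coe_u, h0]
      exact mul_zero _
  have hc : Continuous F' := continuous_finsetSum _ fun s _ => continuous_finsetSum _ fun I _ =>
    continuous_const.mul (contDiff_scale (pdu (s, I) f) (t, x, u)).continuous
  have h2 := intervalIntegral.integral_eq_sub_of_hasDerivAt (fun ε _ => hd ε)
    (hc.intervalIntegrable 0 1)
  rw [intervalIntegral.integral_of_le zero_le_one, one_smul, zero_smul] at h2
  change f.1 (t, x, u) - f.1 (t, x, 0) = _
  rw [← h2, GaugeTheory.coe_sum, hF', integral_finsetSum]
  · refine Finset.sum_congr rfl fun s _ => ?_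
    rw [GaugeTheory.coe_sum, integral_finsetSum]
    · exact Finset.sum_congr rfl fun I _ => integral_const_mul _ _
    · exact fun I _ => integrableOn_of_continuous bounded_unitInterval
        (continuous_const.mul (contDiff_scale (pdu (s, I) f) (t, x, u)).continuous)
  · exact fun s _ => integrableOn_of_continuous bounded_unitInterval
      (continuous_finsetSum _ fun I _ =>
        continuous_const.mul (contDiff_scale (pdu (s, I) f) (t, x, u)).continuous)

/-- Integration of a function of time and position along a coordinate axis. -/
theorem exists_D_eq_atZero (i : Fin n) (f : Loc n m c) : ∃ k : Loc n m c, D i k = atZero f := by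
  set G : ℝ × Space n → ℝ := fun q => f.1 (q.1, q.2, 0) with hG
  have hGs : ContDiff ℝ ∞ G := contDiff_comp_jet f (by fun_prop) (by fun_prop)
    fun j => contDiff_const
  have hco : ∀ x : Space n, x i = (EuclideanSpace.proj i : Space n →L[ℝ] ℝ) x := fun _ => rfl
  set K : ℝ × Space n → ℝ := fun q => q.2 i *
    ∫ ε in Set.Ioc (0 : ℝ) 1, G (q.1, q.2 + ((ε - 1) * q.2 i) • EuclideanSpace.single i 1) with hK
  have hKs : ContDiff ℝ ∞ K := by
    refine ContDiff.mul (by simp_rw [hco]; fun_prop) ?_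
    refine contDiff_setIntegral (Φ := fun r : (ℝ × Space n) × ℝ =>
        G (r.1.1, r.1.2 + ((r.2 - 1) * r.1.2 i) • EuclideanSpace.single i 1))
      measurableSet_Ioc bounded_unitInterval (hGs.comp ?_)
    simp_rw [hco]
    fun_prop
  refine ⟨⟨fun p => K (p.1, p.2.1), isLocal_iff.2 ⟨∅, fun q => K (q.1, q.2.1),
    hKs.comp (by fun_prop), fun _ => rfl⟩⟩, Subtype.ext (funext fun p => ?_)⟩
  obtain ⟨t, x, u⟩ := p
  rw [D_coe]
  have h0 : ∑ᶠ j : JetIdx n m c, u (j.1, j.2 + Pi.single i 1) *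
      pdU j (fun p : ℝ × Space n × (JetIdx n m c → ℝ) => K (p.1, p.2.1)) (t, x, u) = 0 :=
    finsum_eq_zero_of_forall_eq_zero fun j => by
      change _ * deriv (fun _ => K (t, x)) _ = 0
      rw [deriv_const, mul_zero]
  change pdX i (fun p : ℝ × Space n × (JetIdx n m c → ℝ) => K (p.1, p.2.1)) (t, x, u) + _ = _
  rw [h0, add_zero]
  change partialX i (fun y => K (t, y)) x = G (t, x)
  set g : ℝ → ℝ := fun s => G (t, x + (s - x i) • EuclideanSpace.single i 1) with hg
  have hgc : Continuous g := hGs.continuous.comp (by fun_prop)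
  have h1 := hasDerivAt_partialX (f := fun y => K (t, y)) (x := x) i
    (((hKs.comp (contDiff_prodMk_right t)).differentiable (by simp)) x)
  -- on the line through `x` the integral over the unit interval is a primitive
  have h2 : (fun s : ℝ => K (t, x + s • EuclideanSpace.single i 1)) =
      fun s => ∫ y in (0 : ℝ)..(x i + s), g y := by
    funext s
    have h3 := intervalIntegral.mul_integral_comp_mul_left (f := g) (a := 0) (b := 1) (x i + s)
    rw [mul_zero, mul_one] at h3
    rw [← h3, intervalIntegral.integral_of_le zero_le_one, hK]
    have h4 : (x + s • EuclideanSpace.single i (1 : ℝ)) i = x i + s := by simp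
    dsimp only
    rw [h4]
    congr 1
    refine integral_congr_ae (Filter.Eventually.of_forall fun ε => ?_)
    dsimp only [hg]
    rw [hg]
    congr 2
    rw [add_assoc, ← add_smul]
    congr 2
    ring
  rw [h2] at h1
  have h5 : HasDerivAt (fun y => ∫ s in (0 : ℝ)..y, g s) (g (x i)) (x i + 0) := by
    rw [add_zero]
    exact intervalIntegral.integral_hasDerivAt_right (hgc.intervalIntegrable _ _)
      (hgc.stronglyMeasurableAtFilter _ _) hgc.continuousAt
  have h6 := HasDerivAt.comp_const_add (x i) 0 h5
  rw [h1.unique h6, hg]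
  simp

/-- A divergence of local functions. -/
theorem exists_eq_sum_D {f : Loc n m c} (hf : f ∈ DivSub (⊤ : Ideal (Loc n m c))) :
    ∃ k : Fin n → Loc n m c, f = ∑ i, D i (k i) := by
  induction hf using Submodule.span_induction with
  | mem f h =>
    obtain ⟨i, k, -, rfl⟩ := h
    refine ⟨Pi.single i k, ?_⟩
    rw [Finset.sum_eq_single i, Pi.single_eq_same]
    · intro j _ hj
      rw [Pi.single_eq_of_ne hj, map_zero]
    · simp
  | zero => exact ⟨0, by simp⟩
  | add f g _ _ hf hg =>
    obtain ⟨k, rfl⟩ := hf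
    obtain ⟨l, rfl⟩ := hg
    exact ⟨k + l, by simp [Finset.sum_add_distrib]⟩
  | smul a f _ hf =>
    obtain ⟨k, rfl⟩ := hf
    exact ⟨a • k, by simp [Finset.smul_sum]⟩

/-- The homotopy formula: a local function whose Euler derivatives vanish over a region is, over
that region, a total divergence. -/
theorem exists_divergence (hn : 0 < n) {Ω : Set (Space n)} {f : Loc n m c}
    (hf : ∀ s, E s f ∈ vanish Ω) :
    ∃ k : Fin n → Loc n m c, f - ∑ i, D i (k i) ∈ vanish Ω := by
  obtain ⟨A, B, hA, hB⟩ := exists_box f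
  obtain ⟨k₀, hk₀⟩ := exists_D_eq_atZero ⟨0, hn⟩ f
  have htop : ∀ i : Fin n, ∀ g ∈ (⊤ : Ideal (Loc n m c)), D i g ∈ (⊤ : Ideal (Loc n m c)) :=
    fun _ _ _ => trivial
  have h1 : ∀ s, ∑ I ∈ B, co (s, I) * hop (pdu (s, I) f) - co (s, 0) * hop (E s f) ∈
      DivSub (⊤ : Ideal (Loc n m c)) := by
    intro s
    rw [E_eq_sum s f (hB s), map_sum, Finset.mul_sum, ← Finset.sum_sub_distrib]
    refine Submodule.sum_mem _ fun I _ => ?_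
    have h2 := Ds_mul_sub_mem htop I (co (s, 0)) (hop (pdu (s, I) f)) (Or.inl trivial)
    have h3 : Ds I (co (s, 0)) = (co (s, I) : Loc n m c) := by
      rw [Ds_co_zero]
    rwa [h3, Ds_hop, ← map_smul] at h2
  have h4 : f - ∑ s ∈ A, co (s, 0) * hop (E s f) ∈ DivSub (⊤ : Ideal (Loc n m c)) := by
    have h5 := Submodule.add_mem _ (Submodule.sum_mem _ fun s (_ : s ∈ A) => h1 s)
      (D_mem_DivSub ⟨0, hn⟩ (k := k₀) (𝔣 := ⊤) trivial)
    rw [hk₀, Finset.sum_sub_distrib, ← sub_atZero_eq f hA hB] at h5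
    convert h5 using 1
    ring
  obtain ⟨k, hk⟩ := exists_eq_sum_D h4
  refine ⟨k, ?_⟩
  rw [← hk, sub_sub_cancel]
  exact Ideal.sum_mem _ fun s _ => Ideal.mul_mem_left _ _ (hop_mem_vanish (hf s))

end Poincare

namespace GaugeTheory

/-! ### The invariance of the action -/

section Action

variable {n m c r : ℕ} (T : GaugeTheory n m c r)

theorem int_sub {t : ℝ} {u : Config n m c} (hu : Sm u) (f g : Loc n m c) :
    T.functional (f - g).1 t u = T.functional f.1 t u - T.functional g.1 t u :=
  map_sub (T.int t hu) f g

theorem sub_mem_null_iff {f g : Loc n m c} : f - g ∈ T.null ↔ T.FunctionalEq f.1 g.1 := by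
  refine forall₃_congr fun t u hu => ?_
  rw [T.int_sub hu.1, sub_eq_zero]

theorem finsum_val {ι : Type} {F : ι → Loc n m c} (hF : (Function.support F).Finite) (p) :
    (∑ᶠ k, F k).1 p = ∑ᶠ k, (F k).1 p := by
  rw [finsum_eq_sum_of_support_subset (s := hF.toFinset) _ (by simp), coe_sum,
    finsum_eq_sum_of_support_subset (s := hF.toFinset)]
  intro k hk
  rw [Set.Finite.coe_toFinset]
  intro h0
  refine hk ?_
  change (F k).1 p = 0
  rw [h0]
  rfl

theorem divergence_coe (k : Fin n → Loc n m c) :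
    divergence (fun i => (k i).1) = (∑ i, D i (k i)).1 := by
  funext p
  rw [coe_sum, divergence]
  simp_rw [D_coe]

theorem exists_bundle {ι : Type} {Q : ι → JetFn n m c} (hQ : ∀ s, IsLocal (Q s)) :
    ∃ R : ι → Loc n m c, Q = fun s => (R s).1 := ⟨fun s => ⟨Q s, hQ s⟩, rfl⟩

theorem dependsOnlyOnZeta_iff (K : Loc n m c) :
    T.DependsOnlyOnZeta K.1 ↔ ∀ Q, T.PresI Q → V Q K ∈ T.null := by
  constructor
  · intro h Q hQ t u hu
    rw [V_coe]
    exact h _ ((T.presI_iff Q).1 hQ) t u hu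
  · intro h Q hQ
    obtain ⟨R, rfl⟩ := exists_bundle hQ.1.1
    intro t u hu
    have := h R ((T.presI_iff R).2 hQ) t u hu
    rwa [V_coe] at this

/-- The couple of a generator and an action on the multipliers. -/
def coupleL (G : Loc n m c) (Λ : Fin c → Loc n m c) : Couple n m c := (G.1, fun a => (Λ a).1)

/-- The transformation with given local components. -/
def transfL (Z : Fin m → Loc n m c) (Λ : Fin c → Loc n m c) : Transf n m c :=
  (fun A => (Z A).1, fun a => (Λ a).1)

theorem trans_coupleL (G : Loc n m c) (Λ : Fin c → Loc n m c) :
    T.trans (coupleL G Λ) = transfL (T.hamL G) Λ := by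
  refine Prod.ext (funext fun A => ?_) rfl
  exact (T.hamL_coe G A).symm

theorem tilde_transfL (Z : Fin m → Loc n m c) (Λ : Fin c → Loc n m c) :
    T.tilde (transfL Z Λ) = fun s => (T.tildeL Z Λ s).1 :=
  funext fun s => (T.tildeL_coe Z Λ s).symm

theorem tilde_trans_coupleL (G : Loc n m c) (Λ : Fin c → Loc n m c) :
    T.tilde (T.trans (coupleL G Λ)) = fun s => (T.chars G Λ s).1 := by
  rw [trans_coupleL, tilde_transfL]
  rfl

/-- The field part of the time evolution with the velocity `v` of the canonical fields. -/
def velVar (v : Fin m → Space n → ℝ) (hv : ∀ A, ContDiff ℝ ∞ (v A)) : FieldIdx m c → Loc n m c :=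
  Sum.elim (fun A => ofX (v A) (hv A)) (fun la => co (Sum.inr (la.1 + 1, la.2), 0))

/-- The velocity of `advance`. -/
def velocity (u : Config n m c) (v : Fin m → Space n → ℝ) : Config n m c :=
  Sum.elim v (fun la => u (Sum.inr (la.1 + 1, la.2)))

theorem advance_eq (u : Config n m c) (v : Fin m → Space n → ℝ) (s : ℝ) :
    advance u v s = fun l y => u l y + s * velocity u v l y := by
  funext l
  rcases l with A | la <;> rfl

theorem velocity_smooth {u : Config n m c} {v : Fin m → Space n → ℝ} (hu : Sm u)
    (hv : ∀ A, ContDiff ℝ ∞ (v A)) : Sm (velocity u v) := by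
  rintro (A | la)
  · exact hv A
  · exact hu _

theorem jet_velocity {u : Config n m c} {v : Fin m → Space n → ℝ} (hu : Sm u)
    (hv : ∀ A, ContDiff ℝ ∞ (v A)) (t : ℝ) (s : FieldIdx m c) (I : MultiIdx n) (x : Space n) :
    jet (velocity u v) x (s, I) = ev (Ds I (velVar v hv s)).1 t u x := by
  rw [ev_Ds I _ hu]
  have h : velocity u v s = ev (velVar v hv s).1 t u := by
    rcases s with A | la
    · rfl
    · funext y
      change _ = iterOp partialX 0 (u (Sum.inr (la.1 + 1, la.2))) y
      rw [iterOp_zero]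
      rfl
  rw [← h]
  rfl

theorem deriv_ev_advance (f : Loc n m c) {u : Config n m c} {v : Fin m → Space n → ℝ} (hu : Sm u)
    (hv : ∀ A, ContDiff ℝ ∞ (v A)) (t : ℝ) (x : Space n) :
    deriv (fun s => ev f.1 (t + s) (advance u v s) x) 0 =
      ev (pdt f + V (velVar v hv) f).1 t u x := by
  have h := hasDerivAt_line f hu (velocity_smooth hu hv) t 1 (velVar v hv) (x := x)
    fun s I => jet_velocity hu hv t s I x
  simp only [one_mul, one_smul, ← advance_eq] at h
  exact h.deriv

theorem deriv_functional_advance (f : Loc n m c) {u : Config n m c} {v : Fin m → Space n → ℝ}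
    (hu : Sm u) (hv : ∀ A, ContDiff ℝ ∞ (v A)) (t : ℝ) :
    deriv (fun s => T.functional f.1 (t + s) (advance u v s)) 0 =
      T.functional (pdt f + V (velVar v hv) f).1 t u := by
  have h := T.hasDerivAt_functional f hu (velocity_smooth hu hv) t 1 (velVar v hv)
    fun s I x _ => jet_velocity hu hv t s I x
  simp only [one_mul, one_smul, ← advance_eq] at h
  exact h.deriv

theorem σ_inv_swap (A B : Fin m) : T.σ⁻¹ A B = -T.σ⁻¹ B A := by
  have h : (T.σ⁻¹).transpose = -T.σ⁻¹ := by
    rw [Matrix.transpose_nonsing_inv, T.σ_antisymm]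
    refine Matrix.inv_eq_left_inv ?_
    rw [neg_mul_neg, Matrix.nonsing_inv_mul _ T.σ_unit]
  have := congrFun (congrFun h B) A
  simpa using this

/-- Contraction with the symplectic form. -/
theorem sum_inv_sig (y : Fin m → Loc n m c) (B : Fin m) :
    ∑ A, T.σ⁻¹ B A • T.sig y A = y B := by
  simp only [sig, Finset.smul_sum, smul_smul]
  rw [Finset.sum_comm]
  have h : ∀ C, ∑ A, (T.σ⁻¹ B A * T.σ A C) • y C = (if B = C then (1 : ℝ) else 0) • y C := by
    intro C
    rw [← Finset.sum_smul, ← Matrix.mul_apply, Matrix.nonsing_inv_mul _ T.σ_unit, Matrix.one_apply]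
  rw [Finset.sum_congr rfl fun C _ => h C]
  simp

/-- The density of `½ z^A σ_{AB} Z^B - G` as a local function. -/
def totalL (G : Loc n m c) : Loc n m c :=
  ∑ A, ∑ B, ((1 / 2 : ℝ) * T.σ⁻¹ A B) • (co (Sum.inl A, 0) * T.hamL G B) - G

theorem totalL_coe (G : Loc n m c) (Λ : Fin c → Loc n m c) :
    T.totalDerivTerm (coupleL G Λ) = (T.totalL G).1 := by
  funext p
  change _ = (∑ A, ∑ B, ((1 / 2 : ℝ) * T.σ⁻¹ A B) • (co (Sum.inl A, 0) * T.hamL G B)).1 p - G.1 p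
  rw [totalDerivTerm, coe_sum]
  congr 1
  refine Finset.sum_congr rfl fun A _ => ?_
  rw [coe_sum]
  refine Finset.sum_congr rfl fun B _ => ?_
  change _ = ((1 / 2 : ℝ) * T.σ⁻¹ A B) * (coord (Sum.inl A, 0) p * (T.hamL G B).1 p)
  rw [hamL_coe, mul_assoc]
  rfl

/-- The terms of the variation of the Lagrangian that contain the velocities combine to the
derivative of the generator along them. -/
theorem lagrangianVariation_eq (G : Loc n m c) (Λ : Fin c → Loc n m c) {u : Config n m c}
    {v : Fin m → Space n → ℝ} (hu : Sm u) (hv : ∀ A, ContDiff ℝ ∞ (v A)) (t : ℝ) :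
    T.lagrangianVariation (coupleL G Λ) t u v -
        deriv (fun s => T.functional (T.totalDerivTerm (coupleL G Λ)) (t + s) (advance u v s)) 0 =
      T.functional (pdt G + V (velVar v hv) G - ∑ A, ofX (v A) (hv A) * E (Sum.inl A) G -
        V (T.chars G Λ) T.HL).1 t u := by
  set δ : Derivation ℝ (Loc n m c) (Loc n m c) := pdt + V (velVar v hv) with hδ
  have hδa : ∀ f, pdt f + V (velVar v hv) f = δ f := fun f => rfl
  set L : Loc n m c := ∑ A, ∑ B, ((1 / 2 : ℝ) * T.σ⁻¹ A B) •
    (T.hamL G A * ofX (v B) (hv B) + co (Sum.inl A, 0) * δ (T.hamL G B)) with hL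
  have h1 : ∫ x in T.Ω, ∑ A, ∑ B, (1 / 2 : ℝ) * T.σ⁻¹ A B *
      (ev (T.ham (coupleL G Λ).1 A) t u x * v B x + u (Sum.inl A) x *
        deriv (fun s => ev (T.ham (coupleL G Λ).1 B) (t + s) (advance u v s) x) 0) =
      T.functional L.1 t u := by
    refine integral_congr_ae (Filter.Eventually.of_forall fun x => ?_)
    change _ = L.1 (t, x, jet u x)
    rw [hL, coe_sum]
    refine Finset.sum_congr rfl fun A _ => ?_
    rw [coe_sum]
    refine Finset.sum_congr rfl fun B _ => ?_
    change _ = ((1 / 2 : ℝ) * T.σ⁻¹ A B) * ((T.hamL G A).1 (t, x, jet u x) * v B x +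
      iterOp partialX 0 (u (Sum.inl A)) x * (δ (T.hamL G B)).1 (t, x, jet u x))
    rw [iterOp_zero]
    congr 2
    · rw [hamL_coe]
      rfl
    · congr 1
      have := deriv_ev_advance (T.hamL G B) hu hv t x
      rw [hamL_coe] at this
      exact this
  rw [lagrangianVariation, h1, totalL_coe, T.deriv_functional_advance _ hu hv, hδa, hδa,
    tilde_trans_coupleL, ← HL_coe, ← V_coe, ← T.int_sub hu, ← T.int_sub hu]
  congr 2
  have hco : ∀ A, δ (co (Sum.inl A, 0)) = ofX (v A) (hv A) := by
    intro A
    rw [← hδa, V_co, Ds_zero, pdt_co, zero_add]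
    rfl
  have h2 : δ (T.totalL G) = ∑ A, ∑ B, ((1 / 2 : ℝ) * T.σ⁻¹ A B) •
      (ofX (v A) (hv A) * T.hamL G B + co (Sum.inl A, 0) * δ (T.hamL G B)) - δ G := by
    rw [totalL, map_sub, map_sum]
    congr 1
    refine Finset.sum_congr rfl fun A _ => ?_
    rw [map_sum]
    refine Finset.sum_congr rfl fun B _ => ?_
    rw [Derivation.map_smul, Derivation.leibniz, smul_eq_mul, smul_eq_mul, hco]
    congr 1
    ring
  have h3 : ∑ A, ∑ B, ((1 / 2 : ℝ) * T.σ⁻¹ A B) • (ofX (v A) (hv A) * T.hamL G B) =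
      (1 / 2 : ℝ) • ∑ A, ofX (v A) (hv A) * E (Sum.inl A) G := by
    rw [Finset.smul_sum]
    refine Finset.sum_congr rfl fun A _ => ?_
    have h4 : E (Sum.inl A) G = ∑ B, T.σ⁻¹ A B • T.hamL G B :=
      (T.sum_inv_sig (fun B => E (Sum.inl B) G) A).symm
    rw [h4, Finset.mul_sum, Finset.smul_sum]
    refine Finset.sum_congr rfl fun B _ => ?_
    rw [mul_smul_comm, smul_smul]
  have h5 : ∑ A, ∑ B, ((1 / 2 : ℝ) * T.σ⁻¹ A B) • (T.hamL G A * ofX (v B) (hv B)) =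
      -((1 / 2 : ℝ) • ∑ A, ofX (v A) (hv A) * E (Sum.inl A) G) := by
    rw [← h3, Finset.sum_comm, ← Finset.sum_neg_distrib]
    refine Finset.sum_congr rfl fun B _ => ?_
    rw [← Finset.sum_neg_distrib]
    refine Finset.sum_congr rfl fun A _ => ?_
    rw [σ_inv_swap, mul_neg, neg_smul, mul_comm (T.hamL G A)]
  have h6 : (1 / 2 : ℝ) • ∑ A, ofX (v A) (hv A) * E (Sum.inl A) G +
      (1 / 2 : ℝ) • ∑ A, ofX (v A) (hv A) * E (Sum.inl A) G =
      ∑ A, ofX (v A) (hv A) * E (Sum.inl A) G := by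
    rw [← add_smul]
    norm_num
  rw [hL, h2]
  simp only [smul_add, Finset.sum_add_distrib]
  rw [h3, h5]
  linear_combination (-1) * h6

/-- On admissible configurations, the velocity may be replaced with the one given by the
equations of motion. -/
theorem functional_velVar {G : Loc n m c} {t : ℝ} {u : Config n m c}
    {v : Fin m → Space n → ℝ} (hu : Sm u) (hv : T.VelocityAdm t u v) (f : Loc n m c) :
    T.functional (pdt G + V (velVar v hv.1) G - ∑ A, ofX (v A) (hv.1 A) * E (Sum.inl A) G - f).1
      t u = T.functional (T.dtL G - T.poissonL G T.HL - f).1 t u := by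
  set W : FieldIdx m c → Loc n m c := velVar v hv.1 - T.flowL with hWdef
  have hW : ∀ s, W s ∈ flatAt T.Ω t u := by
    rintro (A | la)
    · rw [mem_flatAt_iff hu]
      have : ev (W (Sum.inl A)).1 t u =
          fun y => v A y - ev (T.ham T.H A) t u y := by
        funext y
        change v A y - (T.flowL (Sum.inl A)).1 (t, y, jet u y) = _
        rw [flowL_coe]
        rfl
      rw [this]
      exact hv.2 A
    · change co _ - co _ ∈ _
      rw [sub_self]
      exact Ideal.zero_mem _
  have h1 := setIntegral_DivSub T.isOpen T.bounded hu (V_sub_mem D_mem_flatAt _ G hW)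
  have h2 : ∑ᶠ s, W s * E s G =
      ∑ A, ofX (v A) (hv.1 A) * E (Sum.inl A) G - T.poissonL G T.HL := by
    rw [finsum_field (finite_mul_E _ _), finsum_eq_zero_of_forall_eq_zero, add_zero, poissonL,
      ← Finset.sum_sub_distrib]
    · refine Finset.sum_congr rfl fun A _ => ?_
      change (ofX (v A) (hv.1 A) - T.hamL T.HL A) * _ = _
      ring
    · intro la
      change (co _ - co _) * _ = _
      rw [sub_self, zero_mul]
  rw [← sub_eq_zero, ← T.int_sub hu]
  refine Eq.trans ?_ h1
  unfold GaugeData.functional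
  rw [h2, hWdef, map_sub, Derivation.sub_apply, dtL_apply]
  congr 3
  ring_nf

theorem velocityAdm_flow {t : ℝ} {u : Config n m c} (hu : Sm u) :
    T.VelocityAdm t u (fun A => ev (T.hamL T.HL A).1 t u) := by
  refine ⟨fun A => ev_contDiff _ hu t, fun A I x _ => ?_⟩
  simp only [hamL_coe, HL_coe, sub_self]
  rw [iterX_zero]
  rfl

/-- Generators of external symmetries in terms of the algebra of local functions. -/
theorem externalCouple_iff (G : Loc n m c) (Λ : Fin c → Loc n m c) :
    T.ExternalCouple (coupleL G Λ) ↔ T.Ext G Λ := by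
  have hc := T.tilde_trans_coupleL G Λ
  have hsrc : ∀ (Q : FieldIdx m c → Loc n m c) α t u x,
      ev (V (T.chars G Λ) (V Q (T.χL α)) - V Q (V (T.chars G Λ) (T.χL α))).1 t u x =
        ev (vary (fun s => (T.chars G Λ s).1) (vary (fun s => (Q s).1) (T.χ α))) t u x -
          ev (vary (fun s => (Q s).1) (vary (fun s => (T.chars G Λ s).1) (T.χ α))) t u x := by
    intro Q α t u x
    change (V (T.chars G Λ) (V Q (T.χL α))).1 _ - (V Q (V (T.chars G Λ) (T.χL α))).1 _ = _
    rw [V_coe, V_coe, V_coe, V_coe]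
    rfl
  have hdiff : ∀ Q : FieldIdx m c → Loc n m c, (V Q G - ∑ᶠ s, Q s * E s G ∈ T.null ↔
      ∀ t u, T.Adm u → T.functional (vary (fun s => (Q s).1) G.1) t u =
        T.functional (fun p => ∑ᶠ s : FieldIdx m c, euler s G.1 p * (Q s).1 p) t u) := by
    intro Q
    rw [sub_mem_null_iff, V_coe]
    have : (∑ᶠ s, Q s * E s G).1 =
        fun p => ∑ᶠ s : FieldIdx m c, euler s G.1 p * (Q s).1 p := by
      funext p
      rw [finsum_val (finite_mul_E _ _)]
      refine finsum_congr fun s => ?_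
      change (Q s).1 p * (E s G).1 p = _
      rw [E_coe, mul_comm]
    rw [this]
    rfl
  have hinv : ∀ (w : Loc n m c) t u, Sm u → ∀ v (hv : T.VelocityAdm t u v),
      (T.lagrangianVariation (coupleL G Λ) t u v =
        deriv (fun s => T.functional (T.totalDerivTerm (coupleL G Λ)) (t + s) (advance u v s)) 0 +
          T.functional w.1 t u ↔
      T.functional (T.dtL G - T.poissonL G T.HL - V (T.chars G Λ) T.HL - w).1 t u = 0) := by
    intro w t u hu v hv
    rw [T.int_sub hu, ← T.functional_velVar hu hv, ← T.lagrangianVariation_eq G Λ hu hv.1 t]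
    constructor <;> intro h <;> linarith
  constructor
  · intro h
    refine ⟨?_, ?_, ?_, ?_⟩
    · rw [presE_iff, ← hc]
      exact h.preserves
    · intro Q hQ α t u hu x hx
      rw [hsrc, ← hc]
      exact h.sources _ ((T.presI_iff Q).1 hQ) α t u hu x hx
    · intro Q hQ
      rw [hdiff]
      exact h.differentiable _ ((T.presI_iff Q).1 hQ)
    · obtain ⟨w, hw, hd, h⟩ := h.invariance
      obtain ⟨w, rfl⟩ := exists_bundle hw
      rw [divergence_coe] at hd h
      refine ⟨w, (T.dependsOnlyOnZeta_iff _).1 hd, fun t u hu => ?_⟩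
      exact (hinv _ t u hu.1 _ (T.velocityAdm_flow hu.1)).1
        (h t u _ hu (T.velocityAdm_flow hu.1))
  · intro h
    refine ⟨G.2, fun a => (Λ a).2, ?_, ?_, ?_, ?_⟩
    · rw [hc, ← presE_iff]
      exact h.presE
    · intro Q hQ α t u hu x hx
      obtain ⟨R, rfl⟩ := exists_bundle hQ.1.1
      rw [hc, ← hsrc]
      exact h.sources R ((T.presI_iff R).2 hQ) α t u hu x hx
    · intro Q hQ
      obtain ⟨R, rfl⟩ := exists_bundle hQ.1.1
      exact (hdiff R).1 (h.diff R ((T.presI_iff R).2 hQ))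
    · obtain ⟨w, hd, h⟩ := h.inv
      refine ⟨fun i => (w i).1, fun i => (w i).2, ?_, fun t u v hu hv => ?_⟩
      · rw [divergence_coe]
        exact (T.dependsOnlyOnZeta_iff _).2 hd
      · rw [divergence_coe]
        exact (hinv _ t u hu.1 v hv).2 (h t u hu)

end Action

/-! ### The bracket of transformations -/

section Transformations

variable {n m c r : ℕ} (T : GaugeTheory n m c r)

/-- The trivial symmetry added to `δ̃₁ δ₂ z^A` in the bracket of transformations. -/
def trivZ (Θ₁ Θ₂ : Fin c → Loc n m c) (A : Fin m) : Loc n m c :=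
  ∑ᶠ l : ℕ, ∑ k ∈ Finset.range l, ∑ B, ∑ b, T.σ A B •
    adj (Sum.inl B) (T.dtL^[k] (Θ₁ b))
      ((-T.dtL)^[l - 1 - k] (E (Sum.inr (l, b)) (T.smear Θ₂)))

/-- The canonical components of the bracket of transformations. -/
def brZ (Z₁ : Fin m → Loc n m c) (Θ₁ : Fin c → Loc n m c) (Z₂ : Fin m → Loc n m c)
    (Θ₂ : Fin c → Loc n m c) (A : Fin m) : Loc n m c :=
  (V (T.tildeL Z₁ Θ₁) (Z₂ A) + T.trivZ Θ₁ Θ₂ A) - (V (T.tildeL Z₂ Θ₂) (Z₁ A) + T.trivZ Θ₂ Θ₁ A)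

/-- The multiplier components of the bracket of transformations. -/
def brΘ (Z₁ : Fin m → Loc n m c) (Θ₁ : Fin c → Loc n m c) (Z₂ : Fin m → Loc n m c)
    (Θ₂ : Fin c → Loc n m c) (a : Fin c) : Loc n m c :=
  V (T.tildeL Z₁ Θ₁) (Θ₂ a) - V (T.tildeL Z₂ Θ₂) (Θ₁ a)

theorem trivZ_eq_sum (Θ₁ Θ₂ : Fin c → Loc n m c) {N : ℕ}
    (hN : ∀ l, N ≤ l → ∀ b, E (Sum.inr (l, b)) (T.smear Θ₂) = 0) (A : Fin m) :
    T.trivZ Θ₁ Θ₂ A = ∑ l ∈ Finset.range N, ∑ k ∈ Finset.range l, ∑ B, ∑ b, T.σ A B •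
      adj (Sum.inl B) (T.dtL^[k] (Θ₁ b))
        ((-T.dtL)^[l - 1 - k] (E (Sum.inr (l, b)) (T.smear Θ₂))) := by
  refine finsum_eq_sum_of_support_subset _ fun l hl => ?_
  by_contra h
  refine hl (Finset.sum_eq_zero fun k _ => Finset.sum_eq_zero fun B _ =>
    Finset.sum_eq_zero fun b _ => ?_)
  rw [hN l (by simpa using h) b, iterate_map_zero, map_zero, smul_zero]

theorem neg_dtL_iterate_coe (k : ℕ) (f : Loc n m c) :
    ((-T.dtL)^[k] f).1 = (fun f => -T.dt f)^[k] f.1 := by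
  induction k with
  | zero => rfl
  | succ k ih =>
    rw [Function.iterate_succ_apply', Function.iterate_succ_apply', ← ih, ← dtL_coe]
    rfl

theorem smear_coe (Λ : Fin c → Loc n m c) :
    (T.smear Λ).1 = fun q => ∑ a, T.φ a q * (Λ a).1 q := by
  funext q
  rw [smear, coe_sum]
  rfl

theorem trivZ_coe (Θ₁ Θ₂ : Fin c → Loc n m c) (A : Fin m) :
    (T.trivZ Θ₁ Θ₂ A).1 = fun p =>
      ∑ᶠ l : ℕ, ∑ k ∈ Finset.range l, ∑ D, ∑ b, T.σ A D *
        adjLin D (T.dt^[k] (Θ₁ b).1) ((fun f => -T.dt f)^[l - 1 - k]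
          (euler (Sum.inr (l, b)) (fun q => ∑ a, T.φ a q * (Θ₂ a).1 q))) p := by
  obtain ⟨N, hN⟩ := exists_E_lam_bound (T.smear Θ₂)
  funext p
  rw [trivZ, finsum_val]
  · refine finsum_congr fun l => ?_
    rw [coe_sum]
    refine Finset.sum_congr rfl fun k _ => ?_
    rw [coe_sum]
    refine Finset.sum_congr rfl fun B _ => ?_
    rw [coe_sum]
    refine Finset.sum_congr rfl fun b _ => ?_
    rw [← smear_coe, ← E_coe, ← neg_dtL_iterate_coe, ← dtL_iterate_coe, ← adj_coe]
    rfl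
  · refine (Finset.range N).finite_toSet.subset fun l hl => ?_
    by_contra h
    refine hl (Finset.sum_eq_zero fun k _ => Finset.sum_eq_zero fun B _ =>
      Finset.sum_eq_zero fun b _ => ?_)
    rw [hN l (by simpa using h) b, iterate_map_zero, map_zero, smul_zero]

theorem bracket_transfL (Z₁ : Fin m → Loc n m c) (Θ₁ : Fin c → Loc n m c)
    (Z₂ : Fin m → Loc n m c) (Θ₂ : Fin c → Loc n m c) :
    T.bracket (transfL Z₁ Θ₁) (transfL Z₂ Θ₂) =
      transfL (T.brZ Z₁ Θ₁ Z₂ Θ₂) (T.brΘ Z₁ Θ₁ Z₂ Θ₂) := by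
  have h : ∀ (Z₁ : Fin m → Loc n m c) (Θ₁ : Fin c → Loc n m c)
      (Z₂ : Fin m → Loc n m c) (Θ₂ : Fin c → Loc n m c) (A : Fin m),
      T.halfBracket (transfL Z₁ Θ₁) (transfL Z₂ Θ₂) A =
        (V (T.tildeL Z₁ Θ₁) (Z₂ A) + T.trivZ Θ₁ Θ₂ A).1 := by
    intro Z₁ Θ₁ Z₂ Θ₂ A
    funext p
    change _ = (V (T.tildeL Z₁ Θ₁) (Z₂ A)).1 p + (T.trivZ Θ₁ Θ₂ A).1 p
    rw [trivZ_coe, vary_tildeL_coe]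
    rfl
  refine Prod.ext (funext fun A => funext fun p => ?_) (funext fun a => funext fun p => ?_)
  · change T.halfBracket _ _ A p - T.halfBracket _ _ A p = _
    rw [h, h]
    rfl
  · change vary _ _ p - vary _ _ p = (V (T.tildeL Z₁ Θ₁) (Θ₂ a)).1 p -
      (V (T.tildeL Z₂ Θ₂) (Θ₁ a)).1 p
    rw [vary_tildeL_coe, vary_tildeL_coe]
    rfl

theorem coupleBracket_coupleL (G₁ : Loc n m c) (Λ₁ : Fin c → Loc n m c) (G₂ : Loc n m c)
    (Λ₂ : Fin c → Loc n m c) :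
    T.coupleBracket (coupleL G₁ Λ₁) (coupleL G₂ Λ₂) =
      coupleL (T.brG G₁ Λ₁ G₂ Λ₂) (T.brΛ G₁ Λ₁ G₂ Λ₂) := by
  refine Prod.ext (funext fun p => ?_) (funext fun a => funext fun p => ?_)
  · change vary _ _ p - vary _ _ p - T.poisson _ _ p = (V (T.chars G₁ Λ₁) G₂).1 p -
      (V (T.chars G₂ Λ₂) G₁).1 p - (T.poissonL G₂ G₁).1 p
    rw [tilde_trans_coupleL, tilde_trans_coupleL, poissonL_coe, V_coe, V_coe]
    rfl
  · change vary _ _ p - vary _ _ p = (V (T.chars G₁ Λ₁) (Λ₂ a)).1 p -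
      (V (T.chars G₂ Λ₂) (Λ₁ a)).1 p
    rw [tilde_trans_coupleL, tilde_trans_coupleL, V_coe, V_coe]
    rfl

theorem dtL_iterate_mem_vanish (k : ℕ) {f : Loc n m c} (hf : f ∈ vanish T.Ω) :
    T.dtL^[k] f ∈ vanish T.Ω := by
  induction k with
  | zero => exact hf
  | succ k ih =>
    rw [Function.iterate_succ_apply']
    exact T.dtL_mem_vanish ih

/-- Transformations that agree over the region extend to variations that agree there. -/
theorem tildeL_sub_mem {Z Z' : Fin m → Loc n m c} {Θ Θ' : Fin c → Loc n m c}
    (hZ : ∀ A, Z A - Z' A ∈ vanish T.Ω) (hΘ : ∀ a, Θ a - Θ' a ∈ vanish T.Ω) (s : FieldIdx m c) :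
    (T.tildeL Z Θ - T.tildeL Z' Θ') s ∈ vanish T.Ω := by
  rcases s with A | la
  · exact hZ A
  · change T.dtL^[la.1] (Θ la.2) - T.dtL^[la.1] (Θ' la.2) ∈ _
    rw [← iterate_map_sub]
    exact T.dtL_iterate_mem_vanish _ (hΘ _)

theorem V_sub_mem_vanish {Q R : FieldIdx m c → Loc n m c} (h : ∀ s, (Q - R) s ∈ vanish T.Ω)
    {f g : Loc n m c} (hfg : f - g ∈ vanish T.Ω) : V Q f - V R g ∈ vanish T.Ω := by
  have h1 := (vanish T.Ω).add_mem
    (V_mem_of_char_mem (fun i _ => D_mem_vanish T.isOpen i) h f) (V_mem_vanish T.isOpen R hfg)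
  convert h1 using 1
  rw [map_sub, map_sub, Derivation.sub_apply]
  ring

theorem adj_sub_mem_vanish (s : FieldIdx m c) {P P' v v' : Loc n m c}
    (hP : P - P' ∈ vanish T.Ω) (hv : v - v' ∈ vanish T.Ω) :
    adj s P v - adj s P' v' ∈ vanish T.Ω := by
  have hD : ∀ i, ∀ f ∈ (vanish T.Ω : Ideal (Loc n m c)), D i f ∈ vanish T.Ω :=
    fun i _ => D_mem_vanish T.isOpen i
  have h1 := (vanish T.Ω).add_mem
    (adj_mem_left hD (fun k f hf => pd_mem_vanish T.isOpen hf k) s v hP) (adj_mem_right hD s P' hv)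
  convert h1 using 1
  rw [map_sub, map_sub, LinearMap.sub_apply]
  ring

variable {T}

/-- The derivatives of a generator along the multipliers, in terms of the transformation of the
multipliers. -/
theorem Ext.E_lam_explicit {G : Loc n m c} {Λ Θ : Fin c → Loc n m c} (h : T.Ext G Λ)
    (hne : ∃ u, T.Adm u) (hΛ : ∀ a, Λ a - Θ a ∈ vanish T.Ω) {N : ℕ}
    (hG : ∀ l, N ≤ l → ∀ b, E (Sum.inr (l, b)) G = 0)
    (hN : ∀ l, N ≤ l → ∀ b, E (Sum.inr (l, b)) (T.smear Θ) = 0) (b : Fin c) (k : ℕ) :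
    E (Sum.inr (k, b)) G - ∑ l ∈ Finset.Ico (k + 1) N,
      (-T.dtL)^[l - 1 - k] (E (Sum.inr (l, b)) (T.smear Θ)) ∈ vanish T.Ω := by
  have h0 := T.smear_sub_mem hΛ
  refine descending_induction (P := fun k => E (Sum.inr (k, b)) G - ∑ l ∈ Finset.Ico (k + 1) N,
      (-T.dtL)^[l - 1 - k] (E (Sum.inr (l, b)) (T.smear Θ)) ∈ vanish T.Ω) N
    (fun k hk => ?_) (fun k ih => ?_) k
  · rw [hG k hk, Finset.Ico_eq_empty (by omega), Finset.sum_empty, sub_zero]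
    exact Ideal.zero_mem _
  by_cases hk : k + 1 < N
  · have h1 := (vanish T.Ω).add_mem (h.E_lam hne k b)
      (E_mem_vanish T.isOpen (Sum.inr (k + 1, b)) h0)
    have h2 := (vanish T.Ω).sub_mem h1 (T.dtL_mem_vanish ih)
    rw [Finset.sum_eq_sum_Ico_succ_bot hk]
    convert h2 using 1
    have h3 : ∀ l ∈ Finset.Ico (k + 1 + 1) N,
        (-T.dtL)^[l - 1 - k] (E (Sum.inr (l, b)) (T.smear Θ)) =
          -T.dtL ((-T.dtL)^[l - 1 - (k + 1)] (E (Sum.inr (l, b)) (T.smear Θ))) := by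
      intro l hl
      have : l - 1 - k = l - 1 - (k + 1) + 1 := by
        have := (Finset.mem_Ico.1 hl).1
        omega
      rw [this, Function.iterate_succ_apply']
      rfl
    rw [Finset.sum_congr rfl h3, Finset.sum_neg_distrib, map_sub, map_sub, map_sum]
    simp only [Nat.add_sub_cancel, Nat.sub_self, Function.iterate_zero, id]
    ring
  · have h1 := h.E_lam hne k b
    have h2 := E_mem_vanish T.isOpen (Sum.inr (k + 1, b)) h0
    rw [map_sub, hN (k + 1) (by omega), sub_zero] at h2
    rw [hG (k + 1) (by omega), map_zero, sub_zero] at h1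
    rw [Finset.Ico_eq_empty (by omega), Finset.sum_empty, sub_zero]
    have h3 := (vanish T.Ω).add_mem h1 h2
    rwa [sub_add_cancel] at h3

variable (T) in
/-- A generator together with the transformation that it generates over the region. -/
structure Gen (G : Loc n m c) (Λ : Fin c → Loc n m c) (Z : Fin m → Loc n m c)
    (Θ : Fin c → Loc n m c) : Prop where
  ext : T.Ext G Λ
  ham : ∀ A, T.hamL G A - Z A ∈ vanish T.Ω
  lam : ∀ a, Λ a - Θ a ∈ vanish T.Ω

section Gen

variable {G₁ G₂ : Loc n m c} {Λ₁ Λ₂ : Fin c → Loc n m c} {Z₁ Z₂ : Fin m → Loc n m c}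
  {Θ₁ Θ₂ : Fin c → Loc n m c}

theorem Gen.chars_sub_mem (h₁ : T.Gen G₁ Λ₁ Z₁ Θ₁) (s : FieldIdx m c) :
    (T.chars G₁ Λ₁ - T.tildeL Z₁ Θ₁) s ∈ vanish T.Ω :=
  T.tildeL_sub_mem h₁.ham h₁.lam s

/-- The trivial symmetry in the bracket of transformations is the contribution of the multipliers
to the transformation generated by the bracket of couples. -/
theorem Gen.sig_halfE_sub_mem (h₁ : T.Gen G₁ Λ₁ Z₁ Θ₁) (h₂ : T.Gen G₂ Λ₂ Z₂ Θ₂)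
    (hne : ∃ u, T.Adm u) (A : Fin m) :
    T.sig (fun B => T.halfE G₁ Λ₁ G₂ (Sum.inl B)) A -
      (V (T.tildeL Z₁ Θ₁) (Z₂ A) + T.trivZ Θ₁ Θ₂ A) ∈ vanish T.Ω := by
  obtain ⟨N₁, hN₁⟩ := exists_E_lam_bound G₂
  obtain ⟨N₂, hN₂⟩ := exists_E_lam_bound (T.smear Θ₂)
  set N := max N₁ N₂ with hNdef
  have hG : ∀ l, N ≤ l → ∀ b, E (Sum.inr (l, b)) G₂ = 0 := fun l hl =>
    hN₁ l (le_trans (le_max_left _ _) hl)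
  have hS : ∀ l, N ≤ l → ∀ b, E (Sum.inr (l, b)) (T.smear Θ₂) = 0 := fun l hl =>
    hN₂ l (le_trans (le_max_right _ _) hl)
  have h1 : ∀ B : Fin m, ∑ᶠ la, adj (Sum.inl B) (T.chars G₁ Λ₁ (Sum.inr la)) (E (Sum.inr la) G₂) =
      ∑ k ∈ Finset.range N, ∑ b,
        adj (Sum.inl B) (T.dtL^[k] (Λ₁ b)) (E (Sum.inr (k, b)) G₂) := by
    intro B
    rw [finsum_eq_sum_of_support_subset (s := Finset.range N ×ˢ Finset.univ),
      Finset.sum_product]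
    · rfl
    · rintro ⟨l, b⟩ h
      by_contra hn
      refine h ?_
      dsimp only
      rw [hG l (by simpa using hn), map_zero]
  have h2 : T.trivZ Θ₁ Θ₂ A = T.sig (fun B => ∑ k ∈ Finset.range N, ∑ b,
      adj (Sum.inl B) (T.dtL^[k] (Θ₁ b)) (∑ l ∈ Finset.Ico (k + 1) N,
        (-T.dtL)^[l - 1 - k] (E (Sum.inr (l, b)) (T.smear Θ₂)))) A := by
    rw [T.trivZ_eq_sum Θ₁ Θ₂ hS, sig]
    simp only [Finset.smul_sum, map_sum, Finset.range_eq_Ico]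
    rw [← Finset.sum_Ico_Ico_comm', Finset.sum_comm (s := Finset.univ)]
    refine Finset.sum_congr rfl fun k _ => ?_
    rw [Finset.sum_comm]
    exact Finset.sum_congr rfl fun B _ => Finset.sum_comm
  have h3 : T.sig (fun B => T.halfE G₁ Λ₁ G₂ (Sum.inl B)) A =
      V (T.chars G₁ Λ₁) (T.hamL G₂ A) + T.sig (fun B => ∑ k ∈ Finset.range N, ∑ b,
        adj (Sum.inl B) (T.dtL^[k] (Λ₁ b)) (E (Sum.inr (k, b)) G₂)) A := by
    rw [hamL_eq_sig, der_sig]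
    simp only [sig, halfE, h1, smul_add, Finset.sum_add_distrib]
  have h4 := (vanish T.Ω).add_mem (T.V_sub_mem_vanish h₁.chars_sub_mem (h₂.ham A))
    (T.sig_mem (vanish T.Ω) (y := fun B => ∑ k ∈ Finset.range N, ∑ b,
        adj (Sum.inl B) (T.dtL^[k] (Λ₁ b)) (E (Sum.inr (k, b)) G₂) -
      ∑ k ∈ Finset.range N, ∑ b, adj (Sum.inl B) (T.dtL^[k] (Θ₁ b)) (∑ l ∈ Finset.Ico (k + 1) N,
        (-T.dtL)^[l - 1 - k] (E (Sum.inr (l, b)) (T.smear Θ₂)))) (fun B => by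
      simp only [← Finset.sum_sub_distrib]
      refine Ideal.sum_mem _ fun k _ => Ideal.sum_mem _ fun b _ => ?_
      refine T.adj_sub_mem_vanish _ ?_ (h₂.ext.E_lam_explicit hne h₂.lam hG hS b k)
      rw [← iterate_map_sub]
      exact T.dtL_iterate_mem_vanish _ (h₁.lam b)) A)
  rw [sig_sub] at h4
  convert h4 using 1
  rw [h3, h2]
  ring

/-- The bracket of couples generates the bracket of transformations. -/
theorem Gen.bracket (h₁ : T.Gen G₁ Λ₁ Z₁ Θ₁) (h₂ : T.Gen G₂ Λ₂ Z₂ Θ₂) (hne : ∃ u, T.Adm u) :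
    T.Gen (T.brG G₁ Λ₁ G₂ Λ₂) (T.brΛ G₁ Λ₁ G₂ Λ₂) (T.brZ Z₁ Θ₁ Z₂ Θ₂) (T.brΘ Z₁ Θ₁ Z₂ Θ₂) where
  ext := h₁.ext.bracket h₂.ext hne
  ham A := by
    have h3 := (vanish T.Ω).sub_mem (h₁.sig_halfE_sub_mem h₂ hne A)
      (h₂.sig_halfE_sub_mem h₁ hne A)
    convert h3 using 1
    rw [hamL_eq_sig]
    simp only [E_brG, sig_sub, brZ]
    ring
  lam a := by
    have h3 := (vanish T.Ω).sub_mem (T.V_sub_mem_vanish h₁.chars_sub_mem (h₂.lam a))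
      (T.V_sub_mem_vanish h₂.chars_sub_mem (h₁.lam a))
    convert h3 using 1
    rw [brΛ, brΘ]
    ring

end Gen

end Transformations

/-! ### The extension by boundary terms -/

section Extension

variable {n m c r : ℕ} (T : GaugeTheory n m c r)

/-- The densities of the boundary terms that depend on the boundary fields only. -/
def bndry : Submodule ℝ (Loc n m c) where
  carrier := {k | (∀ Q, T.PresI Q → V Q k ∈ T.null) ∧
    ∃ j : Fin n → Loc n m c, k - ∑ i, D i (j i) ∈ T.null}
  zero_mem' := ⟨fun Q _ => by rw [map_zero]; exact T.null.zero_mem, 0, by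
    simp only [Pi.zero_apply, map_zero, Finset.sum_const_zero, sub_zero]
    exact T.null.zero_mem⟩
  add_mem' {k l} hk hl := by
    obtain ⟨hk, j, hj⟩ := hk
    obtain ⟨hl, i, hi⟩ := hl
    refine ⟨fun Q hQ => ?_, j + i, ?_⟩
    · rw [map_add]
      exact T.null.add_mem (hk Q hQ) (hl Q hQ)
    · convert T.null.add_mem hj hi using 1
      simp only [Pi.add_apply, map_add, Finset.sum_add_distrib]
      ring
  smul_mem' a k hk := by
    obtain ⟨hk, j, hj⟩ := hk
    refine ⟨fun Q hQ => ?_, a • j, ?_⟩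
    · rw [Derivation.map_smul]
      exact T.null.smul_mem a (hk Q hQ)
    · convert T.null.smul_mem a hj using 1
      simp only [Pi.smul_apply, Derivation.map_smul, smul_sub, Finset.smul_sum]

theorem isBoundaryFunctional_iff (k : Loc n m c) : T.IsBoundaryFunctional k.1 ↔ k ∈ T.bndry := by
  constructor
  · rintro ⟨-, h1, j, hj, h2⟩
    obtain ⟨j, rfl⟩ := exists_bundle hj
    rw [divergence_coe] at h2
    exact ⟨(T.dependsOnlyOnZeta_iff k).1 h1, j, T.sub_mem_null_iff.2 h2⟩
  · rintro ⟨h1, j, h2⟩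
    refine ⟨k.2, (T.dependsOnlyOnZeta_iff k).2 h1, fun i => (j i).1, fun i => (j i).2, ?_⟩
    rw [divergence_coe]
    exact T.sub_mem_null_iff.1 h2

/-- The densities of the functionals that vanish on the constraint surface. -/
def weak : Submodule ℝ (Loc n m c) where
  carrier := {f | T.WeaklyZero f.1}
  add_mem' {f g} hf hg t u hu := by
    have := map_add (T.int t hu.1.1) f g
    change T.functional (f + g).1 t u = T.functional f.1 t u + T.functional g.1 t u at this
    rw [this, hf t u hu, hg t u hu, add_zero]
  zero_mem' t u hu := map_zero (T.int t hu.1.1)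
  smul_mem' a f hf t u hu := by
    have := map_smul (T.int t hu.1.1) a f
    change T.functional (a • f).1 t u = a * T.functional f.1 t u at this
    rw [this, hf t u hu, mul_zero]

theorem null_le_weak : T.null ≤ T.weak := fun _ hf t u hu => hf t u hu.1

theorem mem_weak_of_mem_constr {f : Loc n m c} (hf : f ∈ T.constr) : f ∈ T.weak := fun t _ hu =>
  setIntegral_eq_zero_of_forall_eq_zero fun _ hx => T.ev_constr hf t hu hx

theorem mem_null_of {f : Loc n m c} (h : (∃ u, T.Adm u) → f ∈ T.null) : f ∈ T.null :=
  fun t u hu => h ⟨u, hu⟩ t u hu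

theorem mem_weak_of {f : Loc n m c} (h : (∃ u, T.Adm u) → f ∈ T.weak) : f ∈ T.weak :=
  fun t u hu => h ⟨u, hu.1⟩ t u hu

theorem mem_bndry_of {k : Loc n m c} (h : (∃ u, T.Adm u) → k ∈ T.bndry) : k ∈ T.bndry := by
  by_cases hne : ∃ u, T.Adm u
  · exact h hne
  · exact ⟨fun Q _ t u hu => (hne ⟨u, hu⟩).elim, 0, fun t u hu => (hne ⟨u, hu⟩).elim⟩

theorem ext_of {G : Loc n m c} {Λ : Fin c → Loc n m c} (h : (∃ u, T.Adm u) → T.Ext G Λ) :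
    T.Ext G Λ := by
  by_cases hne : ∃ u, T.Adm u
  · exact h hne
  · exact ⟨⟨fun _ _ t u hu => (hne ⟨u, hu⟩).elim, fun _ _ t u hu => (hne ⟨u, hu⟩).elim⟩,
      fun _ _ _ t u hu => (hne ⟨u, hu⟩).elim, fun _ _ t u hu => (hne ⟨u, hu⟩).elim,
      0, fun _ _ t u hu => (hne ⟨u, hu⟩).elim, fun t u hu => (hne ⟨u, hu⟩).elim⟩

theorem generates_iff (G : Loc n m c) (Λ : Fin c → Loc n m c) (Z : Fin m → Loc n m c)
    (Θ : Fin c → Loc n m c) :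
    T.Generates (coupleL G Λ) (transfL Z Θ) ↔ T.Ext G Λ ∧ ((∃ u, T.Adm u) → T.Gen G Λ Z Θ) := by
  rw [Generates, externalCouple_iff, SameTransf, trans_coupleL]
  constructor
  · rintro ⟨h1, -, -, h2⟩
    refine ⟨h1, fun hne => ⟨h1, fun A => ?_, fun a => ?_⟩⟩
    · refine T.mem_vanish_of_forall_adm hne fun t u hu x hx => ?_
      exact sub_eq_zero.2 ((h2 t u hu x (subset_closure hx)).1 A)
    · refine T.mem_vanish_of_forall_adm hne fun t u hu x hx => ?_
      exact sub_eq_zero.2 ((h2 t u hu x (subset_closure hx)).2 a)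
  · rintro ⟨h1, h2⟩
    refine ⟨h1, fun A => (Z A).2, fun a => (Θ a).2, fun t u hu x hx => ⟨fun A => ?_, fun a => ?_⟩⟩
    · exact sub_eq_zero.1 (vanish_closure ((h2 ⟨u, hu⟩).ham A) t hx (jet u x))
    · exact sub_eq_zero.1 (vanish_closure ((h2 ⟨u, hu⟩).lam a) t hx (jet u x))

theorem chars_add (G G' : Loc n m c) (Λ Λ' : Fin c → Loc n m c) :
    T.chars (G + G') (Λ + Λ') = T.chars G Λ + T.chars G' Λ' := by
  funext s
  rcases s with A | la
  · change T.hamL (G + G') A = _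
    rw [hamL_add]
    rfl
  · exact iterate_map_add T.dtL la.1 (Λ la.2) (Λ' la.2)

variable {T}

theorem Generates.exists_bundle {C : Couple n m c} {τ : Transf n m c} (h : T.Generates C τ) :
    ∃ G Λ Z Θ, C = coupleL G Λ ∧ τ = transfL Z Θ :=
  ⟨⟨C.1, h.1.local_G⟩, fun a => ⟨C.2 a, h.1.local_Λ a⟩, fun A => ⟨τ.1 A, h.2.1 A⟩,
    fun a => ⟨τ.2 a, h.2.2.1 a⟩, rfl, rfl⟩

theorem generates_bracket {C₁ C₂ : Couple n m c} {τ₁ τ₂ : Transf n m c}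
    (h₁ : T.Generates C₁ τ₁) (h₂ : T.Generates C₂ τ₂) :
    T.Generates (T.coupleBracket C₁ C₂) (T.bracket τ₁ τ₂) := by
  obtain ⟨G₁, Λ₁, Z₁, Θ₁, rfl, rfl⟩ := h₁.exists_bundle
  obtain ⟨G₂, Λ₂, Z₂, Θ₂, rfl, rfl⟩ := h₂.exists_bundle
  rw [coupleBracket_coupleL, bracket_transfL]
  rw [generates_iff] at h₁ h₂ ⊢
  exact ⟨T.ext_of fun hne => h₁.1.bracket h₂.1 hne, fun hne => (h₁.2 hne).bracket (h₂.2 hne) hne⟩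

theorem E_mem_vanish_of_bndry (hne : ∃ u, T.Adm u) {k : Loc n m c} (hk : k ∈ T.bndry)
    (s : FieldIdx m c) : E s k ∈ vanish T.Ω := by
  obtain ⟨-, j, hj⟩ := hk
  have h := T.E_mem_vanish_of_null hne hj s
  rwa [map_sub, map_sum, Finset.sum_eq_zero fun i _ => E_D s i _, sub_zero] at h

theorem hamL_mem_vanish {k : Loc n m c} (hk : ∀ s, E s k ∈ vanish T.Ω) (A : Fin m) :
    T.hamL k A ∈ vanish T.Ω := T.sig_mem _ (fun B => hk (Sum.inl B)) A

theorem poissonL_sub_mem {F G k l : Loc n m c} (hk : ∀ s, E s k ∈ vanish T.Ω)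
    (hl : ∀ s, E s l ∈ vanish T.Ω) :
    T.poissonL (F + k) (G + l) - T.poissonL F G ∈ vanish T.Ω := by
  rw [poissonL, poissonL, ← Finset.sum_sub_distrib]
  refine Ideal.sum_mem _ fun A _ => ?_
  have h1 := (vanish T.Ω).add_mem ((vanish T.Ω).mul_mem_right (T.hamL (G + l) A) (hk (Sum.inl A)))
    ((vanish T.Ω).mul_mem_left (E (Sum.inl A) F) (hamL_mem_vanish hl A))
  convert h1 using 1
  rw [map_add, hamL_add, Pi.add_apply]
  ring

theorem E_mem_vanish_of_hamL_mem {K : Loc n m c} (h : ∀ A, T.hamL K A ∈ vanish T.Ω) (B : Fin m) :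
    E (Sum.inl B) K ∈ vanish T.Ω := by
  rw [← T.sum_inv_sig (fun B => E (Sum.inl B) K) B]
  exact Ideal.sum_mem _ fun A _ => smul_mem_ideal _ _ (h A)

section Gen

variable {G G' G₁ G₂ : Loc n m c} {Λ Λ' Λ₁ Λ₂ : Fin c → Loc n m c} {Z Z' Z₁ Z₂ : Fin m → Loc n m c}
  {Θ Θ' Θ₁ Θ₂ : Fin c → Loc n m c}

/-- Two generators of the same transformation differ by a boundary term that depends on the
boundary fields only: its Euler derivatives vanish, so that it is a divergence. -/
theorem Gen.sub_mem_bndry (h : T.Gen G Λ Z Θ) (h' : T.Gen G' Λ' Z Θ) (hne : ∃ u, T.Adm u) :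
    G - G' ∈ T.bndry := by
  have hE : ∀ s, E s (G - G') ∈ vanish T.Ω := by
    rintro (B | la)
    · refine E_mem_vanish_of_hamL_mem (fun A => ?_) B
      have h1 := (vanish T.Ω).sub_mem (h.ham A) (h'.ham A)
      convert h1 using 1
      rw [hamL_eq_sig, hamL_eq_sig, hamL_eq_sig]
      simp only [map_sub, sig_sub]
      ring
    · refine h.ext.E_lam_sub_mem h'.ext hne (fun a => ?_) la
      have h1 := (vanish T.Ω).sub_mem (h.lam a) (h'.lam a)
      convert h1 using 1
      ring
  obtain ⟨j, hj⟩ := exists_divergence T.dim_pos hE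
  refine ⟨fun Q hQ => ?_, j, T.vanish_le_null hj⟩
  have h1 : ∑ᶠ s, Q s * E s (G - G') ∈ vanish T.Ω :=
    finsum_induction (fun f => f ∈ vanish T.Ω) (vanish T.Ω).zero_mem
      (fun _ _ => (vanish T.Ω).add_mem) fun s => (vanish T.Ω).mul_mem_left _ (hE s)
  have h2 := T.null.add_mem (T.null.sub_mem (h.ext.diff Q hQ) (h'.ext.diff Q hQ))
    (T.vanish_le_null h1)
  convert h2 using 1
  have h3 : ∑ᶠ s, Q s * E s (G - G') = ∑ᶠ s, Q s * E s G - ∑ᶠ s, Q s * E s G' := by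
    rw [← finsum_sub_distrib (finite_mul_E Q G) (finite_mul_E Q G')]
    exact finsum_congr fun s => by rw [map_sub, mul_sub]
  rw [h3, map_sub]
  ring

/-- External symmetries act on the boundary terms that depend on the boundary fields only. -/
theorem Gen.V_mem_bndry (h : T.Gen G Λ Z Θ) (hne : ∃ u, T.Adm u) {k : Loc n m c}
    (hk : k ∈ T.bndry) : V (T.tildeL Z Θ) k ∈ T.bndry := by
  have h1 : ∀ f, V (T.chars G Λ) f - V (T.tildeL Z Θ) f ∈ vanish T.Ω := fun f =>
    T.V_sub_mem_vanish h.chars_sub_mem (by rw [sub_self]; exact Ideal.zero_mem _)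
  obtain ⟨hk, j, hj⟩ := hk
  refine ⟨fun Q hQ => ?_, fun i => V (T.tildeL Z Θ) (j i), ?_⟩
  · have h2 := T.null.sub_mem (h.ext.V_depends hne hk Q hQ)
      (T.vanish_le_null (V_mem_vanish T.isOpen Q (h1 k)))
    rwa [map_sub, sub_sub_cancel] at h2
  · have h2 := T.null.sub_mem (h.ext.presE.null _ hj) (T.vanish_le_null (h1 (k - ∑ i, D i (j i))))
    rw [sub_sub_cancel, map_sub, map_sum] at h2
    simp only [V_D] at h2
    exact h2

/-- Adding boundary terms to the generators changes their bracket by the action of the symmetries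
on the boundary terms. -/
theorem Gen.brG_add_sub_mem (h₁ : T.Gen G₁ Λ₁ Z₁ Θ₁) (h₂ : T.Gen G₂ Λ₂ Z₂ Θ₂) {k₁ k₂ : Loc n m c}
    (hk₁ : ∀ s, E s k₁ ∈ vanish T.Ω) (hk₂ : ∀ s, E s k₂ ∈ vanish T.Ω)
    (hΛ : ∀ a, Λ a - Θ₁ a ∈ vanish T.Ω) (hΛ' : ∀ a, Λ' a - Θ₂ a ∈ vanish T.Ω) :
    T.brG (G₁ + k₁) Λ (G₂ + k₂) Λ' -
      (T.brG G₁ Λ₁ G₂ Λ₂ + V (T.tildeL Z₁ Θ₁) k₂ - V (T.tildeL Z₂ Θ₂) k₁) ∈ vanish T.Ω := by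
  have hch : ∀ {G k : Loc n m c} {Λ Λ' Θ : Fin c → Loc n m c} {Z : Fin m → Loc n m c},
      T.Gen G Λ Z Θ → (∀ s, E s k ∈ vanish T.Ω) → (∀ a, Λ' a - Θ a ∈ vanish T.Ω) →
      ∀ f g, V (T.chars (G + k) Λ') (f + g) - (V (T.chars G Λ) f + V (T.tildeL Z Θ) g) ∈
        vanish T.Ω := by
    intro G k Λ Λ' Θ Z h hk hΛ f g
    have h0 : ∀ s, (T.chars (G + k) Λ' - T.tildeL Z Θ) s ∈ vanish T.Ω :=
      T.tildeL_sub_mem (fun A => by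
        have h1 := (vanish T.Ω).add_mem (h.ham A) (hamL_mem_vanish hk A)
        convert h1 using 1
        rw [hamL_add, Pi.add_apply]
        ring) hΛ
    have h1 : ∀ f : Loc n m c, f - f ∈ vanish T.Ω := fun f => by
      rw [sub_self]
      exact Ideal.zero_mem _
    have h2 := (vanish T.Ω).add_mem ((vanish T.Ω).sub_mem (T.V_sub_mem_vanish h0 (h1 f))
      (T.V_sub_mem_vanish h.chars_sub_mem (h1 f))) (T.V_sub_mem_vanish h0 (h1 g))
    convert h2 using 1
    rw [map_add]
    ring
  have h3 := (vanish T.Ω).sub_mem ((vanish T.Ω).sub_mem (hch h₁ hk₁ hΛ G₂ k₂)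
    (hch h₂ hk₂ hΛ' G₁ k₁)) (poissonL_sub_mem (F := G₂) (G := G₁) hk₂ hk₁)
  convert h3 using 1
  rw [brG, brG]
  ring

theorem Ext.add (h : T.Ext G Λ) (h' : T.Ext G' Λ') : T.Ext (G + G') (Λ + Λ') := by
  have hc : T.chars (G + G') (Λ + Λ') = T.chars G Λ + T.chars G' Λ' := T.chars_add G G' Λ Λ'
  refine ⟨?_, fun Q hQ α => ?_, fun Q hQ => ?_, ?_⟩
  · rw [hc]
    exact h.presE.add h'.presE
  · convert T.bd.add_mem (h.sources Q hQ α) (h'.sources Q hQ α) using 1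
    rw [hc]
    simp only [map_add, Derivation.add_apply]
    ring
  · convert T.null.add_mem (h.diff Q hQ) (h'.diff Q hQ) using 1
    have h3 : ∑ᶠ s, Q s * E s (G + G') = ∑ᶠ s, Q s * E s G + ∑ᶠ s, Q s * E s G' := by
      rw [← finsum_add_distrib (finite_mul_E Q G) (finite_mul_E Q G')]
      exact finsum_congr fun s => by rw [map_add, mul_add]
    rw [h3, map_add]
    ring
  · obtain ⟨v, hv, hb⟩ := h.inv
    obtain ⟨v', hv', hb'⟩ := h'.inv
    refine ⟨v + v', fun Q hQ => ?_, ?_⟩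
    · simp only [Pi.add_apply, map_add, Finset.sum_add_distrib]
      exact T.null.add_mem (hv Q hQ) (hv' Q hQ)
    · convert T.null.add_mem hb hb' using 1
      have h3 : T.poissonL (G + G') T.HL = T.poissonL G T.HL + T.poissonL G' T.HL := by
        simp only [poissonL, map_add, add_mul, Finset.sum_add_distrib]
      rw [hc, h3]
      simp only [map_add, Derivation.add_apply, Pi.add_apply, Finset.sum_add_distrib]
      ring

theorem Gen.add (h : T.Gen G Λ Z Θ) (h' : T.Gen G' Λ' Z' Θ') :
    T.Gen (G + G') (Λ + Λ') (Z + Z') (Θ + Θ') where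
  ext := h.ext.add h'.ext
  ham A := by
    convert (vanish T.Ω).add_mem (h.ham A) (h'.ham A) using 1
    rw [hamL_add, Pi.add_apply, Pi.add_apply]
    ring
  lam a := by
    convert (vanish T.Ω).add_mem (h.lam a) (h'.lam a) using 1
    rw [Pi.add_apply, Pi.add_apply]
    ring

end Gen

section Jacobi

variable {G₁ G₂ G₃ : Loc n m c} {Λ₁ Λ₂ Λ₃ : Fin c → Loc n m c}

variable (T) in
/-- A double bracket of generators. -/
abbrev brbrG (G₁ : Loc n m c) (Λ₁ : Fin c → Loc n m c) (G₂ : Loc n m c) (Λ₂ : Fin c → Loc n m c)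
    (G₃ : Loc n m c) (Λ₃ : Fin c → Loc n m c) : Loc n m c :=
  T.brG (T.brG G₁ Λ₁ G₂ Λ₂) (T.brΛ G₁ Λ₁ G₂ Λ₂) G₃ Λ₃

variable (T) in
/-- The action on the multipliers of a double bracket of couples. -/
abbrev brbrΛ (G₁ : Loc n m c) (Λ₁ : Fin c → Loc n m c) (G₂ : Loc n m c) (Λ₂ : Fin c → Loc n m c)
    (G₃ : Loc n m c) (Λ₃ : Fin c → Loc n m c) : Fin c → Loc n m c :=
  T.brΛ (T.brG G₁ Λ₁ G₂ Λ₂) (T.brΛ G₁ Λ₁ G₂ Λ₂) G₃ Λ₃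

/-- A double bracket acts as the double commutator on the constraint surface. -/
theorem Ext.V_brbr_sub_mem (h₁ : T.Ext G₁ Λ₁) (h₂ : T.Ext G₂ Λ₂) (h₃ : T.Ext G₃ Λ₃)
    (hne : ∃ u, T.Adm u) (f : Loc n m c) :
    V (T.chars (T.brbrG G₁ Λ₁ G₂ Λ₂ G₃ Λ₃) (T.brbrΛ G₁ Λ₁ G₂ Λ₂ G₃ Λ₃)) f -
      V (comm (comm (T.chars G₁ Λ₁) (T.chars G₂ Λ₂)) (T.chars G₃ Λ₃)) f ∈ T.flat := by
  have h4 := T.constr_le_flat ((h₁.bracket h₂ hne).V_triv_mem h₃ hne f)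
  have h5 := T.constr_le_flat (h₁.V_triv_mem h₂ hne (V (T.chars G₃ Λ₃) f))
  have h6 := h₃.presE.flat (T.constr_le_flat (h₁.V_triv_mem h₂ hne f))
  convert T.flat.add_mem (T.flat.sub_mem h5 h6) h4 using 1
  rw [V_chars_br, V_chars_br, V_chars_br]
  simp only [V_comm, map_add, map_sub]
  ring

/-- The Jacobi identity for the transformations generated by couples. -/
theorem Ext.V_jacobi_mem (h₁ : T.Ext G₁ Λ₁) (h₂ : T.Ext G₂ Λ₂) (h₃ : T.Ext G₃ Λ₃)
    (hne : ∃ u, T.Adm u) (f : Loc n m c) :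
    V (T.chars (T.brbrG G₁ Λ₁ G₂ Λ₂ G₃ Λ₃ + T.brbrG G₂ Λ₂ G₃ Λ₃ G₁ Λ₁ +
        T.brbrG G₃ Λ₃ G₁ Λ₁ G₂ Λ₂) (T.brbrΛ G₁ Λ₁ G₂ Λ₂ G₃ Λ₃ + T.brbrΛ G₂ Λ₂ G₃ Λ₃ G₁ Λ₁ +
        T.brbrΛ G₃ Λ₃ G₁ Λ₁ G₂ Λ₂)) f ∈ T.flat := by
  convert T.flat.add_mem (T.flat.add_mem (h₁.V_brbr_sub_mem h₂ h₃ hne f)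
    (h₂.V_brbr_sub_mem h₃ h₁ hne f)) (h₃.V_brbr_sub_mem h₁ h₂ hne f) using 1
  rw [chars_add, chars_add]
  simp only [V_comm, map_add, map_sub, Derivation.add_apply]
  ring

variable (T) in
/-- The parts of a double bracket that do not cancel in the Jacobi identity are due to the trivial
symmetry in the bracket. -/
theorem brbrG_eq (G₁ : Loc n m c) (Λ₁ : Fin c → Loc n m c) (G₂ : Loc n m c)
    (Λ₂ : Fin c → Loc n m c) (G₃ : Loc n m c) (Λ₃ : Fin c → Loc n m c) :
    T.brbrG G₁ Λ₁ G₂ Λ₂ G₃ Λ₃ =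
      V (T.chars G₁ Λ₁) (V (T.chars G₂ Λ₂) G₃) - V (T.chars G₂ Λ₂) (V (T.chars G₁ Λ₁) G₃) -
        V (T.chars G₃ Λ₃) (V (T.chars G₁ Λ₁) G₂) + V (T.chars G₃ Λ₃) (V (T.chars G₂ Λ₂) G₁) +
      (∑ A, E (Sum.inl A) G₂ * V (T.chars G₃ Λ₃) (T.hamL G₁ A) -
        ∑ A, E (Sum.inl A) G₁ * V (T.chars G₃ Λ₃) (T.hamL G₂ A)) -
      (∑ A, E (Sum.inl A) G₃ * V (T.chars G₁ Λ₁) (T.hamL G₂ A) -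
        ∑ A, E (Sum.inl A) G₃ * V (T.chars G₂ Λ₂) (T.hamL G₁ A)) +
      (V (T.triv G₁ Λ₁ G₂ Λ₂) G₃ -
        ∑ A, T.triv G₁ Λ₁ G₂ Λ₂ (Sum.inl A) * E (Sum.inl A) G₃) := by
  have h1 : T.poissonL G₃ (T.brG G₁ Λ₁ G₂ Λ₂) =
      ∑ A, E (Sum.inl A) G₃ * V (T.chars G₁ Λ₁) (T.hamL G₂ A) -
        ∑ A, E (Sum.inl A) G₃ * V (T.chars G₂ Λ₂) (T.hamL G₁ A) +
        ∑ A, T.triv G₁ Λ₁ G₂ Λ₂ (Sum.inl A) * E (Sum.inl A) G₃ := by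
    rw [poissonL, ← Finset.sum_sub_distrib, ← Finset.sum_add_distrib]
    refine Finset.sum_congr rfl fun A _ => ?_
    change _ = _ + (T.hamL (T.brG G₁ Λ₁ G₂ Λ₂) A -
      (V (T.chars G₁ Λ₁) (T.hamL G₂ A) - V (T.chars G₂ Λ₂) (T.hamL G₁ A))) * _
    ring
  have h2 : ∑ A, V (T.chars G₃ Λ₃) (T.hamL G₂ A) * E (Sum.inl A) G₁ =
      ∑ A, E (Sum.inl A) G₁ * V (T.chars G₃ Λ₃) (T.hamL G₂ A) :=
    Finset.sum_congr rfl fun A _ => mul_comm _ _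
  have h3 : T.brbrG G₁ Λ₁ G₂ Λ₂ G₃ Λ₃ =
      V (T.chars (T.brG G₁ Λ₁ G₂ Λ₂) (T.brΛ G₁ Λ₁ G₂ Λ₂)) G₃ -
        V (T.chars G₃ Λ₃) (T.brG G₁ Λ₁ G₂ Λ₂) - T.poissonL G₃ (T.brG G₁ Λ₁ G₂ Λ₂) := rfl
  have h4 : V (T.chars G₃ Λ₃) (T.brG G₁ Λ₁ G₂ Λ₂) =
      V (T.chars G₃ Λ₃) (V (T.chars G₁ Λ₁) G₂) - V (T.chars G₃ Λ₃) (V (T.chars G₂ Λ₂) G₁) -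
        V (T.chars G₃ Λ₃) (T.poissonL G₂ G₁) := by
    rw [brG, map_sub, map_sub]
  rw [h3, h4, h1, V_chars_br, der_poissonL, h2]
  ring

/-- The trivial symmetries change generators by functionals that vanish on the constraint
surface. -/
theorem Ext.V_triv_sub_mem_weak (h₁ : T.Ext G₁ Λ₁) (h₂ : T.Ext G₂ Λ₂) (hne : ∃ u, T.Adm u)
    (G₃ : Loc n m c) : V (T.triv G₁ Λ₁ G₂ Λ₂) G₃ -
      ∑ A, T.triv G₁ Λ₁ G₂ Λ₂ (Sum.inl A) * E (Sum.inl A) G₃ ∈ T.weak := by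
  have h3 := T.null_le_weak (T.DivSub_flat_le_null (V_sub_mem T.D_mem_flat
    (T.triv G₁ Λ₁ G₂ Λ₂) G₃ fun s => T.constr_le_flat (h₁.triv_mem h₂ hne s)))
  have h4 : ∑ᶠ la, T.triv G₁ Λ₁ G₂ Λ₂ (Sum.inr la) * E (Sum.inr la) G₃ ∈ T.constr :=
    finsum_induction (fun f => f ∈ T.constr) T.constr.zero_mem
      (fun _ _ => T.constr.add_mem) fun la =>
        T.constr.mul_mem_right _ (h₁.triv_mem h₂ hne (Sum.inr la))
  rw [finsum_field (finite_mul_E _ _)] at h3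
  convert T.weak.add_mem h3 (T.mem_weak_of_mem_constr h4) using 1
  ring

/-- The Jacobi identity for generators, on the constraint surface. -/
theorem Ext.jacobi_mem_weak (h₁ : T.Ext G₁ Λ₁) (h₂ : T.Ext G₂ Λ₂) (h₃ : T.Ext G₃ Λ₃)
    (hne : ∃ u, T.Adm u) :
    T.brbrG G₁ Λ₁ G₂ Λ₂ G₃ Λ₃ + T.brbrG G₂ Λ₂ G₃ Λ₃ G₁ Λ₁ + T.brbrG G₃ Λ₃ G₁ Λ₁ G₂ Λ₂ ∈ T.weak := by
  convert T.weak.add_mem (T.weak.add_mem (h₁.V_triv_sub_mem_weak h₂ hne G₃)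
    (h₂.V_triv_sub_mem_weak h₃ hne G₁)) (h₃.V_triv_sub_mem_weak h₁ hne G₂) using 1
  rw [brbrG_eq, brbrG_eq, brbrG_eq]
  ring

/-- Replacing the bracket of two generators with another generator of the same transformation
changes a further bracket by the variation of the difference. -/
theorem Gen.double_sub_mem {Z₁ Z₂ Z₃ : Fin m → Loc n m c} {Θ₁ Θ₂ Θ₃ : Fin c → Loc n m c}
    {G₁₂ : Loc n m c} {Λ₁₂ : Fin c → Loc n m c}
    (h₁ : T.Gen G₁ Λ₁ Z₁ Θ₁) (h₂ : T.Gen G₂ Λ₂ Z₂ Θ₂) (h₃ : T.Gen G₃ Λ₃ Z₃ Θ₃)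
    (h₁₂ : T.Gen G₁₂ Λ₁₂ (T.brZ Z₁ Θ₁ Z₂ Θ₂) (T.brΘ Z₁ Θ₁ Z₂ Θ₂)) (hne : ∃ u, T.Adm u) :
    T.brG G₁₂ Λ₁₂ G₃ Λ₃ - V (T.tildeL Z₃ Θ₃) (T.brG G₁ Λ₁ G₂ Λ₂ - G₁₂) -
      T.brbrG G₁ Λ₁ G₂ Λ₂ G₃ Λ₃ ∈ vanish T.Ω := by
  have hb := h₁.bracket h₂ hne
  have h4 := hb.brG_add_sub_mem h₃ (k₁ := G₁₂ - T.brG G₁ Λ₁ G₂ Λ₂) (k₂ := 0)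
    (E_mem_vanish_of_bndry hne (h₁₂.sub_mem_bndry hb hne))
    (fun s => by rw [map_zero]; exact Ideal.zero_mem _) h₁₂.lam h₃.lam
  rw [add_sub_cancel, add_zero, map_zero, add_zero] at h4
  convert h4 using 1
  rw [map_sub, map_sub, brbrG]
  ring

/-- The cyclic sum of double brackets is a proper gauge transformation. -/
theorem Gen.jacobi_isProperGauge {Z₁ Z₂ Z₃ : Fin m → Loc n m c} {Θ₁ Θ₂ Θ₃ : Fin c → Loc n m c}
    (h₁ : T.Gen G₁ Λ₁ Z₁ Θ₁) (h₂ : T.Gen G₂ Λ₂ Z₂ Θ₂) (h₃ : T.Gen G₃ Λ₃ Z₃ Θ₃)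
    (hne : ∃ u, T.Adm u) :
    T.IsProperGauge
      (T.bracket (T.bracket (transfL Z₁ Θ₁) (transfL Z₂ Θ₂)) (transfL Z₃ Θ₃) +
        T.bracket (T.bracket (transfL Z₂ Θ₂) (transfL Z₃ Θ₃)) (transfL Z₁ Θ₁) +
        T.bracket (T.bracket (transfL Z₃ Θ₃) (transfL Z₁ Θ₁)) (transfL Z₂ Θ₂)) := by
  have h := (((h₁.bracket h₂ hne).bracket h₃ hne).add ((h₂.bracket h₃ hne).bracket h₁ hne)).add
    ((h₃.bracket h₁ hne).bracket h₂ hne)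
  have hgen := (T.generates_iff _ _ _ _).2 ⟨h.ext, fun _ => h⟩
  simp only [bracket_transfL]
  refine ⟨_, ⟨hgen.1, fun α t u hu x hx => ?_, ?_⟩, hgen⟩
  · have h4 := T.flat_le_bd (h₁.ext.V_jacobi_mem h₂.ext h₃.ext hne (T.χL α)) t u hu x hx
    rw [V_coe] at h4
    rw [tilde_trans_coupleL]
    exact h4
  · exact h₁.ext.jacobi_mem_weak h₂.ext h₃.ext hne

end Jacobi

end Extension

end GaugeTheory

end BoundaryGauge

end

open BoundaryGauge GaugeTheory in
theorem mainTheorem11 {n m c r : ℕ} (T : BoundaryGauge.GaugeTheory n m c r) :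
    -- external symmetries are closed under the bracket, which is generated by the couple bracket
    (∀ (C₁ C₂ : BoundaryGauge.Couple n m c) (τ₁ τ₂ : BoundaryGauge.Transf n m c),
      T.Generates C₁ τ₁ → T.Generates C₂ τ₂ →
        T.Generates (T.coupleBracket C₁ C₂) (T.bracket τ₁ τ₂)) ∧
    ∀ (𝒢 : Submodule ℝ (BoundaryGauge.Transf n m c))
      (G : BoundaryGauge.Transf n m c → BoundaryGauge.Couple n m c),
      T.IsGeneratingSet 𝒢 G →
      ∃ K : BoundaryGauge.Transf n m c → BoundaryGauge.Transf n m c →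
          BoundaryGauge.JetFn n m c,
        -- the extension terms are boundary terms depending on the boundary fields only
        (∀ τ₁ ∈ 𝒢, ∀ τ₂ ∈ 𝒢, T.IsBoundaryFunctional (K τ₁ τ₂)) ∧
        -- `[(G₁, δ₁), (G₂, δ₂)] = (G_{[1,2]} + K_{1,2}, δ_{[1,2]})`
        (∀ τ₁ ∈ 𝒢, ∀ τ₂ ∈ 𝒢,
          T.FunctionalEq (T.coupleBracket (G τ₁) (G τ₂)).1
            ((G (T.bracket τ₁ τ₂)).1 + K τ₁ τ₂) ∧
          T.Generates (T.coupleBracket (G τ₁) (G τ₂)) (T.bracket τ₁ τ₂)) ∧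
        -- antisymmetry
        (∀ τ₁ ∈ 𝒢, ∀ τ₂ ∈ 𝒢, T.FunctionalEq (K τ₁ τ₂) (-K τ₂ τ₁)) ∧
        -- cocycle condition
        (∀ τ₁ ∈ 𝒢, ∀ τ₂ ∈ 𝒢, ∀ τ₃ ∈ 𝒢,
          T.IsBoundaryFunctional
            ((K (T.bracket τ₁ τ₂) τ₃ - BoundaryGauge.vary (T.tilde τ₃) (K τ₁ τ₂)) +
              (K (T.bracket τ₂ τ₃) τ₁ - BoundaryGauge.vary (T.tilde τ₁) (K τ₂ τ₃)) +
              (K (T.bracket τ₃ τ₁) τ₂ - BoundaryGauge.vary (T.tilde τ₂) (K τ₃ τ₁))) ∧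
          T.WeaklyZero
            ((K (T.bracket τ₁ τ₂) τ₃ - BoundaryGauge.vary (T.tilde τ₃) (K τ₁ τ₂)) +
              (K (T.bracket τ₂ τ₃) τ₁ - BoundaryGauge.vary (T.tilde τ₁) (K τ₂ τ₃)) +
              (K (T.bracket τ₃ τ₁) τ₂ - BoundaryGauge.vary (T.tilde τ₂) (K τ₃ τ₁)))) ∧
        -- abelian extension of `𝒢` by the boundary terms, on which `𝒢` acts
        (∀ τ₁ ∈ 𝒢, ∀ τ₂ ∈ 𝒢, ∀ k₁ k₂ : BoundaryGauge.JetFn n m c,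
          T.IsBoundaryFunctional k₁ → T.IsBoundaryFunctional k₂ →
          T.IsBoundaryFunctional (BoundaryGauge.vary (T.tilde τ₁) k₂) ∧
          T.FunctionalEq
            (T.coupleBracket ((G τ₁).1 + k₁, (G τ₁).2) ((G τ₂).1 + k₂, (G τ₂).2)).1
            ((G (T.bracket τ₁ τ₂)).1 + K τ₁ τ₂ + BoundaryGauge.vary (T.tilde τ₁) k₂ -
              BoundaryGauge.vary (T.tilde τ₂) k₁)) := by
  refine ⟨fun C₁ C₂ τ₁ τ₂ h₁ h₂ => generates_bracket h₁ h₂, fun 𝒢 G hG => ?_⟩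
  have hloc : ∀ τ ∈ 𝒢, ∃ Z Θ, τ = transfL Z Θ := by
    intro τ hτ
    obtain ⟨-, -, Z, Θ, -, h⟩ := (hG.generates τ hτ).exists_bundle
    exact ⟨Z, Θ, h⟩
  have hex : ∀ (Z : Fin m → Loc n m c) (Θ : Fin c → Loc n m c), transfL Z Θ ∈ 𝒢 →
      ∃ (g : Loc n m c) (μ : Fin c → Loc n m c), G (transfL Z Θ) = coupleL g μ ∧
        ((∃ u, T.Adm u) → T.Gen g μ Z Θ) := by
    intro Z Θ h
    have h1 := hG.generates _ h
    exact ⟨⟨_, h1.1.local_G⟩, fun a => ⟨_, h1.1.local_Λ a⟩, rfl,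
      ((T.generates_iff ⟨_, h1.1.local_G⟩ (fun a => ⟨_, h1.1.local_Λ a⟩) Z Θ).1 h1).2⟩
  -- `g` and `μ` are the chosen couples, as functions of the characteristics of the transformation
  choose! g μ hg hgen using hex
  have hvary : ∀ (Z : Fin m → Loc n m c) (Θ : Fin c → Loc n m c) (k : Loc n m c),
      vary (T.tilde (transfL Z Θ)) k.1 = (V (T.tildeL Z Θ) k).1 :=
    fun Z Θ k => (T.vary_tildeL_coe Z Θ k).symm
  have hbr : ∀ {Z₁ Z₂ : Fin m → Loc n m c} {Θ₁ Θ₂ : Fin c → Loc n m c}, transfL Z₁ Θ₁ ∈ 𝒢 →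
      transfL Z₂ Θ₂ ∈ 𝒢 → transfL (T.brZ Z₁ Θ₁ Z₂ Θ₂) (T.brΘ Z₁ Θ₁ Z₂ Θ₂) ∈ 𝒢 := by
    intro Z₁ Z₂ Θ₁ Θ₂ h₁ h₂
    rw [← bracket_transfL]
    exact hG.bracket_mem _ h₁ _ h₂
  -- the density of the extension term
  set κ : (Fin m → Loc n m c) → (Fin c → Loc n m c) → (Fin m → Loc n m c) →
      (Fin c → Loc n m c) → Loc n m c := fun Z₁ Θ₁ Z₂ Θ₂ =>
    T.brG (g Z₁ Θ₁) (μ Z₁ Θ₁) (g Z₂ Θ₂) (μ Z₂ Θ₂) -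
      g (T.brZ Z₁ Θ₁ Z₂ Θ₂) (T.brΘ Z₁ Θ₁ Z₂ Θ₂) with hκ
  have hκb : ∀ {Z₁ Z₂ : Fin m → Loc n m c} {Θ₁ Θ₂ : Fin c → Loc n m c}, transfL Z₁ Θ₁ ∈ 𝒢 →
      transfL Z₂ Θ₂ ∈ 𝒢 → κ Z₁ Θ₁ Z₂ Θ₂ ∈ T.bndry := fun h₁ h₂ =>
    T.mem_bndry_of fun hne => ((hgen _ _ h₁ hne).bracket (hgen _ _ h₂ hne) hne).sub_mem_bndry
      (hgen _ _ (hbr h₁ h₂) hne) hne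
  have hVb : ∀ {Z : Fin m → Loc n m c} {Θ : Fin c → Loc n m c}, transfL Z Θ ∈ 𝒢 →
      ∀ {k : Loc n m c}, k ∈ T.bndry → V (T.tildeL Z Θ) k ∈ T.bndry := fun h _ hk =>
    T.mem_bndry_of fun hne => (hgen _ _ h hne).V_mem_bndry hne hk
  have hK : ∀ {Z₁ Z₂ : Fin m → Loc n m c} {Θ₁ Θ₂ : Fin c → Loc n m c}, transfL Z₁ Θ₁ ∈ 𝒢 →
      transfL Z₂ Θ₂ ∈ 𝒢 → (T.coupleBracket (G (transfL Z₁ Θ₁)) (G (transfL Z₂ Θ₂))).1 -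
        (G (T.bracket (transfL Z₁ Θ₁) (transfL Z₂ Θ₂))).1 = (κ Z₁ Θ₁ Z₂ Θ₂).1 := by
    intro Z₁ Z₂ Θ₁ Θ₂ h₁ h₂
    rw [bracket_transfL, hg _ _ h₁, hg _ _ h₂, hg _ _ (hbr h₁ h₂), coupleBracket_coupleL]
    rfl
  refine ⟨fun τ₁ τ₂ => (T.coupleBracket (G τ₁) (G τ₂)).1 - (G (T.bracket τ₁ τ₂)).1,
    fun τ₁ hτ₁ τ₂ hτ₂ => ?_, fun τ₁ hτ₁ τ₂ hτ₂ => ⟨?_, ?_⟩, fun τ₁ hτ₁ τ₂ hτ₂ => ?_,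
    fun τ₁ hτ₁ τ₂ hτ₂ τ₃ hτ₃ => ?_, fun τ₁ hτ₁ τ₂ hτ₂ k₁ k₂ hk₁ hk₂ => ?_⟩
  · obtain ⟨Z₁, Θ₁, rfl⟩ := hloc τ₁ hτ₁
    obtain ⟨Z₂, Θ₂, rfl⟩ := hloc τ₂ hτ₂
    dsimp only
    rw [hK hτ₁ hτ₂, isBoundaryFunctional_iff]
    exact hκb hτ₁ hτ₂
  · rw [add_sub_cancel]
    exact fun t u _ => rfl
  · exact generates_bracket (hG.generates _ hτ₁) (hG.generates _ hτ₂)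
  · obtain ⟨Z₁, Θ₁, rfl⟩ := hloc τ₁ hτ₁
    obtain ⟨Z₂, Θ₂, rfl⟩ := hloc τ₂ hτ₂
    have h1 := hG.linear _ (hbr hτ₂ hτ₁) _ (hbr hτ₂ hτ₁) (-1) 0
    have h2 : (-1 : ℝ) • transfL (T.brZ Z₂ Θ₂ Z₁ Θ₁) (T.brΘ Z₂ Θ₂ Z₁ Θ₁) +
        (0 : ℝ) • transfL (T.brZ Z₂ Θ₂ Z₁ Θ₁) (T.brΘ Z₂ Θ₂ Z₁ Θ₁) =
        transfL (T.brZ Z₁ Θ₁ Z₂ Θ₂) (T.brΘ Z₁ Θ₁ Z₂ Θ₂) := by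
      rw [zero_smul, add_zero, neg_one_smul, ← bracket_transfL, ← bracket_transfL]
      refine Prod.ext (funext fun A => funext fun p => ?_) (funext fun a => funext fun p => ?_)
      · exact neg_sub _ _
      · exact neg_sub _ _
    rw [h2, hg _ _ (hbr hτ₁ hτ₂), hg _ _ (hbr hτ₂ hτ₁)] at h1
    have h3 : g (T.brZ Z₁ Θ₁ Z₂ Θ₂) (T.brΘ Z₁ Θ₁ Z₂ Θ₂) -
        ((-1 : ℝ) • g (T.brZ Z₂ Θ₂ Z₁ Θ₁) (T.brΘ Z₂ Θ₂ Z₁ Θ₁) +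
          (0 : ℝ) • g (T.brZ Z₂ Θ₂ Z₁ Θ₁) (T.brΘ Z₂ Θ₂ Z₁ Θ₁)) ∈ T.null :=
      T.sub_mem_null_iff.2 h1
    dsimp only
    rw [hK hτ₁ hτ₂, hK hτ₂ hτ₁]
    refine T.sub_mem_null_iff (g := -κ Z₂ Θ₂ Z₁ Θ₁).1 ?_
    convert T.null.neg_mem h3 using 1
    simp only [hκ, brG, zero_smul, neg_one_smul]
    rw [T.poissonL_swap (g Z₂ Θ₂)]
    ring
  · obtain ⟨Z₁, Θ₁, rfl⟩ := hloc τ₁ hτ₁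
    obtain ⟨Z₂, Θ₂, rfl⟩ := hloc τ₂ hτ₂
    obtain ⟨Z₃, Θ₃, rfl⟩ := hloc τ₃ hτ₃
    have h12 := hbr hτ₁ hτ₂
    have h23 := hbr hτ₂ hτ₃
    have h31 := hbr hτ₃ hτ₁
    -- the cyclic sum of the double brackets is a proper gauge transformation, so that its chosen
    -- generator, the cyclic sum of those of the double brackets, vanishes weakly
    have hproper : (∃ u, T.Adm u) →
        g (T.brZ (T.brZ Z₁ Θ₁ Z₂ Θ₂) (T.brΘ Z₁ Θ₁ Z₂ Θ₂) Z₃ Θ₃)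
            (T.brΘ (T.brZ Z₁ Θ₁ Z₂ Θ₂) (T.brΘ Z₁ Θ₁ Z₂ Θ₂) Z₃ Θ₃) +
          g (T.brZ (T.brZ Z₂ Θ₂ Z₃ Θ₃) (T.brΘ Z₂ Θ₂ Z₃ Θ₃) Z₁ Θ₁)
            (T.brΘ (T.brZ Z₂ Θ₂ Z₃ Θ₃) (T.brΘ Z₂ Θ₂ Z₃ Θ₃) Z₁ Θ₁) +
          g (T.brZ (T.brZ Z₃ Θ₃ Z₁ Θ₁) (T.brΘ Z₃ Θ₃ Z₁ Θ₁) Z₂ Θ₂)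
            (T.brΘ (T.brZ Z₃ Θ₃ Z₁ Θ₁) (T.brΘ Z₃ Θ₃ Z₁ Θ₁) Z₂ Θ₂) ∈ T.weak := by
      intro hne
      have h1 := (hgen _ _ hτ₁ hne).jacobi_isProperGauge (hgen _ _ hτ₂ hne) (hgen _ _ hτ₃ hne) hne
      simp only [bracket_transfL] at h1
      have m1 := hbr h12 hτ₃
      have m2 := hbr h23 hτ₁
      have m3 := hbr h31 hτ₂
      have h2 := hG.proper _ (𝒢.add_mem (𝒢.add_mem m1 m2) m3) h1
      have h3 := hG.linear _ m1 _ m2 1 1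
      have h4 := hG.linear _ (𝒢.add_mem m1 m2) _ m3 1 1
      simp only [one_smul] at h3 h4
      have h5 := hG.generates _ (𝒢.add_mem m1 m2)
      rw [hg _ _ m1, hg _ _ m2] at h3
      rw [hg _ _ m3] at h4
      intro t u hu
      have h6 := h4 t u hu.1
      rw [h2 t u hu] at h6
      have h7 := map_add (T.int t hu.1.1) ⟨_, h5.1.local_G⟩
        (g (T.brZ (T.brZ Z₃ Θ₃ Z₁ Θ₁) (T.brΘ Z₃ Θ₃ Z₁ Θ₁) Z₂ Θ₂)
            (T.brΘ (T.brZ Z₃ Θ₃ Z₁ Θ₁) (T.brΘ Z₃ Θ₃ Z₁ Θ₁) Z₂ Θ₂))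
      have h8 := h6.trans h7
      change 0 = T.functional _ t u + T.functional _ t u at h8
      rw [h3 t u hu.1] at h8
      refine Eq.trans (map_add (T.int t hu.1.1) _ _) ?_
      exact h8.symm
    -- one summand of the cocycle condition
    have hS : ∀ {Z₁ Z₂ Z₃ : Fin m → Loc n m c} {Θ₁ Θ₂ Θ₃ : Fin c → Loc n m c},
        transfL Z₁ Θ₁ ∈ 𝒢 → transfL Z₂ Θ₂ ∈ 𝒢 → transfL Z₃ Θ₃ ∈ 𝒢 →
        (T.coupleBracket (G (T.bracket (transfL Z₁ Θ₁) (transfL Z₂ Θ₂))) (G (transfL Z₃ Θ₃))).1 -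
            (G (T.bracket (T.bracket (transfL Z₁ Θ₁) (transfL Z₂ Θ₂)) (transfL Z₃ Θ₃))).1 -
          vary (T.tilde (transfL Z₃ Θ₃))
            ((T.coupleBracket (G (transfL Z₁ Θ₁)) (G (transfL Z₂ Θ₂))).1 -
              (G (T.bracket (transfL Z₁ Θ₁) (transfL Z₂ Θ₂))).1) =
        (κ (T.brZ Z₁ Θ₁ Z₂ Θ₂) (T.brΘ Z₁ Θ₁ Z₂ Θ₂) Z₃ Θ₃ -
          V (T.tildeL Z₃ Θ₃) (κ Z₁ Θ₁ Z₂ Θ₂)).1 := by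
      intro Z₁ Z₂ Z₃ Θ₁ Θ₂ Θ₃ h₁ h₂ h₃
      rw [hK h₁ h₂, hvary, T.bracket_transfL Z₁ Θ₁ Z₂ Θ₂, hK (hbr h₁ h₂) h₃]
      rfl
    dsimp only
    rw [hS hτ₁ hτ₂ hτ₃, hS hτ₂ hτ₃ hτ₁, hS hτ₃ hτ₁ hτ₂]
    set S : Loc n m c := (κ (T.brZ Z₁ Θ₁ Z₂ Θ₂) (T.brΘ Z₁ Θ₁ Z₂ Θ₂) Z₃ Θ₃ -
          V (T.tildeL Z₃ Θ₃) (κ Z₁ Θ₁ Z₂ Θ₂)) +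
        (κ (T.brZ Z₂ Θ₂ Z₃ Θ₃) (T.brΘ Z₂ Θ₂ Z₃ Θ₃) Z₁ Θ₁ -
          V (T.tildeL Z₁ Θ₁) (κ Z₂ Θ₂ Z₃ Θ₃)) +
        (κ (T.brZ Z₃ Θ₃ Z₁ Θ₁) (T.brΘ Z₃ Θ₃ Z₁ Θ₁) Z₂ Θ₂ -
          V (T.tildeL Z₂ Θ₂) (κ Z₃ Θ₃ Z₁ Θ₁)) with hSdef
    refine ⟨(T.isBoundaryFunctional_iff S).2 (T.bndry.add_mem (T.bndry.add_mem
      (T.bndry.sub_mem (hκb h12 hτ₃) (hVb hτ₃ (hκb hτ₁ hτ₂)))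
      (T.bndry.sub_mem (hκb h23 hτ₁) (hVb hτ₁ (hκb hτ₂ hτ₃))))
      (T.bndry.sub_mem (hκb h31 hτ₂) (hVb hτ₂ (hκb hτ₃ hτ₁)))),
      T.mem_weak_of (f := S) fun hne => ?_⟩
    have e1 := hgen _ _ hτ₁ hne
    have e2 := hgen _ _ hτ₂ hne
    have e3 := hgen _ _ hτ₃ hne
    have d1 := T.null_le_weak (T.vanish_le_null
      (e1.double_sub_mem e2 e3 (hgen _ _ h12 hne) hne))
    have d2 := T.null_le_weak (T.vanish_le_null
      (e2.double_sub_mem e3 e1 (hgen _ _ h23 hne) hne))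
    have d3 := T.null_le_weak (T.vanish_le_null
      (e3.double_sub_mem e1 e2 (hgen _ _ h31 hne) hne))
    have d4 := T.weak.sub_mem (e1.ext.jacobi_mem_weak e2.ext e3.ext hne) (hproper hne)
    convert T.weak.add_mem (T.weak.add_mem (T.weak.add_mem d1 d2) d3) d4 using 1
    simp only [hSdef, hκ]
    ring
  · obtain ⟨Z₁, Θ₁, rfl⟩ := hloc τ₁ hτ₁
    obtain ⟨Z₂, Θ₂, rfl⟩ := hloc τ₂ hτ₂
    lift k₁ to Loc n m c using hk₁.1
    lift k₂ to Loc n m c using hk₂.1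
    rw [isBoundaryFunctional_iff] at hk₁ hk₂
    dsimp only
    rw [hvary, hvary, isBoundaryFunctional_iff]
    refine ⟨hVb hτ₁ hk₂, ?_⟩
    rw [add_sub_cancel, hg _ _ hτ₁, hg _ _ hτ₂, coupleBracket_coupleL]
    have h1 : T.coupleBracket ((coupleL (g Z₁ Θ₁) (μ Z₁ Θ₁)).1 + k₁.1, (coupleL (g Z₁ Θ₁) (μ Z₁ Θ₁)).2)
        ((coupleL (g Z₂ Θ₂) (μ Z₂ Θ₂)).1 + k₂.1, (coupleL (g Z₂ Θ₂) (μ Z₂ Θ₂)).2) =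
        coupleL (T.brG (g Z₁ Θ₁ + k₁) (μ Z₁ Θ₁) (g Z₂ Θ₂ + k₂) (μ Z₂ Θ₂))
          (T.brΛ (g Z₁ Θ₁ + k₁) (μ Z₁ Θ₁) (g Z₂ Θ₂ + k₂) (μ Z₂ Θ₂)) :=
      T.coupleBracket_coupleL (g Z₁ Θ₁ + k₁) (μ Z₁ Θ₁) (g Z₂ Θ₂ + k₂) (μ Z₂ Θ₂)
    rw [h1]
    refine T.sub_mem_null_iff (g := T.brG (g Z₁ Θ₁) (μ Z₁ Θ₁) (g Z₂ Θ₂) (μ Z₂ Θ₂) +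
      V (T.tildeL Z₁ Θ₁) k₂ - V (T.tildeL Z₂ Θ₂) k₁).1 (T.mem_null_of fun hne => ?_)
    have e1 := hgen _ _ hτ₁ hne
    have e2 := hgen _ _ hτ₂ hne
    exact T.vanish_le_null (e1.brG_add_sub_mem e2 (E_mem_vanish_of_bndry hne hk₁)
      (E_mem_vanish_of_bndry hne hk₂) e1.lam e2.lam)
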